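/- Let $\Psi:\mathbb{R}\to[0,1]$ be a shape, that is, $\Psi$ is differentiable, $\Psi'\le 0$ is Riemann integrable, $\Psi\in L^1(0,\infty)$ and $1-\Psi\in L^1(-\infty,0)$. Let $\tau>0$ and $0<\delta<\alpha<1$. For real $N>0$ put $$K^N_{\Psi,\alpha}(x,y)=\sum_{k=0}^\infty\Psi\Big(\frac{k-N}{\tau N^\alpha}\Big)\varphi_k(x)\varphi_k(y),\qquad \varphi_k(x)=\sqrt{\tfrac{\pi\sqrt N}{\sqrt2}}\;h_k\Big(x\,\tfrac{\pi\sqrt N}{\sqrt2}\Big),$$ where $h_k(x)=e^{x^2/2}\frac{(-1)^k}{\sqrt{k!\,2^k\sqrt\pi}}\frac{d^k}{dx^k}e^{-x^2}$ are the Hermite functions, and let $\Xi=\sum_i\delta_{X_i}$ be a determinantal point process on $\mathbb{R}$ (with respect to Lebesgue measure) with correlation kernel $K^N_{\Psi,\alpha}$ (a modified GUE). Let $f:\mathbb{R}\to\mathbb{R}$ have compact support and belong to $H^{1/2}(\mathbb{R})$, that is, $f\in L^2(\mathbb{R})$ and $\iint\big|\frac{f(x)-f(y)}{x-y}\big|^2dx\,dy<\infty$,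 and let $\Xi f_\delta=\sum_i f(X_iN^\delta)$. Put $$\operatorname{B}^2_\Psi=\int_{\mathbb{R}}\Psi(x)\big(1-\Psi(x)\big)\,dx .$$ Then $0<\operatorname{B}^2_\Psi<\infty$, the random variable $\Xi f_\delta$ has a finite second moment for every $N>0$, and as $N\to\infty$ $$\operatorname{Var}_{K^N_{\Psi,\alpha}}[\Xi f_\delta]=\frac{\tau}{2}\,N^{\alpha-\delta}\operatorname{B}^2_\Psi\int_{\mathbb{R}}f(x)^2\,dx+o(N^{\alpha-\delta}),$$ $$N^{-\frac{\alpha-\delta}{2}}\Big(\Xi f_\delta-\mathbb{E}_{K^N_{\Psi,\alpha}}[\Xi f_\delta]\Big)\ \Rightarrow\ \mathcal{N}\Big(0,\ \frac{\tau}{2}\operatorname{B}^2_\Psi\,\|f\|_{L^2}^2\Big)\quad\text{in distribution.}$$ -/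

import Mathlib

open MeasureTheory ProbabilityTheory Filter Asymptotics
open scoped ENNReal NNReal Topology Nat

noncomputable section

namespace ModifiedGUE

/-- A (simple) point process on the real line: a random set of points without accumulation points,
such that the number of points in every Borel set is a random variable. -/
structure PointProcess (Ω : Type*) [MeasurableSpace Ω] where
  /-- The point configuration `(X_i)` of the outcome `ω`. -/
  points : Ω → Set ℝ
  locallyFinite : ∀ ω, ∀ C : Set ℝ, IsCompact C → (points ω ∩ C).Finite
  measurable_count : ∀ B : Set ℝ, MeasurableSet B → Measurable fun ω => (points ω ∩ B).encard

namespace PointProcess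

variable {Ω : Type*} [MeasurableSpace Ω]

/-- `ρ` is the `n`-point correlation function of `Ξ` with respect to Lebesgue measure: for every
measurable `F ≥ 0`, the expectation of the sum of `F (X_{i_1}, …, X_{i_n})` over all `n`-tuples of
pairwise distinct points of the configuration is `∫ F ρ`. -/
def IsCorrelationFunction (Ξ : PointProcess Ω) (P : Measure Ω) (n : ℕ)
    (ρ : (Fin n → ℝ) → ℝ) : Prop :=
  (∀ᵐ x, 0 ≤ ρ x) ∧
  ∀ F : (Fin n → ℝ) → ℝ≥0∞, Measurable F →
    ∫⁻ ω, (∑' x : {x : Fin n → ℝ // Function.Injective x ∧ ∀ i, x i ∈ Ξ.points ω}, F x) ∂P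
      = ∫⁻ x, F x * ENNReal.ofReal (ρ x)

/-- `Ξ` is a determinantal point process with correlation kernel `K`
(with respect to Lebesgue measure). -/
def IsDeterminantal (Ξ : PointProcess Ω) (P : Measure Ω) (K : ℝ → ℝ → ℝ) : Prop :=
  ∀ n : ℕ, Ξ.IsCorrelationFunction P n
    fun x => (Matrix.of fun i j : Fin n => K (x i) (x j)).det

/-- The linear statistic `Ξ f = ∑ i, f (X_i)`. The sum is finite when `f` has compact support. -/
def linearStatistic (Ξ : PointProcess Ω) (f : ℝ → ℝ) (ω : Ω) : ℝ :=
  ∑ᶠ x ∈ Ξ.points ω, f x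

end PointProcess

/-- The rescaled test function `f_δ (x) = f (x N ^ δ)`. -/
def rescale (f : ℝ → ℝ) (N δ : ℝ) (x : ℝ) : ℝ := f (x * N ^ δ)

/-- The `n`-th (orthonormal) Hermite function. -/
def hermiteFun (n : ℕ) (x : ℝ) : ℝ :=
  Real.exp (x ^ 2 / 2) * ((-1) ^ n / √((n ! : ℝ) * 2 ^ n * √Real.pi)) *
    iteratedDeriv n (fun t : ℝ => Real.exp (-t ^ 2)) x

/-- The rescaled Hermite functions `φ_k`. -/
def hermiteScaled (N : ℝ) (k : ℕ) (x : ℝ) : ℝ :=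
  √(Real.pi * √N / √2) * hermiteFun k (x * (Real.pi * √N / √2))

/-- The class of shapes. The derivative is Riemann integrable on every bounded interval; its
improper integral over the line then converges, since it is nonpositive and `Ψ` is bounded. -/
structure IsShape (Ψ : ℝ → ℝ) : Prop where
  mem_Icc : ∀ t, Ψ t ∈ Set.Icc (0 : ℝ) 1
  differentiable : Differentiable ℝ Ψ
  deriv_nonpos : ∀ t, deriv Ψ t ≤ 0
  riemannIntegrable_deriv : ∀ I : BoxIntegral.Box (Fin 1),
    BoxIntegral.Integrable I BoxIntegral.IntegrationParams.Riemann (fun t => deriv Ψ (t 0))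
      BoxIntegral.BoxAdditiveMap.volume
  integrable_right : IntegrableOn Ψ (Set.Ioi 0)
  integrable_left : IntegrableOn (fun t => 1 - Ψ t) (Set.Iio 0)

/-- The correlation kernel of the modified GUE with shape `Ψ`, temperature `τ`, modification
scale `α` and density parameter `N`. -/
def kernel (Ψ : ℝ → ℝ) (τ α N : ℝ) (x y : ℝ) : ℝ :=
  ∑' k : ℕ, Ψ (((k : ℝ) - N) / (τ * N ^ α)) * hermiteScaled N k x * hermiteScaled N k y

/-- The constant `B²_Ψ = ∫ Ψ (1 - Ψ)`. -/
def shapeConst (Ψ : ℝ → ℝ) : ℝ := ∫ t, Ψ t * (1 - Ψ t)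

/-- Membership in `H^{1/2}(ℝ)`: `f` is in `L²` and its Gagliardo seminorm
`∬ |(f x - f y) / (x - y)|² dx dy` is finite. -/
structure MemHHalf (f : ℝ → ℝ) : Prop where
  memLp : MemLp f 2
  seminorm_lt_top :
    ∫⁻ x : ℝ, ∫⁻ y : ℝ, ENNReal.ofReal (((f x - f y) / (x - y)) ^ 2) < ∞

end ModifiedGUE

end

/-! The kernel is diagonal in the orthonormal functions φ_k, with eigenvalues p_k = Ψ((k -
N)/(τN^α)) in [0, 1]. For g = f_δ and a finite truncation of the kernel, the variance splits exactly
(`trace_gram_eq`, `integral_offDiagonal`) as Σ p_k (1 - p_k) ∫ g² φ_k² + ½ ∬ (g(x) - g(y))² K(x,y)²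
dx dy.

The first term carries the asymptotics. The weight p_k (1 - p_k) selects a window of width τN^α
around the index N, and for k ~ N the local averages of φ_k² at scale N^(-δ) tend to 1/2
(`tendsto_local_average`). A Riemann sum then gives τ/2 · B² ∫ f² (`tendsto_diagonal`). The local
average comes from the oscillator energy h'² + (2k + 1 - x²) h². It is almost constant near 0, it is
shared equally on average by its two terms, and its value at 0 is given by the Wallis product.

The second term is o(N^(α-δ)). Summation by parts and Christoffel–Darboux bound (x - y) K(x,y)
uniformly near the origin, so the double integral is controlled by the H^{1/2} seminorm, which is
invariant under dilation (`IsCutoff.offDiagonal_le`, `gagliardo_comp_mul`). Indices below N/4, where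
the pointwise bounds on φ_k fail, contribute little because 1 - p_k = o(N^(α-1)) there
(`tendsto_one_sub_eig_cut`).

For the central limit theorem let |f| ≤ C. The logarithm L(s) of the Laplace transform is a limit of
log-determinants satisfying |L'''| ≤ 2C L'', so L(s) - sL'(0) equals s²/2 times the variance up to
factors exp(±2C|s|) (`log_det_tilt_bound`). After normalization s is replaced by a quantity tending
to 0, so the Laplace transforms converge to a Gaussian one. A power series argument passes to
characteristic functions (`tendsto_charFun_of_tendsto_mgf`). An unbounded f is truncated by `clamp`,
and the remainder is small in L² by the variance asymptotics themselves. -/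

noncomputable section

namespace ModifiedGUE

/-! ### Determinants and traces: expansions, derivatives, positivity. -/

/-- **Hadamard's inequality** for positive semidefinite matrices. -/
theorem det_le_prod_diag {n : Type*} [Fintype n] [DecidableEq n] {A : Matrix n n ℝ}
    (hA : A.PosSemidef) : A.det ≤ ∏ i, A i i := by
  by_cases h0 : ∃ i, A i i = 0
  · obtain ⟨i, hi⟩ := h0
    have hz : A.mulVec (Pi.single i 1) = 0 := by
      rw [← hA.dotProduct_mulVec_zero_iff]
      simp [hi]
    rw [Matrix.det_eq_zero_of_column_eq_zero i fun j => by
      have := congrFun hz j; simpa using this]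
    exact Finset.prod_nonneg fun j _ => hA.diag_nonneg
  push Not at h0
  have hpos : ∀ i, 0 < A i i := fun i => lt_of_le_of_ne hA.diag_nonneg (h0 i).symm
  -- Rescaling to unit diagonal reduces the claim to det ≤ 1, which follows from λ ≤ exp(λ - 1)
  -- because the eigenvalues sum to the dimension.
  set D : Matrix n n ℝ := Matrix.diagonal fun i => (√(A i i))⁻¹ with hD
  have hB : (D.conjTranspose * A * D).PosSemidef := hA.conjTranspose_mul_mul_same D
  have hDt : D.conjTranspose = D := by simp [hD]
  rw [hDt] at hB
  have hdiag : ∀ i, (D * A * D) i i = 1 := fun i => by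
    have := Real.mul_self_sqrt (hpos i).le
    have h2 : √(A i i) ≠ 0 := (Real.sqrt_pos.2 (hpos i)).ne'
    simp only [hD, Matrix.mul_diagonal, Matrix.diagonal_mul]
    field_simp
    nlinarith
  have hle : (D * A * D).det ≤ 1 := by
    have hd := hB.1.det_eq_prod_eigenvalues
    have ht := hB.1.trace_eq_sum_eigenvalues
    simp only [RCLike.ofReal_real_eq_id, id_eq] at hd ht
    rw [hd]
    calc ∏ i, hB.1.eigenvalues i ≤ ∏ i, Real.exp (hB.1.eigenvalues i - 1) :=
          Finset.prod_le_prod (fun i _ => hB.eigenvalues_nonneg i) fun i _ => by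
            have := Real.add_one_le_exp (hB.1.eigenvalues i - 1); linarith
      _ = 1 := by
          rw [← Real.exp_sum, Finset.sum_sub_distrib, ← ht, Matrix.trace]
          simp [hdiag]
  have hdet : (D * A * D).det * ∏ i, A i i = A.det := by
    rw [Matrix.det_mul, Matrix.det_mul, hD, Matrix.det_diagonal]
    have h1 : (∏ i, (√(A i i))⁻¹) * (∏ i, (√(A i i))⁻¹) * ∏ i, A i i = 1 := by
      rw [← Finset.prod_mul_distrib, ← Finset.prod_mul_distrib]
      refine Finset.prod_eq_one fun i _ => ?_
      have := Real.mul_self_sqrt (hpos i).le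
      have h2 : √(A i i) ≠ 0 := (Real.sqrt_pos.2 (hpos i)).ne'
      field_simp
      nlinarith
    linear_combination A.det * h1
  rw [← hdet]
  have : 0 ≤ ∏ i, A i i := Finset.prod_nonneg fun i _ => (hpos i).le
  nlinarith

/-- Each n-subset is the range of exactly n! injections. This links the ordered tuples of
correlation functions and Fredholm series to subsets of points and principal minors. -/
theorem sum_embedding_eq {α : Type*} [Fintype α] [DecidableEq α] (n : ℕ) (h : Finset α → ℝ) :
    ∑ e : Fin n ↪ α, h (Finset.univ.map e)
      = n ! * ∑ U ∈ Finset.powersetCard n Finset.univ, h U := by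
  classical
  rw [← Finset.sum_fiberwise_of_maps_to (s := Finset.univ)
    (t := Finset.powersetCard n (Finset.univ : Finset α)) (g := fun e => Finset.univ.map e)
    (fun e _ => by simp [Finset.mem_powersetCard]), Finset.mul_sum]
  refine Finset.sum_congr rfl fun U hU => ?_
  rw [Finset.sum_congr rfl (g := fun _ => h U)
    (fun e he => by rw [(Finset.mem_filter.1 he).2]), Finset.sum_const, nsmul_eq_mul]
  congr 2
  have hUc : U.card = n := (Finset.mem_powersetCard.1 hU).2
  have h1 : Fintype.card (Fin n ↪ U) = n ! := by
    rw [Fintype.card_embedding_eq, Fintype.card_coe, hUc, Fintype.card_fin, Nat.descFactorial_self]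
  rw [← h1, ← Finset.card_univ]
  symm
  refine Finset.card_bij (fun e _ => e.trans (Function.Embedding.subtype _)) ?_ ?_ ?_
  · intro e _
    refine Finset.mem_filter.2 ⟨Finset.mem_univ _, ?_⟩
    refine Finset.eq_of_subset_of_card_le (fun x hx => ?_) (by simp [hUc])
    obtain ⟨i, _, rfl⟩ := Finset.mem_map.1 hx
    exact (e i).2
  · intro e _ e' _ hee
    ext i
    exact DFunLike.congr_fun hee i
  · intro e he
    have hm := (Finset.mem_filter.1 he).2
    refine ⟨⟨fun i => ⟨e i, ?_⟩, fun i j hij => ?_⟩, Finset.mem_univ _, ?_⟩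
    · rw [← hm]; exact Finset.mem_map_of_mem _ (Finset.mem_univ i)
    · exact e.injective (Subtype.ext_iff.1 hij)
    · ext i; rfl

/-- Fredholm expansion. Non-injective κ repeat a row and vanish, the others give each principal
minor n! times, and only finitely many n contribute. -/
theorem det_one_add_eq_sum {M : ℕ} (A : Matrix (Fin M) (Fin M) ℝ) :
    HasSum (fun n : ℕ => (n ! : ℝ)⁻¹ * ∑ κ : Fin n → Fin M, (A.submatrix κ κ).det)
      (1 + A).det := by
  classical
  have key : ∀ n : ℕ, (n ! : ℝ)⁻¹ * ∑ κ : Fin n → Fin M, (A.submatrix κ κ).det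
      = (Matrix.det (1 + (Polynomial.X : Polynomial ℝ) • A.map Polynomial.C)).coeff n := by
    intro n
    rw [Matrix.coeff_det_one_add_X_smul_eq_sum_minors]
    have h1 : ∑ κ : Fin n → Fin M, (A.submatrix κ κ).det
        = ∑ e : Fin n ↪ Fin M, (A.submatrix e e).det := by
      symm
      refine Finset.sum_of_injOn (fun e => (e : Fin n → Fin M)) ?_ (by simp) ?_ (by simp)
      · intro e _ e' _ h; exact DFunLike.coe_injective h
      · intro κ _ hκ
        have : ¬ Function.Injective κ := fun hinj => hκ ⟨⟨κ, hinj⟩, by simp, rfl⟩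
        simp only [Function.Injective, not_forall] at this
        obtain ⟨i, j, hij, hne⟩ := this
        exact Matrix.det_zero_of_row_eq hne (by ext l; simp [hij])
    have h2 : ∀ e : Fin n ↪ Fin M, (A.submatrix e e).det
        = (A.submatrix (Subtype.val : ↥(Finset.univ.map e) → Fin M)
            Subtype.val).det := by
      intro e
      let E : Fin n ≃ ↥(Finset.univ.map e) :=
        Equiv.ofBijective (fun i => ⟨e i, Finset.mem_map_of_mem _ (Finset.mem_univ i)⟩)
          ⟨fun i j h => e.injective (Subtype.ext_iff.1 h), fun ⟨x, hx⟩ => by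
            obtain ⟨i, _, rfl⟩ := Finset.mem_map.1 hx
            exact ⟨i, rfl⟩⟩
      rw [← Matrix.det_submatrix_equiv_self E, Matrix.submatrix_submatrix]
      rfl
    rw [h1, Finset.sum_congr rfl fun e _ => h2 e,
      sum_embedding_eq n fun U : Finset (Fin M) =>
        (A.submatrix (Subtype.val : U → Fin M) Subtype.val).det, ← mul_assoc,
      inv_mul_cancel₀ (by positivity), one_mul]
  simp_rw [key]
  set P := Matrix.det (1 + (Polynomial.X : Polynomial ℝ) • A.map Polynomial.C) with hP
  have he : (1 + A).det = P.eval 1 := by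
    rw [hP, ← Polynomial.coe_evalRingHom, RingHom.map_det]
    congr 1
    ext i j
    by_cases hij : i = j <;> simp [hij]
  rw [he, Polynomial.eval_eq_sum_range]
  simp only [one_pow, mul_one]
  refine hasSum_sum_of_ne_finset_zero fun n hn => ?_
  exact Polynomial.coeff_eq_zero_of_natDegree_lt (by simpa using hn)

/-- Andréief's identity: after expanding the determinant over permutations and the kernel over its
eigenfunctions, each term is a product of one-variable integrals. -/
theorem integral_prod_mul_det {M n : ℕ} (ψ : Fin M → ℝ → ℝ) (g : ℝ → ℝ)
    (hint : ∀ j k, Integrable fun x => g x * (ψ j x * ψ k x)) :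
    ∫ x : Fin n → ℝ, (∏ i, g (x i)) *
        (Matrix.of fun i j => ∑ k, ψ k (x i) * ψ k (x j)).det
      = ∑ κ : Fin n → Fin M,
        ((Matrix.of fun j k => ∫ x, g x * (ψ j x * ψ k x)).submatrix κ κ).det := by
  have h1 : ∀ x : Fin n → ℝ, (∏ i, g (x i)) *
      (Matrix.of fun i j => ∑ k, ψ k (x i) * ψ k (x j)).det
      = ∑ κ : Fin n → Fin M, ∑ σ : Equiv.Perm (Fin n), ((Equiv.Perm.sign σ : ℤ) : ℝ) *
          ∏ i, (g (x i) * (ψ (κ (σ i)) (x i) * ψ (κ i) (x i))) := by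
    intro x
    rw [Matrix.det_apply', Finset.mul_sum, Finset.sum_comm,
      ← Equiv.sum_comp (Equiv.inv (Equiv.Perm (Fin n)))]
    refine Finset.sum_congr rfl fun σ _ => ?_
    simp only [Matrix.of_apply, Equiv.inv_apply, Equiv.Perm.sign_inv]
    rw [Finset.prod_univ_sum, Finset.mul_sum, Finset.mul_sum, Fintype.piFinset_univ]
    refine Finset.sum_congr rfl fun κ _ => ?_
    rw [Finset.prod_mul_distrib, Finset.prod_mul_distrib, Finset.prod_mul_distrib]
    have : ∏ i, ψ (κ (σ i)) (x i) = ∏ i, ψ (κ i) (x (σ⁻¹ i)) := by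
      simpa using Equiv.prod_comp σ fun i => ψ (κ i) (x (σ⁻¹ i))
    rw [← this]
    ring
  have hi : ∀ (κ : Fin n → Fin M) (σ : Equiv.Perm (Fin n)), Integrable fun x : Fin n → ℝ =>
      ((Equiv.Perm.sign σ : ℤ) : ℝ) *
        ∏ i, (g (x i) * (ψ (κ (σ i)) (x i) * ψ (κ i) (x i))) := fun κ σ =>
    (Integrable.fintype_prod (f := fun i y => g y * (ψ (κ (σ i)) y * ψ (κ i) y))
      fun i => hint _ _).const_mul _
  simp_rw [h1]
  rw [integral_finsetSum _ fun κ _ => integrable_finsetSum _ fun σ _ => hi κ σ]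
  refine Finset.sum_congr rfl fun κ _ => ?_
  rw [integral_finsetSum _ fun σ _ => hi κ σ, Matrix.det_apply']
  refine Finset.sum_congr rfl fun σ _ => ?_
  rw [integral_const_mul, integral_fintype_prod_volume_eq_prod
    (f := fun i y => g y * (ψ (κ (σ i)) y * ψ (κ i) y))]
  rfl

/-- Jacobi's formula: differentiating one column at a time gives Cramer determinants, which are the
diagonal entries of adj(G) G'. -/
theorem hasDerivAt_det {m : Type*} [Fintype m] [DecidableEq m] {G : ℝ → Matrix m m ℝ}
    {G' : Matrix m m ℝ} {s : ℝ} (h : ∀ i j, HasDerivAt (fun t => G t i j) (G' i j) s) :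
    HasDerivAt (fun t => (G t).det) ((G s).adjugate * G').trace s := by
  have h1 : HasDerivAt (fun t => ∑ σ : Equiv.Perm m, ((Equiv.Perm.sign σ : ℤ) : ℝ) *
      ∏ i, G t (σ i) i) (∑ σ : Equiv.Perm m, ((Equiv.Perm.sign σ : ℤ) : ℝ) *
      ∑ i, (∏ j ∈ Finset.univ.erase i, G s (σ j) j) • G' (σ i) i) s :=
    HasDerivAt.fun_sum fun σ _ => (HasDerivAt.fun_finsetProd fun i _ => h (σ i) i).const_mul _
  have h2 : (fun t => (G t).det) = fun t => ∑ σ : Equiv.Perm m, ((Equiv.Perm.sign σ : ℤ) : ℝ) *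
      ∏ i, G t (σ i) i := funext fun t => Matrix.det_apply' _
  rw [h2]
  convert h1 using 1
  simp_rw [Matrix.trace, Matrix.diag, Finset.mul_sum]
  rw [Finset.sum_comm]
  refine Finset.sum_congr rfl fun i _ => ?_
  have h3 : ((G s).adjugate * G') i i = ((G s).updateCol i fun j => G' j i).det := by
    rw [← Matrix.cramer_apply, Matrix.cramer_eq_adjugate_mulVec]
    rfl
  rw [h3, Matrix.det_apply']
  refine Finset.sum_congr rfl fun σ _ => ?_
  rw [← Finset.mul_prod_erase _ _ (Finset.mem_univ i), Matrix.updateCol_self, smul_eq_mul,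
    mul_comm (G' _ _)]
  congr 2
  exact Finset.prod_congr rfl fun j hj => by
    rw [Matrix.updateCol_ne (Finset.ne_of_mem_erase hj)]

theorem hasDerivAt_matrix_mul {m : Type*} [Fintype m] {G H : ℝ → Matrix m m ℝ}
    {G' H' : Matrix m m ℝ} {s : ℝ} (hG : ∀ i j, HasDerivAt (fun t => G t i j) (G' i j) s)
    (hH : ∀ i j, HasDerivAt (fun t => H t i j) (H' i j) s) (i j : m) :
    HasDerivAt (fun t => (G t * H t) i j) ((G' * H s + G s * H') i j) s := by
  simp only [Matrix.mul_apply, Matrix.add_apply, ← Finset.sum_add_distrib]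
  exact HasDerivAt.fun_sum fun k _ => (hG i k).mul (hH k j)

/-- Cramer's rule shows that the entries are differentiable; differentiating G⁻¹ G = 1 then
identifies the derivative. -/
theorem hasDerivAt_matrix_inv {m : Type*} [Fintype m] [DecidableEq m] {G : ℝ → Matrix m m ℝ}
    {G' : Matrix m m ℝ} {s : ℝ} (h : ∀ i j, HasDerivAt (fun t => G t i j) (G' i j) s)
    (hdet : ∀ t, (G t).det ≠ 0) (i j : m) :
    HasDerivAt (fun t => (G t)⁻¹ i j) ((-((G s)⁻¹ * G' * (G s)⁻¹)) i j) s := by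
  have hd : ∀ i j, ∃ d, HasDerivAt (fun t => (G t)⁻¹ i j) d s := by
    intro i j
    have h1 : ∀ t, (G t)⁻¹ i j = (G t).det⁻¹ * ((G t).updateRow j (Pi.single i 1)).det := by
      intro t
      rw [Matrix.inv_def, Matrix.smul_apply, Matrix.adjugate_apply, Ring.inverse_eq_inv',
        smul_eq_mul]
    simp_rw [h1]
    refine ⟨_, (((hasDerivAt_det h).inv (hdet s)).mul (hasDerivAt_det
      (G' := Matrix.of fun a b => if a = j then 0 else G' a b) fun a b => ?_))⟩
    by_cases haj : a = j
    · subst haj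
      simpa using hasDerivAt_const s ((Pi.single i 1 : m → ℝ) b)
    · simpa [Matrix.updateRow_ne haj, haj] using h a b
  choose R' hR' using hd
  have hprod := hasDerivAt_matrix_mul (G' := Matrix.of R') hR' h
  have hone : ∀ t, (G t)⁻¹ * G t = 1 := fun t =>
    Matrix.nonsing_inv_mul _ (isUnit_iff_ne_zero.2 (hdet t))
  have hzero : Matrix.of R' * G s + (G s)⁻¹ * G' = 0 := by
    ext a b
    have := hprod a b
    simp only [hone] at this
    exact this.unique (hasDerivAt_const s _)
  have hR : Matrix.of R' = -((G s)⁻¹ * G' * (G s)⁻¹) := by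
    have h2 : Matrix.of R' * G s * (G s)⁻¹ = -((G s)⁻¹ * G') * (G s)⁻¹ := by
      rw [eq_neg_of_add_eq_zero_left hzero]
    rwa [Matrix.mul_assoc, Matrix.mul_nonsing_inv _ (isUnit_iff_ne_zero.2 (hdet s)),
      Matrix.mul_one, Matrix.neg_mul] at h2
  rw [← hR]
  exact hR' i j

open scoped MatrixOrder Matrix.Norms.L2Operator in
-- Write P = B*B; then tr(PQ) = tr(BQB*), the trace of a positive semidefinite matrix.
theorem trace_mul_nonneg {m : Type*} [Fintype m] [DecidableEq m] {P Q : Matrix m m ℝ}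
    (hP : P.PosSemidef) (hQ : Q.PosSemidef) : 0 ≤ (P * Q).trace := by
  obtain ⟨B, rfl⟩ := (CStarAlgebra.nonneg_iff_eq_star_mul_self (a := P)).1 hP.nonneg
  rw [Matrix.mul_assoc, Matrix.trace_mul_comm]
  exact (hQ.mul_mul_conjTranspose_same B).trace_nonneg

/-- By Grönwall, L'' e^{-at} decreases and L'' e^{at} increases, so L'' lies between L''(0) e^{-as}
and L''(0) e^{as} on [0, s]. Two integrations give the Taylor bounds. -/
theorem bound_of_third_derivative {L L₁ L₂ L₃ : ℝ → ℝ} {a : ℝ}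
    (h₀ : L 0 = 0) (h₁ : ∀ s, HasDerivAt L (L₁ s) s) (h₂ : ∀ s, HasDerivAt L₁ (L₂ s) s)
    (h₃ : ∀ s, HasDerivAt L₂ (L₃ s) s) (hb : ∀ s, |L₃ s| ≤ a * L₂ s) {s : ℝ} (hs : 0 ≤ s)
    (hpos : 0 ≤ L₂ 0) (ha : 0 ≤ a) :
    s ^ 2 / 2 * (L₂ 0 * Real.exp (-(a * s))) ≤ L s - s * L₁ 0 ∧
      L s - s * L₁ 0 ≤ s ^ 2 / 2 * (L₂ 0 * Real.exp (a * s)) := by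
  have up : ∀ u, 0 ≤ u → L₂ u ≤ L₂ 0 * Real.exp (a * u) := by
    intro u hu
    have hd : ∀ t, HasDerivAt (fun t => L₂ t * Real.exp (-(a * t)))
        (L₃ t * Real.exp (-(a * t)) + L₂ t * (Real.exp (-(a * t)) * -(a * 1))) t := fun t =>
      (h₃ t).mul (((hasDerivAt_id t).const_mul a).neg.exp)
    have := antitone_of_hasDerivAt_nonpos hd (fun t => by
      have := (abs_le.1 (hb t)).2
      have := Real.exp_pos (-(a * t))
      simp only [Pi.zero_apply]
      nlinarith) hu
    simp only [mul_zero, neg_zero, Real.exp_zero, mul_one] at this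
    rw [Real.exp_neg] at this
    rwa [← div_eq_mul_inv, div_le_iff₀ (Real.exp_pos _)] at this
  have lo : ∀ u, 0 ≤ u → L₂ 0 * Real.exp (-(a * u)) ≤ L₂ u := by
    intro u hu
    have hd : ∀ t, HasDerivAt (fun t => L₂ t * Real.exp (a * t))
        (L₃ t * Real.exp (a * t) + L₂ t * (Real.exp (a * t) * (a * 1))) t := fun t =>
      (h₃ t).mul (((hasDerivAt_id t).const_mul a).exp)
    have := monotone_of_hasDerivAt_nonneg hd (fun t => by
      have := (abs_le.1 (hb t)).1
      have := Real.exp_pos (a * t)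
      simp only [Pi.zero_apply]
      nlinarith) hu
    simp only [mul_zero, Real.exp_zero, mul_one] at this
    rw [Real.exp_neg]
    rwa [← div_eq_mul_inv, div_le_iff₀ (Real.exp_pos _)]
  -- The sign ε = ±1 treats the upper and the lower bound by one argument.
  have quad : ∀ (ε B : ℝ), (∀ u ∈ Set.Icc 0 s, ε * L₂ u ≤ ε * B) →
      ε * (L s - s * L₁ 0) ≤ ε * (s ^ 2 / 2 * B) := by
    intro ε B hB
    have hd1 : ∀ t, HasDerivAt (fun t => ε * (L₁ t - L₁ 0 - t * B)) (ε * (L₂ t - 1 * B)) t :=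
      fun t => (((h₂ t).sub_const _).sub ((hasDerivAt_id t).mul_const B)).const_mul ε
    have hd0 : ∀ t, HasDerivAt (fun t => ε * (L t - t * L₁ 0 - t ^ 2 / 2 * B))
        (ε * (L₁ t - L₁ 0 - t * B)) t := fun t => by
      convert! (((h₁ t).sub ((hasDerivAt_id t).mul_const (L₁ 0))).sub
        ((((hasDerivAt_id t).pow 2).div_const 2).mul_const B)).const_mul ε using 1
      simp
    have a1 : AntitoneOn (fun t => ε * (L₁ t - L₁ 0 - t * B)) (Set.Icc 0 s) :=
      antitoneOn_of_hasDerivWithinAt_nonpos (convex_Icc 0 s)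
        (fun t _ => (hd1 t).continuousAt.continuousWithinAt)
        (fun t _ => (hd1 t).hasDerivWithinAt) fun t ht => by
          have := hB t (interior_subset ht); linarith
    have a0 : AntitoneOn (fun t => ε * (L t - t * L₁ 0 - t ^ 2 / 2 * B)) (Set.Icc 0 s) :=
      antitoneOn_of_hasDerivWithinAt_nonpos (convex_Icc 0 s)
        (fun t _ => (hd0 t).continuousAt.continuousWithinAt)
        (fun t _ => (hd0 t).hasDerivWithinAt) fun t ht => by
          have := a1 ⟨le_rfl, hs⟩ (interior_subset ht) (interior_subset ht).1
          simpa using this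
    have := a0 ⟨le_rfl, hs⟩ ⟨hs, le_rfl⟩ hs
    simp [h₀] at this
    linarith
  constructor
  · have := quad (-1) (L₂ 0 * Real.exp (-(a * s))) fun u hu => by
      have h := lo u hu.1
      have : Real.exp (-(a * s)) ≤ Real.exp (-(a * u)) :=
        Real.exp_le_exp.2 (neg_le_neg (mul_le_mul_of_nonneg_left hu.2 ha))
      nlinarith
    linarith
  · have := quad 1 (L₂ 0 * Real.exp (a * s)) fun u hu => by
      have h := up u hu.1
      have : Real.exp (a * u) ≤ Real.exp (a * s) :=
        Real.exp_le_exp.2 (mul_le_mul_of_nonneg_left hu.2 ha)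
      nlinarith
    linarith

/-! ### Gram matrices and exponential tilting. -/

/-- The matrix of the compression of the multiplication by `h` to the functions `ψ`. -/
def gram {M : ℕ} (ψ : Fin M → ℝ → ℝ) (h : ℝ → ℝ) : Matrix (Fin M) (Fin M) ℝ :=
  Matrix.of fun j k => ∫ x, h x * (ψ j x * ψ k x)

section Gram

variable {M : ℕ} {ψ : Fin M → ℝ → ℝ}

theorem integrable_mul_mul (hψ : ∀ j, MemLp (ψ j) 2) {h : ℝ → ℝ} (hh : Measurable h) {B : ℝ}
    (hB : ∀ x, |h x| ≤ B) (j k : Fin M) : Integrable fun x => h x * (ψ j x * ψ k x) :=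
  ((hψ j).integrable_mul (hψ k)).bdd_mul hh.aestronglyMeasurable (ae_of_all _ hB)

theorem gram_isHermitian (h : ℝ → ℝ) : (gram ψ h).IsHermitian := by
  ext j k
  simp only [gram, Matrix.conjTranspose_apply, Matrix.of_apply, star_trivial]
  simp_rw [mul_comm (ψ k _)]

theorem gram_form (hψ : ∀ j, MemLp (ψ j) 2) {h : ℝ → ℝ} (hh : Measurable h) {B : ℝ}
    (hB : ∀ x, |h x| ≤ B) (v w : Fin M → ℝ) :
    Integrable (fun x => h x * ((∑ j, v j * ψ j x) * ∑ k, w k * ψ k x)) ∧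
    v ⬝ᵥ (gram ψ h).mulVec w = ∫ x, h x * ((∑ j, v j * ψ j x) * ∑ k, w k * ψ k x) := by
  have e : ∀ x, h x * ((∑ j, v j * ψ j x) * ∑ k, w k * ψ k x)
      = ∑ j, ∑ k, v j * (h x * (ψ j x * ψ k x) * w k) := by
    intro x
    rw [Finset.sum_mul_sum, Finset.mul_sum]
    refine Finset.sum_congr rfl fun j _ => ?_
    rw [Finset.mul_sum]
    exact Finset.sum_congr rfl fun k _ => by ring
  have hi := fun j k => ((integrable_mul_mul hψ hh hB j k).mul_const (w k)).const_mul (v j)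
  simp_rw [e]
  refine ⟨integrable_finsetSum _ fun j _ => integrable_finsetSum _ fun k _ => hi j k, ?_⟩
  rw [integral_finsetSum _ fun j _ => integrable_finsetSum _ fun k _ => hi j k]
  refine Finset.sum_congr rfl fun j _ => ?_
  rw [integral_finsetSum _ fun k _ => hi j k]
  simp only [Matrix.mulVec, dotProduct, Finset.mul_sum, gram, Matrix.of_apply]
  refine Finset.sum_congr rfl fun k _ => ?_
  rw [integral_const_mul, integral_mul_const]

theorem hasDerivAt_integral_exp {f q : ℝ → ℝ} (hf : Measurable f) {C : ℝ} (hC : ∀ x, |f x| ≤ C)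
    (hq : Integrable q) (n : ℕ) (s : ℝ) :
    HasDerivAt (fun t => ∫ x, (f x ^ n * Real.exp (t * f x)) * q x)
      (∫ x, (f x ^ (n + 1) * Real.exp (s * f x)) * q x) s := by
  have hC0 : 0 ≤ C := (abs_nonneg _).trans (hC 0)
  have hb : ∀ (k : ℕ) (t x : ℝ), |f x ^ k * Real.exp (t * f x)| ≤ C ^ k * Real.exp (|t| * C) := by
    intro k t x
    rw [abs_mul, abs_pow, Real.abs_exp]
    have h1 : t * f x ≤ |t| * C := (le_abs_self _).trans (by
      rw [abs_mul]; exact mul_le_mul_of_nonneg_left (hC x) (abs_nonneg _))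
    exact mul_le_mul (pow_le_pow_left₀ (abs_nonneg _) (hC x) k) (Real.exp_le_exp.2 h1)
      (Real.exp_pos _).le (pow_nonneg hC0 k)
  have hint : ∀ (k : ℕ) (t : ℝ), Integrable fun x => (f x ^ k * Real.exp (t * f x)) * q x :=
    fun k t => hq.bdd_mul (by fun_prop) (ae_of_all _ (hb k t))
  refine (hasDerivAt_integral_of_dominated_loc_of_deriv_le (Metric.ball_mem_nhds s one_pos)
    (bound := fun x => C ^ (n + 1) * Real.exp ((|s| + 1) * C) * |q x|)
    (F' := fun t x => (f x ^ (n + 1) * Real.exp (t * f x)) * q x)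
    (Eventually.of_forall fun t => (hint n t).aestronglyMeasurable) (hint n s)
    (hint (n + 1) s).aestronglyMeasurable ?_ (hq.abs.const_mul _) ?_).2
  · refine ae_of_all _ fun x t ht => ?_
    rw [Real.norm_eq_abs, abs_mul]
    refine mul_le_mul_of_nonneg_right ((hb _ _ _).trans ?_) (abs_nonneg _)
    refine mul_le_mul_of_nonneg_left (Real.exp_le_exp.2 (mul_le_mul_of_nonneg_right ?_ hC0))
      (pow_nonneg hC0 _)
    rw [Metric.mem_ball, Real.dist_eq] at ht
    have := abs_sub_abs_le_abs_sub t s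
    linarith
  · refine ae_of_all _ fun x t _ => ?_
    have := ((((hasDerivAt_id t).mul_const (f x)).exp).const_mul (f x ^ n)).mul_const (q x)
    convert! this using 1
    simp only [id_eq]; ring

variable (ψ) in
/-- The matrix of the weight `f ^ n * exp (s f)`. -/
def gramExp (f : ℝ → ℝ) (n : ℕ) (s : ℝ) : Matrix (Fin M) (Fin M) ℝ :=
  gram ψ fun x => f x ^ n * Real.exp (s * f x)

theorem hasDerivAt_gramExp (hψ : ∀ j, MemLp (ψ j) 2) {f : ℝ → ℝ} (hf : Measurable f) {C : ℝ}
    (hC : ∀ x, |f x| ≤ C) (n : ℕ) (s : ℝ) (i j : Fin M) :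
    HasDerivAt (fun t => gramExp ψ f n t i j) (gramExp ψ f (n + 1) s i j) s :=
  hasDerivAt_integral_exp hf hC ((hψ i).integrable_mul (hψ j)) n s

variable (ψ) in
/-- The matrix whose determinant is the Laplace functional. -/
def tilt (f : ℝ → ℝ) (s : ℝ) : Matrix (Fin M) (Fin M) ℝ :=
  1 - gram ψ 1 + gramExp ψ f 0 s

theorem posSemidef_of_form {P : Matrix (Fin M) (Fin M) ℝ} (h : P.IsHermitian)
    (h' : ∀ v, 0 ≤ v ⬝ᵥ P.mulVec v) : P.PosSemidef :=
  Matrix.PosSemidef.of_dotProduct_mulVec_nonneg h fun v => by simpa using h' v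

theorem integral_second_difference {F₀ F₁ F₂ F₃ F₄ F₅ : ℝ → ℝ} (h₀ : Integrable F₀)
    (h₁ : Integrable F₁) (h₂ : Integrable F₂) (h₃ : Integrable F₃) (h₄ : Integrable F₄)
    (h₅ : Integrable F₅) (a b : ℝ) :
    ∫ x, (a * (F₀ x - 2 * F₁ x + F₂ x) + b * (F₃ x - 2 * F₄ x + F₅ x))
      = a * ((∫ x, F₀ x) - 2 * (∫ x, F₁ x) + ∫ x, F₂ x)
        + b * ((∫ x, F₃ x) - 2 * (∫ x, F₄ x) + ∫ x, F₅ x) := by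
  have h : ∀ {A B D : ℝ → ℝ}, Integrable A → Integrable B → Integrable D →
      Integrable (fun x => A x - 2 * B x + D x) ∧
        ∫ x, (A x - 2 * B x + D x) = (∫ x, A x) - 2 * (∫ x, B x) + ∫ x, D x := by
    intro A B D hA hB hD
    have hB2 : Integrable fun x => 2 * B x := hB.const_mul 2
    have hAB : Integrable fun x => A x - 2 * B x := hA.sub hB2
    exact ⟨hAB.add hD, by rw [integral_add hAB hD, integral_sub hA hB2, integral_const_mul]⟩
  rw [integral_add ((h h₀ h₁ h₂).1.const_mul a) ((h h₃ h₄ h₅).1.const_mul b),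
    integral_const_mul, integral_const_mul, (h h₀ h₁ h₂).2, (h h₃ h₄ h₅).2]

section Tilt

variable (hψ : ∀ j, MemLp (ψ j) 2) (hK : (1 - gram ψ 1).PosSemidef) {f : ℝ → ℝ}
  (hf : Measurable f) {C : ℝ} (hC : ∀ x, |f x| ≤ C)

theorem abs_pow_mul_exp_le (hC : ∀ x, |f x| ≤ C) (n : ℕ) (s x : ℝ) :
    |f x ^ n * Real.exp (s * f x)| ≤ C ^ n * Real.exp (|s| * C) := by
  have hC0 : 0 ≤ C := (abs_nonneg _).trans (hC 0)
  rw [abs_mul, abs_pow, Real.abs_exp]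
  have h1 : s * f x ≤ |s| * C := (le_abs_self _).trans (by
    rw [abs_mul]; exact mul_le_mul_of_nonneg_left (hC x) (abs_nonneg _))
  exact mul_le_mul (pow_le_pow_left₀ (abs_nonneg _) (hC x) n) (Real.exp_le_exp.2 h1)
    (Real.exp_pos _).le (pow_nonneg hC0 n)

include hψ hf hC

theorem gramExp_form (n : ℕ) (s : ℝ) (v w : Fin M → ℝ) :
    Integrable (fun x => (f x ^ n * Real.exp (s * f x)) *
      ((∑ j, v j * ψ j x) * ∑ k, w k * ψ k x)) ∧
    v ⬝ᵥ (gramExp ψ f n s).mulVec w = ∫ x, (f x ^ n * Real.exp (s * f x)) *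
      ((∑ j, v j * ψ j x) * ∑ k, w k * ψ k x) :=
  gram_form hψ (by fun_prop) (abs_pow_mul_exp_le hC n s) v w

include hK

/-- With e^{sf} ≥ c = e^{-|s|C} and c ≤ 1, the matrix dominates (1 - A) + cA ≥ c · 1, where A =
`gram ψ 1` ≤ 1. -/
theorem tilt_posDef (s : ℝ) : (tilt ψ f s).PosDef := by
  have hH : (tilt ψ f s).IsHermitian := (hK.1).add (gram_isHermitian _)
  refine Matrix.PosDef.of_dotProduct_mulVec_pos hH fun v hv => ?_
  simp only [star_trivial]
  have hC0 : 0 ≤ C := (abs_nonneg _).trans (hC 0)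
  set c := Real.exp (-(|s| * C)) with hc
  have hc1 : c ≤ 1 := Real.exp_le_one_iff.2 (by have := abs_nonneg s; nlinarith)
  have hc0 : 0 < c := Real.exp_pos _
  have h1 := hK.dotProduct_mulVec_nonneg v
  obtain ⟨i1, e1⟩ := gram_form hψ (h := 1) measurable_one (B := 1) (by simp) v v
  obtain ⟨i2, e2⟩ := gramExp_form hψ hf hC 0 s v v
  have hle : c * (v ⬝ᵥ (gram ψ 1).mulVec v) ≤ v ⬝ᵥ (gramExp ψ f 0 s).mulVec v := by
    rw [e1, e2, ← integral_const_mul]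
    refine integral_mono (i1.const_mul c) i2 fun x => ?_
    simp only [Pi.one_apply, one_mul, pow_zero]
    refine mul_le_mul_of_nonneg_right (Real.exp_le_exp.2 ?_) (mul_self_nonneg _)
    have := neg_abs_le (s * f x)
    rw [abs_mul] at this
    have := mul_le_mul_of_nonneg_left (hC x) (abs_nonneg s)
    linarith
  have hvv : 0 < v ⬝ᵥ v :=
    lt_of_le_of_ne (Finset.sum_nonneg fun i _ => mul_self_nonneg (v i))
      (Ne.symm (mt dotProduct_self_eq_zero.1 hv))
  simp only [star_trivial, Matrix.sub_mulVec, Matrix.one_mulVec, dotProduct_sub] at h1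
  simp only [tilt, Matrix.add_mulVec, Matrix.sub_mulVec, Matrix.one_mulVec, dotProduct_sub,
    dotProduct_add]
  nlinarith

/-- The quadratic forms controlling the cumulants of the tilted process. -/
theorem tilt_forms (s : ℝ) :
    let R := (tilt ψ f s)⁻¹
    let G₁ := gramExp ψ f 1 s
    let G₂ := gramExp ψ f 2 s
    let G₃ := gramExp ψ f 3 s
    let H := G₂ - G₁ * R * G₁
    let W := G₃ - G₁ * R * G₂ - G₂ * R * G₁ + G₁ * R * G₁ * R * G₁
    H.PosSemidef ∧ (C • H - W).PosSemidef ∧ (C • H + W).PosSemidef ∧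
      (C • tilt ψ f s - G₁).PosSemidef ∧ (C • tilt ψ f s + G₁).PosSemidef := by
  intro R G₁ G₂ G₃ H W
  have hC0 : 0 ≤ C := (abs_nonneg _).trans (hC 0)
  have hG := tilt_posDef hψ hK hf hC s
  have hRh : R.IsHermitian := hG.1.inv
  have h1 : G₁.IsHermitian := gram_isHermitian _
  have h2 : G₂.IsHermitian := gram_isHermitian _
  have h3 : G₃.IsHermitian := gram_isHermitian _
  have hGR : tilt ψ f s * R = 1 := Matrix.mul_nonsing_inv _ ((Matrix.isUnit_iff_isUnit_det _).1 hG.isUnit)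
  have hHh : H.IsHermitian := by
    refine h2.sub ?_
    simp only [Matrix.IsHermitian, Matrix.conjTranspose_mul, h1.eq, hRh.eq, Matrix.mul_assoc]
  have hWh : W.IsHermitian := by
    simp only [W, Matrix.IsHermitian, Matrix.conjTranspose_mul, Matrix.conjTranspose_add,
      Matrix.conjTranspose_sub, h1.eq, h2.eq, h3.eq, hRh.eq, Matrix.mul_assoc]
    abel
  have sym : ∀ {P : Matrix (Fin M) (Fin M) ℝ}, P.IsHermitian → ∀ v w : Fin M → ℝ,
      v ⬝ᵥ P.mulVec w = P.mulVec v ⬝ᵥ w := fun {P} hP v w => by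
    rw [Matrix.dotProduct_mulVec, ← Matrix.mulVec_transpose,
      ← Matrix.conjTranspose_eq_transpose_of_trivial, hP.eq]
  -- the forms of `H` and `W` at `v`
  have key : ∀ v : Fin M → ℝ, ∀ ε : ℝ, |ε| ≤ 1 →
      0 ≤ C * (v ⬝ᵥ H.mulVec v) + ε * (v ⬝ᵥ W.mulVec v) ∧ 0 ≤ v ⬝ᵥ H.mulVec v := by
    intro v ε hε
    -- The vector w solves G w = G₁ v: it completes the square in the form of H, and makes both
    -- forms integrals of (f v - w)², up to the nonnegative contribution of 1 - `gram ψ 1`.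
    set w := R.mulVec (G₁.mulVec v) with hw
    have hGw : (tilt ψ f s).mulVec w = G₁.mulVec v := by
      rw [hw, Matrix.mulVec_mulVec, hGR, Matrix.one_mulVec]
    have eH : v ⬝ᵥ H.mulVec v = v ⬝ᵥ G₂.mulVec v - 2 * (v ⬝ᵥ G₁.mulVec w)
        + w ⬝ᵥ (tilt ψ f s).mulVec w := by
      have : w ⬝ᵥ (tilt ψ f s).mulVec w = v ⬝ᵥ G₁.mulVec w := by
        rw [hGw, sym h1 v w, dotProduct_comm]
      rw [this]
      simp only [H, Matrix.sub_mulVec, dotProduct_sub, ← Matrix.mulVec_mulVec, ← hw]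
      ring
    have eW : v ⬝ᵥ W.mulVec v = v ⬝ᵥ G₃.mulVec v - 2 * (v ⬝ᵥ G₂.mulVec w)
        + w ⬝ᵥ G₁.mulVec w := by
      have a1 : v ⬝ᵥ G₁.mulVec (R.mulVec (G₂.mulVec v)) = v ⬝ᵥ G₂.mulVec w := by
        rw [sym h1, sym hRh, ← hw, sym h2 v w, dotProduct_comm]
      have a2 : v ⬝ᵥ G₁.mulVec (R.mulVec (G₁.mulVec w)) = w ⬝ᵥ G₁.mulVec w := by
        rw [sym h1, sym hRh, ← hw]
      simp only [W, Matrix.sub_mulVec, Matrix.add_mulVec, dotProduct_sub, dotProduct_add,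
        ← Matrix.mulVec_mulVec, ← hw, a1, a2]
      ring
    have hKw := hK.dotProduct_mulVec_nonneg w
    obtain ⟨i0, e0⟩ := gramExp_form hψ hf hC 0 s w w
    obtain ⟨i1v, e1v⟩ := gramExp_form hψ hf hC 1 s v w
    obtain ⟨i1, e1⟩ := gramExp_form hψ hf hC 1 s w w
    obtain ⟨i2, e2⟩ := gramExp_form hψ hf hC 2 s v v
    obtain ⟨i2w, e2w⟩ := gramExp_form hψ hf hC 2 s v w
    obtain ⟨i3, e3⟩ := gramExp_form hψ hf hC 3 s v v
    have eG : w ⬝ᵥ (tilt ψ f s).mulVec w = w ⬝ᵥ (1 - gram ψ 1).mulVec w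
        + w ⬝ᵥ (gramExp ψ f 0 s).mulVec w := by
      simp only [tilt, Matrix.add_mulVec, dotProduct_add]
    simp only [star_trivial] at hKw
    -- H carries the weight e^{sf} and W the weight f e^{sf} on the same square. Since |f| ≤ C, the
    -- weight C + εf is nonnegative, which gives -CH ≤ W ≤ CH.
    have hI : ∀ a b : ℝ, a * (v ⬝ᵥ G₂.mulVec v - 2 * (v ⬝ᵥ G₁.mulVec w)
        + w ⬝ᵥ (gramExp ψ f 0 s).mulVec w) + b * (v ⬝ᵥ W.mulVec v)
        = ∫ x, (a + b * f x) * Real.exp (s * f x) *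
          (f x * (∑ j, v j * ψ j x) - ∑ j, w j * ψ j x) ^ 2 := by
      intro a b
      rw [eW, e0, e1v, e1, e2, e2w, e3, ← integral_second_difference i2 i1v i0 i3 i2w i1]
      refine integral_congr_ae (ae_of_all _ fun x => ?_)
      ring
    have hp1 := hI C ε
    have hp2 := hI 1 0
    have n1 : 0 ≤ ∫ x, (C + ε * f x) * Real.exp (s * f x) *
          (f x * (∑ j, v j * ψ j x) - ∑ j, w j * ψ j x) ^ 2 :=
      integral_nonneg fun x => by
        have : |ε * f x| ≤ C := by
          rw [abs_mul]
          calc |ε| * |f x| ≤ 1 * C := mul_le_mul hε (hC x) (abs_nonneg _) zero_le_one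
            _ = C := one_mul C
        have := neg_le_of_abs_le this
        have : 0 ≤ C + ε * f x := by linarith
        positivity
    have n2 : 0 ≤ ∫ x, (1 + 0 * f x) * Real.exp (s * f x) *
          (f x * (∑ j, v j * ψ j x) - ∑ j, w j * ψ j x) ^ 2 :=
      integral_nonneg fun x => by
        simp only [zero_mul, add_zero, one_mul]; positivity
    rw [eH, eG]
    constructor
    · nlinarith
    · nlinarith
  have key1 : ∀ v : Fin M → ℝ, ∀ ε : ℝ, |ε| ≤ 1 →
      0 ≤ C * (v ⬝ᵥ (tilt ψ f s).mulVec v) + ε * (v ⬝ᵥ G₁.mulVec v) := by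
    intro v ε hε
    obtain ⟨i0, e0⟩ := gramExp_form hψ hf hC 0 s v v
    obtain ⟨i1, e1⟩ := gramExp_form hψ hf hC 1 s v v
    have hKw := hK.dotProduct_mulVec_nonneg v
    simp only [star_trivial] at hKw
    simp only [tilt, Matrix.add_mulVec (1 - gram ψ 1), dotProduct_add]
    have : 0 ≤ C * (v ⬝ᵥ (gramExp ψ f 0 s).mulVec v) + ε * (v ⬝ᵥ G₁.mulVec v) := by
      rw [e0, e1, ← integral_const_mul, ← integral_const_mul,
        ← integral_add (i0.const_mul _) (i1.const_mul _)]
      refine integral_nonneg fun x => ?_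
      have h3 : |ε * f x| ≤ C := by
        rw [abs_mul]
        calc |ε| * |f x| ≤ 1 * C := mul_le_mul hε (hC x) (abs_nonneg _) zero_le_one
          _ = C := one_mul C
      have h4 := neg_le_of_abs_le h3
      have h5 : 0 ≤ (C + ε * f x) * (Real.exp (s * f x) *
          ((∑ j, v j * ψ j x) * ∑ k, v k * ψ k x)) :=
        mul_nonneg (by linarith) (mul_nonneg (Real.exp_pos _).le (mul_self_nonneg _))
      simp only [Pi.zero_apply, pow_zero, pow_one]
      linarith
    nlinarith
  have smulH : ∀ {P : Matrix (Fin M) (Fin M) ℝ}, P.IsHermitian → (C • P).IsHermitian :=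
    fun {P} hP => by
      rw [Matrix.IsHermitian, Matrix.conjTranspose_smul, hP.eq, star_trivial]
  refine ⟨posSemidef_of_form hHh fun v => (key v 0 (by simp)).2,
    posSemidef_of_form ((smulH hHh).sub hWh) fun v => ?_,
    posSemidef_of_form ((smulH hHh).add hWh) fun v => ?_,
    posSemidef_of_form ((smulH hG.1).sub h1) fun v => ?_,
    posSemidef_of_form ((smulH hG.1).add h1) fun v => ?_⟩
  · have := (key v (-1) (by simp)).1
    simp only [Matrix.sub_mulVec (C • H), Matrix.smul_mulVec, dotProduct_sub, dotProduct_smul, smul_eq_mul]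
    linarith
  · have := (key v 1 (by simp)).1
    simp only [Matrix.add_mulVec (C • H), Matrix.smul_mulVec, dotProduct_add, dotProduct_smul, smul_eq_mul]
    linarith
  · have := key1 v (-1) (by simp)
    simp only [Matrix.sub_mulVec (C • tilt ψ f s), Matrix.smul_mulVec, dotProduct_sub, dotProduct_smul, smul_eq_mul]
    linarith
  · have := key1 v 1 (by simp)
    simp only [Matrix.add_mulVec (C • tilt ψ f s), Matrix.smul_mulVec, dotProduct_add, dotProduct_smul, smul_eq_mul]
    linarith

end Tilt

end Gram

/-! ### Cumulant bounds for log-determinants. -/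

section LogDet

variable {M : ℕ} {ψ : Fin M → ℝ → ℝ} (hψ : ∀ j, MemLp (ψ j) 2)
  (hK : (1 - gram ψ 1).PosSemidef) {f : ℝ → ℝ} (hf : Measurable f) {C : ℝ} (hC : ∀ x, |f x| ≤ C)

theorem hasDerivAt_trace {m : Type*} [Fintype m] {G : ℝ → Matrix m m ℝ}
    {G' : Matrix m m ℝ} {s : ℝ} (h : ∀ i j, HasDerivAt (fun t => G t i j) (G' i j) s) :
    HasDerivAt (fun t => (G t).trace) G'.trace s :=
  HasDerivAt.fun_sum fun i _ => h i i

theorem gramExp_zero (n : ℕ) : gramExp ψ f n 0 = gram ψ fun x => f x ^ n := by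
  simp [gramExp]

theorem tilt_zero : tilt ψ f 0 = 1 := by
  rw [tilt, gramExp_zero]
  simp only [pow_zero]
  exact sub_add_cancel _ _

include hψ hK hf hC

/-- For L = log det G the first derivatives are L' = tr(RG₁) and L'' = tr(RH). Since L''' = tr(RW) -
tr(RG₁RH), the matrix inequalities of `tilt_forms` give |L'''| ≤ 2C L'', and
`bound_of_third_derivative` applies. -/
theorem log_det_tilt_bound_of_nonneg {s : ℝ} (hs : 0 ≤ s) :
    0 ≤ (gram ψ fun x => f x ^ 2).trace - (gram ψ f * gram ψ f).trace ∧
    s ^ 2 / 2 * (((gram ψ fun x => f x ^ 2).trace - (gram ψ f * gram ψ f).trace)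
        * Real.exp (-(2 * C * s))) ≤ Real.log (tilt ψ f s).det - s * (gram ψ f).trace ∧
      Real.log (tilt ψ f s).det - s * (gram ψ f).trace ≤
    s ^ 2 / 2 * (((gram ψ fun x => f x ^ 2).trace - (gram ψ f * gram ψ f).trace)
        * Real.exp (2 * C * s)) := by
  have hC0 : 0 ≤ C := (abs_nonneg _).trans (hC 0)
  set R : ℝ → Matrix (Fin M) (Fin M) ℝ := fun t => (tilt ψ f t)⁻¹ with hR
  set G₁ := gramExp ψ f 1 with hG₁
  set G₂ := gramExp ψ f 2 with hG₂
  set G₃ := gramExp ψ f 3 with hG₃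
  have hdet : ∀ t, (tilt ψ f t).det ≠ 0 := fun t => (tilt_posDef hψ hK hf hC t).det_pos.ne'
  have d0 : ∀ t i j, HasDerivAt (fun u => tilt ψ f u i j) (G₁ t i j) t := fun t i j =>
    (hasDerivAt_gramExp hψ hf hC 0 t i j).const_add _
  have d1 : ∀ t i j, HasDerivAt (fun u => G₁ u i j) (G₂ t i j) t := fun t i j =>
    hasDerivAt_gramExp hψ hf hC 1 t i j
  have d2 : ∀ t i j, HasDerivAt (fun u => G₂ u i j) (G₃ t i j) t := fun t i j =>
    hasDerivAt_gramExp hψ hf hC 2 t i j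
  have dR : ∀ t i j, HasDerivAt (fun u => R u i j) ((-(R t * G₁ t * R t)) i j) t := fun t i j =>
    hasDerivAt_matrix_inv (d0 t) hdet i j
  have h₁ : ∀ t, HasDerivAt (fun u => Real.log (tilt ψ f u).det) ((R t * G₁ t).trace) t := by
    intro t
    convert (hasDerivAt_det (d0 t)).log (hdet t) using 1
    change ((tilt ψ f t)⁻¹ * _).trace = _
    rw [Matrix.inv_def, Matrix.smul_mul, Matrix.trace_smul, Ring.inverse_eq_inv', smul_eq_mul]
    field_simp
  have dRG₁ := fun t => hasDerivAt_matrix_mul (dR t) (d1 t)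
  have dRG₂ := fun t => hasDerivAt_matrix_mul (dR t) (d2 t)
  have h₂ : ∀ t, HasDerivAt (fun u => (R u * G₁ u).trace)
      ((R t * G₂ t - R t * G₁ t * (R t * G₁ t)).trace) t := by
    intro t
    convert hasDerivAt_trace (dRG₁ t) using 2
    noncomm_ring
  have h₃ : ∀ t, HasDerivAt (fun u => (R u * G₂ u - R u * G₁ u * (R u * G₁ u)).trace)
      ((R t * (G₃ t - G₁ t * R t * G₂ t - G₂ t * R t * G₁ t + G₁ t * R t * G₁ t * R t * G₁ t)
        - R t * G₁ t * R t * (G₂ t - G₁ t * R t * G₁ t)).trace) t := by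
    intro t
    have := hasDerivAt_trace (G := fun u => R u * G₂ u - R u * G₁ u * (R u * G₁ u))
      (G' := (-(R t * G₁ t * R t) * G₂ t + R t * G₃ t)
        - ((-(R t * G₁ t * R t) * G₁ t + R t * G₂ t) * (R t * G₁ t)
          + R t * G₁ t * (-(R t * G₁ t * R t) * G₁ t + R t * G₂ t))) fun i j =>
      (dRG₂ t i j).sub (hasDerivAt_matrix_mul (dRG₁ t) (dRG₁ t) i j)
    convert this using 2
    noncomm_ring
  -- Each of the two parts of L''' is at most C tr(RH) in absolute value: tr(RW) because ±W ≤ CH,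
  -- and tr(RG₁RH) because ±RG₁R ≤ CRGR = CR. Products of positive semidefinite matrices have
  -- nonnegative trace.
  have hp : ∀ t, 0 ≤ (R t * G₂ t - R t * G₁ t * (R t * G₁ t)).trace ∧
      |(R t * (G₃ t - G₁ t * R t * G₂ t - G₂ t * R t * G₁ t + G₁ t * R t * G₁ t * R t * G₁ t)
        - R t * G₁ t * R t * (G₂ t - G₁ t * R t * G₁ t)).trace|
      ≤ 2 * C * (R t * G₂ t - R t * G₁ t * (R t * G₁ t)).trace := by
    intro t
    obtain ⟨pH, pW1, pW2, pG1, pG2⟩ := tilt_forms hψ hK hf hC t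
    have pG := tilt_posDef hψ hK hf hC t
    have pR : (R t).PosSemidef := pG.posSemidef.inv
    have hRh : (R t).conjTranspose = R t := pR.1
    have eH : R t * G₂ t - R t * G₁ t * (R t * G₁ t) = R t * (G₂ t - G₁ t * R t * G₁ t) := by
      noncomm_ring
    have hRG : R t * tilt ψ f t = 1 := Matrix.nonsing_inv_mul _ (isUnit_iff_ne_zero.2 (hdet t))
    have q1 := pG1.mul_mul_conjTranspose_same (R t)
    have q2 := pG2.mul_mul_conjTranspose_same (R t)
    rw [hRh] at q1 q2
    have s1 := trace_mul_nonneg pR pH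
    have s2 := trace_mul_nonneg pR pW1
    have s3 := trace_mul_nonneg pR pW2
    have s4 := trace_mul_nonneg q1 pH
    have s5 := trace_mul_nonneg q2 pH
    rw [eH]
    simp only [Matrix.mul_sub (R t) (C • _), Matrix.mul_add (R t) (C • _), Matrix.mul_smul,
      Matrix.smul_mul, Matrix.sub_mul (C • _), Matrix.add_mul (C • _), Matrix.trace_sub (C • _),
      Matrix.trace_add (C • _), Matrix.trace_smul, hRG, Matrix.one_mul, smul_eq_mul]
      at s2 s3 s4 s5
    refine ⟨s1, ?_⟩
    rw [Matrix.trace_sub, abs_le]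
    constructor <;> linarith
  have hV : (R 0 * G₂ 0 - R 0 * G₁ 0 * (R 0 * G₁ 0)).trace
      = (gram ψ fun x => f x ^ 2).trace - (gram ψ f * gram ψ f).trace := by
    simp only [hR, tilt_zero, inv_one, one_mul, hG₁, hG₂, gramExp_zero, pow_one,
      Matrix.trace_sub]
  have hm : (R 0 * G₁ 0).trace = (gram ψ f).trace := by
    simp only [hR, tilt_zero, inv_one, one_mul, hG₁, gramExp_zero, pow_one]
  have hb := bound_of_third_derivative (a := 2 * C) (by simp [tilt_zero]) h₁ h₂ h₃
    (fun t => (hp t).2) hs (hp 0).1 (by positivity)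
  simp only [hV, hm] at hb
  exact ⟨hV ▸ (hp 0).1, hb⟩

theorem log_det_tilt_bound (s : ℝ) :
    s ^ 2 / 2 * (((gram ψ fun x => f x ^ 2).trace - (gram ψ f * gram ψ f).trace)
        * Real.exp (-(2 * C * |s|))) ≤ Real.log (tilt ψ f s).det - s * (gram ψ f).trace ∧
      Real.log (tilt ψ f s).det - s * (gram ψ f).trace ≤
    s ^ 2 / 2 * (((gram ψ fun x => f x ^ 2).trace - (gram ψ f * gram ψ f).trace)
        * Real.exp (2 * C * |s|)) := by
  rcases le_total 0 s with hs | hs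
  · rw [abs_of_nonneg hs]
    exact (log_det_tilt_bound_of_nonneg hψ hK hf hC hs).2
  -- The pairs (f, s) and (-f, -s) define the same tilt, so negative s reduces to positive s.
  · have h := (log_det_tilt_bound_of_nonneg hψ hK hf.neg (C := C)
      (fun x => by simpa using hC x) (neg_nonneg.2 hs)).2
    have e1 : gram ψ (-f) = -gram ψ f := by
      ext i j
      simp [gram, integral_neg]
    have e2 : tilt ψ (-f) (-s) = tilt ψ f s := by
      simp [tilt, gramExp]
    rw [abs_of_nonpos hs]
    simpa [e1, e2] using h

end LogDet

/-! ### Point processes: measurability and symmetric functions of the points. -/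

namespace PointProcess

variable {Ω : Type*} [MeasurableSpace Ω] (Ξ : PointProcess Ω)

theorem countable_points (ω : Ω) : (Ξ.points ω).Countable := by
  have : Ξ.points ω = ⋃ n : ℕ, Ξ.points ω ∩ Set.Icc (-(n : ℝ)) n := by
    ext x
    simp only [Set.mem_iUnion, Set.mem_inter_iff, Set.mem_Icc, exists_and_left]
    refine ⟨fun h => ⟨h, ?_⟩, fun h => h.1⟩
    obtain ⟨n, hn⟩ := exists_nat_ge |x|
    exact ⟨n, abs_le.1 hn⟩
  rw [this]
  exact Set.countable_iUnion fun n => (Ξ.locallyFinite ω _ isCompact_Icc).countable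

/-- The counting measure of the configuration. -/
def countMeasure (ω : Ω) : Measure ℝ := Measure.count.restrict (Ξ.points ω)

/-- The configuration becomes a random measure, so sums over its points are measurable without any
measurable enumeration of the points. -/
theorem measurable_countMeasure : Measurable Ξ.countMeasure := by
  refine Measure.measurable_of_measurable_coe _ fun B hB => ?_
  have h : (fun ω => Ξ.countMeasure ω B) = fun ω => (((Ξ.points ω ∩ B).encard : ℕ∞) : ℝ≥0∞) := by
    ext ω
    rw [countMeasure, Measure.restrict_apply hB,
      Measure.count_apply (hB.inter (Ξ.countable_points ω).measurableSet), Set.inter_comm]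
  rw [h]
  exact (measurable_of_countable _).comp (Ξ.measurable_count B hB)

/-- The points of the configuration in `[-L, L]`. -/
def pointsIn (L : ℝ) (ω : Ω) : Finset ℝ :=
  (Ξ.locallyFinite ω (Set.Icc (-L) L) isCompact_Icc).toFinset

theorem mem_pointsIn {L : ℝ} {ω : Ω} {x : ℝ} :
    x ∈ Ξ.pointsIn L ω ↔ x ∈ Ξ.points ω ∧ x ∈ Set.Icc (-L) L := by
  simp [pointsIn]

theorem lintegral_countMeasure {L : ℝ} {g : ℝ → ℝ≥0∞} (hs : ∀ x, x ∉ Set.Icc (-L) L → g x = 0)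
    (hg : Measurable g) (ω : Ω) :
    ∫⁻ x, g x ∂Ξ.countMeasure ω = ∑ x ∈ Ξ.pointsIn L ω, g x := by
  rw [countMeasure, ← lintegral_indicator (Ξ.countable_points ω).measurableSet,
    lintegral_count' (hg.indicator (Ξ.countable_points ω).measurableSet)]
  rw [tsum_eq_sum (s := Ξ.pointsIn L ω)]
  · refine Finset.sum_congr rfl fun x hx => ?_
    rw [Set.indicator_of_mem (Ξ.mem_pointsIn.1 hx).1]
  · intro x hx
    by_cases h1 : x ∈ Ξ.points ω
    · rw [Set.indicator_of_mem h1]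
      exact hs x fun h2 => hx (Ξ.mem_pointsIn.2 ⟨h1, h2⟩)
    · rw [Set.indicator_of_notMem h1]

theorem measurable_sum_pointsIn {L : ℝ} {g : ℝ → ℝ} (hg : Measurable g) :
    Measurable fun ω => ∑ x ∈ Ξ.pointsIn L ω, g x := by
  have key : ∀ u : ℝ → ℝ, Measurable u → (∀ x, 0 ≤ u x) →
      Measurable fun ω => ∑ x ∈ Ξ.pointsIn L ω, u x := by
    intro u hu hu0
    set v : ℝ → ℝ≥0∞ := (Set.Icc (-L) L).indicator fun x => ENNReal.ofReal (u x) with hv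
    have hvm : Measurable v := hu.ennreal_ofReal.indicator measurableSet_Icc
    have h := (Measure.measurable_lintegral hvm).comp Ξ.measurable_countMeasure
    have h2 : ∀ ω, ∫⁻ x, v x ∂Ξ.countMeasure ω = ENNReal.ofReal (∑ x ∈ Ξ.pointsIn L ω, u x) := by
      intro ω
      rw [Ξ.lintegral_countMeasure (L := L) (fun x hx => Set.indicator_of_notMem hx _) hvm,
        ENNReal.ofReal_sum_of_nonneg fun x _ => hu0 x]
      refine Finset.sum_congr rfl fun x hx => ?_
      exact Set.indicator_of_mem (Ξ.mem_pointsIn.1 hx).2 _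
    have h3 : (fun ω => ∑ x ∈ Ξ.pointsIn L ω, u x)
        = fun ω => (∫⁻ x, v x ∂Ξ.countMeasure ω).toReal := by
      ext ω
      rw [h2, ENNReal.toReal_ofReal (Finset.sum_nonneg fun x _ => hu0 x)]
    rw [h3]
    exact h.ennreal_toReal
  have hsplit : (fun ω => ∑ x ∈ Ξ.pointsIn L ω, g x) = fun ω =>
      (∑ x ∈ Ξ.pointsIn L ω, max (g x) 0) - ∑ x ∈ Ξ.pointsIn L ω, max (-g x) 0 := by
    ext ω
    rw [← Finset.sum_sub_distrib]
    refine Finset.sum_congr rfl fun x _ => ?_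
    rcases le_total 0 (g x) with h | h <;> simp [h]
  rw [hsplit]
  exact (key _ (hg.max measurable_const) fun x => le_max_right _ _).sub
    (key _ (hg.neg.max measurable_const) fun x => le_max_right _ _)

theorem linearStatistic_eq_sum {L : ℝ} {g : ℝ → ℝ} (hs : ∀ x, x ∉ Set.Icc (-L) L → g x = 0)
    (ω : Ω) : Ξ.linearStatistic g ω = ∑ x ∈ Ξ.pointsIn L ω, g x := by
  rw [linearStatistic, finsum_mem_eq_sum_of_inter_support_eq]
  ext x
  simp only [Set.mem_inter_iff, Function.mem_support, Finset.mem_coe, mem_pointsIn]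
  constructor
  · rintro ⟨h1, h2⟩
    exact ⟨⟨h1, by_contra fun h => h2 (hs x h)⟩, h2⟩
  · rintro ⟨⟨h1, _⟩, h2⟩
    exact ⟨h1, h2⟩

/-- The `n`-th elementary symmetric function of the values of `g` at the points in `[-L, L]`. -/
def esum (L : ℝ) (g : ℝ → ℝ) (n : ℕ) (ω : Ω) : ℝ :=
  ∑ U ∈ (Ξ.pointsIn L ω).powersetCard n, ∏ x ∈ U, g x

theorem newton_identity (T : Finset ℝ) (g : ℝ → ℝ) (n : ℕ) :
    (n : ℝ) * ∑ U ∈ T.powersetCard n, ∏ x ∈ U, g x = (-1) ^ (n + 1) *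
      ∑ a ∈ (Finset.HasAntidiagonal.antidiagonal n).filter (fun a => a.1 < n),
        (-1) ^ a.1 * (∑ U ∈ T.powersetCard a.1, ∏ x ∈ U, g x) * ∑ x ∈ T, g x ^ a.2 := by
  classical
  have he : ∀ k, MvPolynomial.aeval (fun x : T => g x) (MvPolynomial.esymm T ℝ k)
      = ∑ U ∈ T.powersetCard k, ∏ x ∈ U, g x := by
    intro k
    rw [MvPolynomial.aeval_esymm_eq_multiset_esymm, ← Finset.esymm_map_val]
    congr 1
    exact Multiset.attach_map_val' T.val g
  have hp : ∀ k, MvPolynomial.aeval (fun x : T => g x) (MvPolynomial.psum T ℝ k)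
      = ∑ x ∈ T, g x ^ k := by
    intro k
    simp only [MvPolynomial.psum, map_sum, map_pow, MvPolynomial.aeval_X]
    exact Finset.sum_coe_sort T fun x => g x ^ k
  have h := congrArg (MvPolynomial.aeval fun x : T => g x) (MvPolynomial.mul_esymm_eq_sum T ℝ n)
  simpa only [map_mul, map_natCast, map_pow, map_neg, map_one, map_sum, he, hp] using h

/-- Newton's identities reduce elementary symmetric functions to power sums, which are linear
statistics and hence measurable. -/
theorem measurable_esum {L : ℝ} {g : ℝ → ℝ} (hg : Measurable g) (n : ℕ) :
    Measurable (Ξ.esum L g n) := by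
  induction n using Nat.strong_induction_on with
  | _ n ih =>
    rcases Nat.eq_zero_or_pos n with rfl | hn
    · have : Ξ.esum L g 0 = fun _ => 1 := by
        ext ω; simp [esum]
      rw [this]; exact measurable_const
    have h1 : Ξ.esum L g n = fun ω => (n : ℝ)⁻¹ * ((-1) ^ (n + 1) *
      ∑ a ∈ (Finset.HasAntidiagonal.antidiagonal n).filter (fun a => a.1 < n),
        (-1) ^ a.1 * Ξ.esum L g a.1 ω * ∑ x ∈ Ξ.pointsIn L ω, g x ^ a.2) := by
      ext ω
      have : (n : ℝ) ≠ 0 := by positivity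
      rw [eq_inv_mul_iff_mul_eq₀ this]
      exact newton_identity _ g n
    rw [h1]
    refine Measurable.const_mul (Measurable.const_mul (Finset.measurable_fun_sum _ fun a ha => ?_) _) _
    exact ((ih a.1 (Finset.mem_filter.1 ha).2).const_mul _).mul
      (Ξ.measurable_sum_pointsIn (hg.pow_const _))

theorem prod_one_add (L : ℝ) (g : ℝ → ℝ) (ω : Ω) :
    HasSum (fun n => Ξ.esum L g n ω) (∏ x ∈ Ξ.pointsIn L ω, (1 + g x)) := by
  have h : ∏ x ∈ Ξ.pointsIn L ω, (1 + g x)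
      = ∑ n ∈ Finset.range ((Ξ.pointsIn L ω).card + 1), Ξ.esum L g n ω := by
    simp_rw [add_comm (1 : ℝ)]
    rw [Finset.prod_add_one, Finset.sum_powerset]
    rfl
  rw [h]
  refine hasSum_sum_of_ne_finset_zero fun n hn => ?_
  rw [esum, Finset.powersetCard_eq_empty.2 (by simpa using hn)]
  simp

/-- The compact support turns the series defining correlation functions into a finite sum over
injections into the points of the window. -/
theorem tsum_tuples {L : ℝ} {n : ℕ} {F : (Fin n → ℝ) → ℝ≥0∞}
    (hF : ∀ x, (∃ i, x i ∉ Set.Icc (-L) L) → F x = 0) (ω : Ω) :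
    (∑' x : {x : Fin n → ℝ // Function.Injective x ∧ ∀ i, x i ∈ Ξ.points ω}, F x)
      = ∑ e : Fin n ↪ Ξ.pointsIn L ω, F fun i => e i := by
  let J : (Fin n ↪ Ξ.pointsIn L ω) →
      {x : Fin n → ℝ // Function.Injective x ∧ ∀ i, x i ∈ Ξ.points ω} := fun e =>
    ⟨fun i => e i, fun i j h => e.injective (Subtype.ext h),
      fun i => (Ξ.mem_pointsIn.1 (e i).2).1⟩
  have hJ : Function.Injective J := fun e e' h => by
    ext i
    exact congrFun (Subtype.ext_iff.1 h) i
  rw [← hJ.tsum_eq (f := fun x => F x.1), tsum_fintype]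
  intro x hx
  have hx' : ∀ i, x.1 i ∈ Set.Icc (-L) L := by
    by_contra hcon
    push Not at hcon
    exact hx (hF _ hcon)
  exact ⟨⟨fun i => ⟨x.1 i, Ξ.mem_pointsIn.2 ⟨x.2.2 i, hx' i⟩⟩,
    fun i j h => x.2.1 (Subtype.ext_iff.1 h)⟩, rfl⟩

theorem sum_tuples_eq_esum (L : ℝ) (g : ℝ → ℝ) (n : ℕ) (ω : Ω) :
    ∑ e : Fin n ↪ Ξ.pointsIn L ω, ∏ i, g (e i) = n ! * Ξ.esum L g n ω := by
  classical
  have h := sum_embedding_eq (α := Ξ.pointsIn L ω) n fun U => ∏ x ∈ U, g x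
  simp only [Finset.prod_map] at h
  rw [h, esum]
  congr 1
  have h2 : (Ξ.pointsIn L ω).powersetCard n = (Finset.powersetCard n
      (Finset.univ : Finset (Ξ.pointsIn L ω))).map
        (Finset.mapEmbedding (Function.Embedding.subtype _)).toEmbedding := by
    rw [← Finset.powersetCard_map]
    congr 1
    ext x; simp
  rw [h2, Finset.sum_map]
  refine Finset.sum_congr rfl fun U _ => ?_
  simp [Finset.mapEmbedding_apply]

theorem abs_esum_le (L : ℝ) (g : ℝ → ℝ) (n : ℕ) (ω : Ω) :
    |Ξ.esum L g n ω| ≤ Ξ.esum L (fun x => |g x|) n ω := by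
  refine (Finset.abs_sum_le_sum_abs _ _).trans (le_of_eq ?_)
  exact Finset.sum_congr rfl fun U _ => Finset.abs_prod _ _

end PointProcess

namespace PointProcess

variable {Ω : Type*} [MeasurableSpace Ω] (Ξ : PointProcess Ω)

/-- This is the correlation identity for F = ∏ g(x_i), divided by n!. The bound by ∏ κ(x_i), later
Hadamard's inequality with κ the diagonal of the kernel, gives integrability and the factor 1/n!
that makes the Fredholm series converge. -/
theorem integral_esum {P : Measure Ω} {n : ℕ} {ρ : (Fin n → ℝ) → ℝ}
    (hρ : Ξ.IsCorrelationFunction P n ρ) (hρm : Measurable ρ) (hρ0 : ∀ x, 0 ≤ ρ x)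
    {κ : ℝ → ℝ} (hκ : ∀ x, ρ x ≤ ∏ i, κ (x i)) {L : ℝ} {g : ℝ → ℝ} (hg : Measurable g)
    (hs : ∀ x, x ∉ Set.Icc (-L) L → g x = 0) (hi : Integrable fun x => |g x| * κ x) :
    Integrable (Ξ.esum L g n) P ∧
    ∫ ω, Ξ.esum L g n ω ∂P = (n ! : ℝ)⁻¹ * ∫ x, (∏ i, g (x i)) * ρ x ∧
    ∫ ω, |Ξ.esum L g n ω| ∂P ≤ (n ! : ℝ)⁻¹ * (∫ x, |g x| * κ x) ^ n := by
  have hgm : ∀ u : ℝ → ℝ, Measurable u → Measurable fun x : Fin n → ℝ => ∏ i, u (x i) :=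
    fun u hu => Finset.measurable_fun_prod _ fun i _ => hu.comp (measurable_pi_apply i)
  have hdom : Integrable fun x : Fin n → ℝ => ∏ i, (|g (x i)| * κ (x i)) :=
    Integrable.fintype_prod (f := fun _ y => |g y| * κ y) fun _ => hi
  have hle : ∀ x : Fin n → ℝ, (∏ i, |g (x i)|) * ρ x ≤ ∏ i, (|g (x i)| * κ (x i)) := fun x => by
    rw [Finset.prod_mul_distrib]
    exact mul_le_mul_of_nonneg_left (hκ x) (Finset.prod_nonneg fun i _ => abs_nonneg _)
  have habs : ∀ x : Fin n → ℝ, |∏ i, g (x i)| = ∏ i, |g (x i)| := fun x => Finset.abs_prod _ _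
  have iA : Integrable fun x : Fin n → ℝ => (∏ i, |g (x i)|) * ρ x :=
    hdom.mono' ((hgm _ hg.abs).mul hρm).aestronglyMeasurable (ae_of_all _ fun x => by
      rw [Real.norm_of_nonneg (mul_nonneg (Finset.prod_nonneg fun i _ => abs_nonneg _) (hρ0 x))]
      exact hle x)
  have iB : Integrable fun x : Fin n → ℝ => (∏ i, g (x i)) * ρ x :=
    hdom.mono' ((hgm _ hg).mul hρm).aestronglyMeasurable (ae_of_all _ fun x => by
      rw [Real.norm_eq_abs, abs_mul, habs, abs_of_nonneg (hρ0 x)]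
      exact hle x)
  -- Correlation functions are tested only against nonnegative F, so the signed product is the
  -- difference of (∏|g| ± ∏g)/2.
  have key : ∀ ε : ℝ, |ε| = 1 →
      Integrable (fun ω => (Ξ.esum L (fun x => |g x|) n ω + ε * Ξ.esum L g n ω) / 2) P ∧
      ∫ ω, (Ξ.esum L (fun x => |g x|) n ω + ε * Ξ.esum L g n ω) / 2 ∂P
        = (n ! : ℝ)⁻¹ * ∫ x : Fin n → ℝ, ((∏ i, |g (x i)|) + ε * ∏ i, g (x i)) / 2 * ρ x := by
    intro ε hε
    set F : (Fin n → ℝ) → ℝ := fun x => ((∏ i, |g (x i)|) + ε * ∏ i, g (x i)) / 2 with hF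
    have hFm : Measurable F := (((hgm _ hg.abs).add ((hgm _ hg).const_mul ε)).div_const 2)
    have hF0 : ∀ x, 0 ≤ F x := fun x => by
      have h1 := neg_abs_le (ε * ∏ i, g (x i))
      rw [abs_mul, hε, one_mul, habs] at h1
      simp only [hF]; linarith
    have iF : Integrable fun x => F x * ρ x := by
      have : (fun x => F x * ρ x) = fun x : Fin n → ℝ =>
          ((∏ i, |g (x i)|) * ρ x + ε * ((∏ i, g (x i)) * ρ x)) / 2 := by
        ext x; simp only [hF]; ring
      rw [this]
      exact (iA.add (iB.const_mul ε)).div_const 2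
    have hc := hρ.2 (fun x => ENNReal.ofReal (F x)) hFm.ennreal_ofReal
    have hT : ∀ ω, (∑' x : {x : Fin n → ℝ // Function.Injective x ∧ ∀ i, x i ∈ Ξ.points ω},
        ENNReal.ofReal (F x)) = ENNReal.ofReal (n ! *
          ((Ξ.esum L (fun x => |g x|) n ω + ε * Ξ.esum L g n ω) / 2)) := by
      intro ω
      rw [Ξ.tsum_tuples (L := L) (F := fun x => ENNReal.ofReal (F x)) (fun x hx => by
        obtain ⟨i, hi⟩ := hx
        have h0 : ∏ i, g (x i) = 0 := Finset.prod_eq_zero (Finset.mem_univ i) (hs _ hi)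
        simp only [hF]
        rw [← habs, h0]; simp), ← ENNReal.ofReal_sum_of_nonneg fun e _ => hF0 _]
      congr 1
      simp only [hF]
      rw [← Finset.sum_div, Finset.sum_add_distrib, ← Finset.mul_sum,
        Ξ.sum_tuples_eq_esum L (fun x => |g x|), Ξ.sum_tuples_eq_esum L g]
      ring
    simp_rw [hT] at hc
    have hc2 : ∫⁻ x, ENNReal.ofReal (F x) * ENNReal.ofReal (ρ x)
        = ENNReal.ofReal (∫ x, F x * ρ x) := by
      rw [ofReal_integral_eq_lintegral_ofReal iF
        (ae_of_all _ fun x => mul_nonneg (hF0 x) (hρ0 x))]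
      exact lintegral_congr fun x => (ENNReal.ofReal_mul (hF0 x)).symm
    rw [hc2] at hc
    set u : Ω → ℝ := fun ω => (Ξ.esum L (fun x => |g x|) n ω + ε * Ξ.esum L g n ω) / 2 with hu
    have hum : Measurable u :=
      ((Ξ.measurable_esum hg.abs n).add ((Ξ.measurable_esum hg n).const_mul ε)).div_const 2
    have hu0 : ∀ ω, 0 ≤ u ω := fun ω => by
      have h1 := neg_abs_le (ε * Ξ.esum L g n ω)
      rw [abs_mul, hε, one_mul] at h1
      have h2 := Ξ.abs_esum_le L g n ω
      simp only [hu]; linarith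
    have hn : (0 : ℝ) < n ! := by positivity
    have hu0' : ∀ ω, 0 ≤ n ! * u ω := fun ω => mul_nonneg hn.le (hu0 ω)
    have hI : Integrable (fun ω => (n ! : ℝ) * u ω) P := by
      refine ⟨(hum.const_mul _).aestronglyMeasurable, ?_⟩
      rw [hasFiniteIntegral_iff_ofReal (ae_of_all _ hu0'), hc]
      exact ENNReal.ofReal_lt_top
    have hI2 : Integrable u P := by
      have := hI.const_mul ((n ! : ℝ)⁻¹)
      simpa [← mul_assoc, hn.ne'] using this
    refine ⟨hI2, ?_⟩
    have h3 : ∫ ω, (n ! : ℝ) * u ω ∂P = ∫ x, F x * ρ x := by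
      rw [integral_eq_lintegral_of_nonneg_ae (ae_of_all _ hu0') hI.1, hc,
        ENNReal.toReal_ofReal (integral_nonneg fun x => mul_nonneg (hF0 x) (hρ0 x))]
    rw [← h3, integral_const_mul, ← mul_assoc, inv_mul_cancel₀ hn.ne', one_mul]
  obtain ⟨i1, e1⟩ := key 1 (by simp)
  obtain ⟨i2, e2⟩ := key (-1) (by simp)
  have eB : Ξ.esum L g n = fun ω => (Ξ.esum L (fun x => |g x|) n ω + 1 * Ξ.esum L g n ω) / 2
      - (Ξ.esum L (fun x => |g x|) n ω + -1 * Ξ.esum L g n ω) / 2 := by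
    ext ω; ring
  have eA : Ξ.esum L (fun x => |g x|) n = fun ω =>
      (Ξ.esum L (fun x => |g x|) n ω + 1 * Ξ.esum L g n ω) / 2
      + (Ξ.esum L (fun x => |g x|) n ω + -1 * Ξ.esum L g n ω) / 2 := by
    ext ω; ring
  have jB : Integrable (Ξ.esum L g n) P := by rw [eB]; exact i1.sub i2
  have jA : Integrable (Ξ.esum L (fun x => |g x|) n) P := by rw [eA]; exact i1.add i2
  have iF : ∀ ε : ℝ, Integrable fun x : Fin n → ℝ =>
      ((∏ i, |g (x i)|) + ε * ∏ i, g (x i)) / 2 * ρ x := fun ε => by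
    have : (fun x => ((∏ i, |g (x i)|) + ε * ∏ i, g (x i)) / 2 * ρ x) = fun x : Fin n → ℝ =>
        ((∏ i, |g (x i)|) * ρ x + ε * ((∏ i, g (x i)) * ρ x)) / 2 := by
      ext x; ring
    rw [this]
    exact (iA.add (iB.const_mul ε)).div_const 2
  refine ⟨jB, ?_, ?_⟩
  · rw [eB, integral_sub i1 i2, e1, e2, ← mul_sub, ← integral_sub (iF 1) (iF (-1))]
    congr 2
    ext x; ring
  · refine (integral_mono jB.abs jA (Ξ.abs_esum_le L g n)).trans ?_
    rw [eA, integral_add i1 i2, e1, e2, ← mul_add, ← integral_add (iF 1) (iF (-1))]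
    refine mul_le_mul_of_nonneg_left ?_ (by positivity)
    have h4 : ∫ x : Fin n → ℝ, ∏ i, (|g (x i)| * κ (x i)) = (∫ x, |g x| * κ x) ^ n := by
      rw [integral_fintype_prod_volume_eq_prod (f := fun _ y => |g y| * κ y)]
      simp
    rw [← h4]
    refine integral_mono ((iF 1).add (iF (-1))) hdom fun x => (le_of_eq ?_).trans (hle x)
    ring

end PointProcess

/-! ### Determinantal processes with spectral kernels: moments and Laplace functional. -/

/-- A kernel that is diagonal, with eigenvalues `p k ∈ [0, 1]`, in an orthonormal system `ϕ`, and
whose diagonal is finite and locally bounded. -/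
structure IsSpectral (p : ℕ → ℝ) (ϕ : ℕ → ℝ → ℝ) : Prop where
  mem_Icc : ∀ k, p k ∈ Set.Icc (0 : ℝ) 1
  measurable : ∀ k, Measurable (ϕ k)
  memLp : ∀ k, MemLp (ϕ k) 2
  orthonormal : ∀ j k, ∫ x, ϕ j x * ϕ k x = if j = k then 1 else 0
  summable : ∀ x, Summable fun k => p k * ϕ k x ^ 2
  bounded : ∀ L : ℝ, ∃ B, ∀ x ∈ Set.Icc (-L) L, ∑' k, p k * ϕ k x ^ 2 ≤ B

/-- The kernel with eigenvalues `p` and eigenfunctions `ϕ`. -/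
def spectralKernel (p : ℕ → ℝ) (ϕ : ℕ → ℝ → ℝ) (x y : ℝ) : ℝ := ∑' k, p k * ϕ k x * ϕ k y

/-- The first `M` eigenfunctions, weighted with the square roots of the eigenvalues. -/
def weighted (p : ℕ → ℝ) (ϕ : ℕ → ℝ → ℝ) (M : ℕ) (k : Fin M) (x : ℝ) : ℝ := √(p k) * ϕ k x

theorem spectralKernel_self (p : ℕ → ℝ) (ϕ : ℕ → ℝ → ℝ) (x : ℝ) :
    spectralKernel p ϕ x x = ∑' k, p k * ϕ k x ^ 2 :=
  tsum_congr fun k => by ring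

namespace IsSpectral

variable {p : ℕ → ℝ} {ϕ : ℕ → ℝ → ℝ} (h : IsSpectral p ϕ)
include h

theorem summable_mul (x y : ℝ) : Summable fun k => p k * ϕ k x * ϕ k y := by
  refine Summable.of_norm_bounded ((h.summable x).add (h.summable y)) fun k => ?_
  have h0 := (h.mem_Icc k).1
  rw [mul_assoc, Real.norm_eq_abs, abs_mul, abs_of_nonneg h0, ← mul_add]
  refine mul_le_mul_of_nonneg_left ?_ h0
  rw [abs_le]
  constructor <;> nlinarith [sq_nonneg (ϕ k x + ϕ k y), sq_nonneg (ϕ k x - ϕ k y)]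

theorem weighted_sum (M : ℕ) (x y : ℝ) :
    ∑ k, weighted p ϕ M k x * weighted p ϕ M k y = ∑ k ∈ Finset.range M, p k * ϕ k x * ϕ k y := by
  rw [← Fin.sum_univ_eq_sum_range (fun k => p k * ϕ k x * ϕ k y)]
  refine Finset.sum_congr rfl fun k _ => ?_
  have := Real.mul_self_sqrt (h.mem_Icc k).1
  simp only [weighted]
  linear_combination (ϕ k x * ϕ k y) * this

theorem tendsto_weighted_sum (x y : ℝ) :
    Tendsto (fun M => ∑ k, weighted p ϕ M k x * weighted p ϕ M k y) atTop
      (𝓝 (spectralKernel p ϕ x y)) := by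
  simp_rw [h.weighted_sum]
  exact (h.summable_mul x y).hasSum.tendsto_sum_nat

theorem weighted_self_le (M : ℕ) (x : ℝ) :
    ∑ k, weighted p ϕ M k x * weighted p ϕ M k x ≤ spectralKernel p ϕ x x := by
  rw [h.weighted_sum]
  exact (h.summable_mul x x).sum_le_tsum _ fun k _ => by
    rw [mul_assoc]; exact mul_nonneg (h.mem_Icc k).1 (mul_self_nonneg _)

theorem self_nonneg (x : ℝ) : 0 ≤ spectralKernel p ϕ x x := by
  rw [spectralKernel_self]
  exact tsum_nonneg fun k => mul_nonneg (h.mem_Icc k).1 (sq_nonneg _)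

theorem measurable_weighted (M : ℕ) (k : Fin M) : Measurable (weighted p ϕ M k) :=
  (h.measurable k).const_mul _

theorem memLp_weighted (M : ℕ) (k : Fin M) : MemLp (weighted p ϕ M k) 2 :=
  (h.memLp k).const_mul _

theorem measurable_spectralKernel {α : Type*} [MeasurableSpace α] {u v : α → ℝ}
    (hu : Measurable u) (hv : Measurable v) :
    Measurable fun a => spectralKernel p ϕ (u a) (v a) := by
  refine measurable_of_tendsto_metrizable
    (f := fun M a => ∑ k, weighted p ϕ M k (u a) * weighted p ϕ M k (v a)) (fun M => ?_)
    (tendsto_pi_nhds.2 fun a => h.tendsto_weighted_sum (u a) (v a))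
  exact Finset.measurable_fun_sum _ fun k _ => ((h.measurable_weighted M k).comp hu).mul
    ((h.measurable_weighted M k).comp hv)

/-- The truncated kernel matrix is B Bᵀ, so it is positive semidefinite and Hadamard's inequality
applies. The bound is uniform in the truncation M. -/
theorem det_trunc_mem (M n : ℕ) (x : Fin n → ℝ) :
    (Matrix.of fun i j => ∑ k, weighted p ϕ M k (x i) * weighted p ϕ M k (x j)).det
      ∈ Set.Icc 0 (∏ i, spectralKernel p ϕ (x i) (x i)) := by
  set B : Matrix (Fin n) (Fin M) ℝ := Matrix.of fun i k => weighted p ϕ M k (x i) with hB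
  have e : (Matrix.of fun i j => ∑ k, weighted p ϕ M k (x i) * weighted p ϕ M k (x j))
      = B * B.conjTranspose := by
    ext i j; simp [hB, Matrix.mul_apply]
  have hp : (B * B.conjTranspose).PosSemidef := Matrix.posSemidef_self_mul_conjTranspose B
  rw [e]
  refine ⟨hp.det_nonneg, (det_le_prod_diag hp).trans ?_⟩
  rw [← e]
  exact Finset.prod_le_prod (fun i _ => by
      rw [Matrix.of_apply]; exact Finset.sum_nonneg fun k _ => mul_self_nonneg _)
    fun i _ => h.weighted_self_le M (x i)

theorem tendsto_det_trunc (n : ℕ) (x : Fin n → ℝ) :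
    Tendsto (fun M =>
      (Matrix.of fun i j => ∑ k, weighted p ϕ M k (x i) * weighted p ϕ M k (x j)).det) atTop
      (𝓝 (Matrix.of fun i j => spectralKernel p ϕ (x i) (x j)).det) := by
  have hc : Continuous fun A : Matrix (Fin n) (Fin n) ℝ => A.det := continuous_id.matrix_det
  refine (hc.tendsto _).comp ?_
  exact tendsto_pi_nhds.2 fun i => tendsto_pi_nhds.2 fun j => h.tendsto_weighted_sum _ _

theorem det_mem (n : ℕ) (x : Fin n → ℝ) :
    (Matrix.of fun i j => spectralKernel p ϕ (x i) (x j)).det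
      ∈ Set.Icc 0 (∏ i, spectralKernel p ϕ (x i) (x i)) :=
  isClosed_Icc.mem_of_tendsto (h.tendsto_det_trunc n x)
    (Eventually.of_forall fun M => h.det_trunc_mem M n x)

theorem measurable_det (n : ℕ) : Measurable fun x : Fin n → ℝ =>
    (Matrix.of fun i j => spectralKernel p ϕ (x i) (x j)).det := by
  simp only [Matrix.det_apply']
  refine Finset.measurable_fun_sum _ fun σ _ => Measurable.const_mul ?_ _
  exact Finset.measurable_fun_prod _ fun i _ =>
    h.measurable_spectralKernel (measurable_pi_apply _) (measurable_pi_apply _)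

theorem measurable_det_trunc (M n : ℕ) : Measurable fun x : Fin n → ℝ =>
    (Matrix.of fun i j => ∑ k, weighted p ϕ M k (x i) * weighted p ϕ M k (x j)).det := by
  simp only [Matrix.det_apply']
  refine Finset.measurable_fun_sum _ fun σ _ => Measurable.const_mul ?_ _
  refine Finset.measurable_fun_prod _ fun i _ => ?_
  simp only [Matrix.of_apply]
  refine Finset.measurable_fun_sum _ fun k _ => ?_
  exact ((h.measurable_weighted M k).comp (measurable_pi_apply _)).mul
    ((h.measurable_weighted M k).comp (measurable_pi_apply _))

theorem integrable_mul_self {L : ℝ} {g : ℝ → ℝ} (hg : Integrable g)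
    (hs : ∀ x, x ∉ Set.Icc (-L) L → g x = 0) :
    Integrable fun x => |g x| * spectralKernel p ϕ x x := by
  obtain ⟨B, hB⟩ := h.bounded L
  refine (hg.abs.mul_const B).mono' (hg.1.norm.mul
    (h.measurable_spectralKernel measurable_id measurable_id).aestronglyMeasurable)
    (ae_of_all _ fun x => ?_)
  by_cases hx : x ∈ Set.Icc (-L) L
  · rw [Real.norm_of_nonneg (mul_nonneg (abs_nonneg _) (h.self_nonneg x))]
    refine mul_le_mul_of_nonneg_left ?_ (abs_nonneg _)
    rw [spectralKernel_self]
    exact hB x hx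
  · simp [hs x hx]

theorem integrable_gram {g : ℝ → ℝ} (hg : Measurable g)
    (hi : Integrable fun x => |g x| * spectralKernel p ϕ x x) (M : ℕ) (j k : Fin M) :
    Integrable fun x => g x * (weighted p ϕ M j x * weighted p ϕ M k x) := by
  refine hi.mono' (hg.mul ((h.measurable_weighted M j).mul
    (h.measurable_weighted M k))).aestronglyMeasurable (ae_of_all _ fun x => ?_)
  rw [Real.norm_eq_abs, abs_mul]
  refine mul_le_mul_of_nonneg_left ?_ (abs_nonneg _)
  have hj : ∀ i : Fin M, weighted p ϕ M i x * weighted p ϕ M i x ≤ spectralKernel p ϕ x x :=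
    fun i => (Finset.single_le_sum
      (f := fun k => weighted p ϕ M k x * weighted p ϕ M k x)
      (fun k _ => mul_self_nonneg _) (Finset.mem_univ i)).trans (h.weighted_self_le M x)
  have h1 := hj j
  have h2 := hj k
  rw [abs_le]
  constructor <;> nlinarith [sq_nonneg (weighted p ϕ M j x + weighted p ϕ M k x),
    sq_nonneg (weighted p ϕ M j x - weighted p ϕ M k x)]

/-- The truncated determinants are dominated by the product of the diagonal values of the full
kernel, so they may be integrated in the limit M → ∞; for finite M the integral is Andréief's sum of
minors. -/
theorem tendsto_integral_det {g : ℝ → ℝ} (hg : Measurable g)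
    (hi : Integrable fun x => |g x| * spectralKernel p ϕ x x) (n : ℕ) :
    Tendsto (fun M => ∑ κ : Fin n → Fin M,
        ((gram (weighted p ϕ M) g).submatrix κ κ).det) atTop
      (𝓝 (∫ x : Fin n → ℝ, (∏ i, g (x i)) *
        (Matrix.of fun i j => spectralKernel p ϕ (x i) (x j)).det)) ∧
    ∀ M, |∑ κ : Fin n → Fin M, ((gram (weighted p ϕ M) g).submatrix κ κ).det|
      ≤ (∫ x, |g x| * spectralKernel p ϕ x x) ^ n := by
  have e : ∀ M, ∑ κ : Fin n → Fin M, ((gram (weighted p ϕ M) g).submatrix κ κ).det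
      = ∫ x : Fin n → ℝ, (∏ i, g (x i)) *
        (Matrix.of fun i j => ∑ k, weighted p ϕ M k (x i) * weighted p ϕ M k (x j)).det :=
    fun M => (integral_prod_mul_det _ g (h.integrable_gram hg hi M)).symm
  have hgm : Measurable fun x : Fin n → ℝ => ∏ i, g (x i) :=
    Finset.measurable_fun_prod _ fun i _ => hg.comp (measurable_pi_apply i)
  have hdom : Integrable fun x : Fin n → ℝ => ∏ i, (|g (x i)| * spectralKernel p ϕ (x i) (x i)) :=
    Integrable.fintype_prod (f := fun _ y => |g y| * spectralKernel p ϕ y y) fun _ => hi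
  have hle : ∀ M, ∀ x : Fin n → ℝ, ‖(∏ i, g (x i)) *
      (Matrix.of fun i j => ∑ k, weighted p ϕ M k (x i) * weighted p ϕ M k (x j)).det‖
      ≤ ∏ i, (|g (x i)| * spectralKernel p ϕ (x i) (x i)) := fun M x => by
    have hd := h.det_trunc_mem M n x
    rw [Real.norm_eq_abs, abs_mul, Finset.abs_prod, abs_of_nonneg hd.1, Finset.prod_mul_distrib]
    exact mul_le_mul_of_nonneg_left hd.2 (Finset.prod_nonneg fun i _ => abs_nonneg _)
  have h4 : ∫ x : Fin n → ℝ, ∏ i, (|g (x i)| * spectralKernel p ϕ (x i) (x i))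
      = (∫ x, |g x| * spectralKernel p ϕ x x) ^ n := by
    rw [integral_fintype_prod_volume_eq_prod (f := fun _ y => |g y| * spectralKernel p ϕ y y)]
    simp
  simp_rw [e]
  refine ⟨?_, fun M => ?_⟩
  · refine tendsto_integral_of_dominated_convergence _
      (fun M => (hgm.mul (h.measurable_det_trunc M n)).aestronglyMeasurable) hdom
      (fun M => ae_of_all _ (hle M)) (ae_of_all _ fun x => ?_)
    exact (h.tendsto_det_trunc n x).const_mul _
  · rw [← h4]
    refine (abs_integral_le_integral_abs).trans ?_
    refine integral_mono_of_nonneg (ae_of_all _ fun x => abs_nonneg _) hdom (ae_of_all _ (hle M))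

/-- The Laplace functional of a determinantal process is a limit of determinants. -/
theorem integral_prod_one_add {Ω : Type*} [MeasurableSpace Ω] {Ξ : PointProcess Ω}
    {P : Measure Ω} (hΞ : Ξ.IsDeterminantal P (spectralKernel p ϕ)) {L : ℝ} {g : ℝ → ℝ}
    (hg : Measurable g) (hgi : Integrable g) (hs : ∀ x, x ∉ Set.Icc (-L) L → g x = 0) :
    Integrable (fun ω => ∏ x ∈ Ξ.pointsIn L ω, (1 + g x)) P ∧
    Tendsto (fun M => (1 + gram (weighted p ϕ M) g).det) atTop
      (𝓝 (∫ ω, ∏ x ∈ Ξ.pointsIn L ω, (1 + g x) ∂P)) := by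
  have hi := h.integrable_mul_self hgi hs
  set a := ∫ x, |g x| * spectralKernel p ϕ x x with ha
  -- Hadamard's inequality bounds the n-th term of the Fredholm series by aⁿ/n!, uniformly in M. It
  -- justifies both the termwise expectation and the limit M → ∞.
  have hsum : Summable fun n : ℕ => (n ! : ℝ)⁻¹ * a ^ n := by
    simpa [div_eq_inv_mul] using Real.summable_pow_div_factorial a
  have hE := fun n => Ξ.integral_esum (hΞ n) (h.measurable_det n) (fun x => (h.det_mem n x).1)
    (fun x => (h.det_mem n x).2) hg hs hi
  have hsE : Summable fun n => ∫ ω, ‖Ξ.esum L g n ω‖ ∂P :=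
    Summable.of_nonneg_of_le (fun n => integral_nonneg fun ω => norm_nonneg _)
      (fun n => (hE n).2.2) hsum
  have hHS := hasSum_integral_of_summable_integral_norm (fun n => (hE n).1) hsE
  have hIS : ∀ ω, ∑' n, Ξ.esum L g n ω = ∏ x ∈ Ξ.pointsIn L ω, (1 + g x) := fun ω =>
    (Ξ.prod_one_add L g ω).tsum_eq
  simp_rw [hIS] at hHS
  constructor
  · simp_rw [← hIS]
    have hm : Measurable fun ω => ∏ x ∈ Ξ.pointsIn L ω, (1 + g x) :=
      measurable_of_tendsto_metrizable
        (f := fun n ω => ∑ i ∈ Finset.range n, Ξ.esum L g i ω)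
        (fun n => Finset.measurable_fun_sum _ fun i _ => Ξ.measurable_esum hg i)
        (tendsto_pi_nhds.2 fun ω => (Ξ.prod_one_add L g ω).tendsto_sum_nat)
    simp_rw [← hIS] at hm
    refine ⟨hm.aestronglyMeasurable, ?_⟩
    calc ∫⁻ ω, ‖∑' n, Ξ.esum L g n ω‖ₑ ∂P ≤ ∫⁻ ω, ∑' n, ‖Ξ.esum L g n ω‖ₑ ∂P :=
          lintegral_mono fun ω => enorm_tsum_le_tsum_enorm
      _ = ∑' n, ∫⁻ ω, ‖Ξ.esum L g n ω‖ₑ ∂P :=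
          lintegral_tsum fun n => (Ξ.measurable_esum hg n).enorm.aemeasurable
      _ = ENNReal.ofReal (∑' n, ∫ ω, ‖Ξ.esum L g n ω‖ ∂P) := by
          rw [ENNReal.ofReal_tsum_of_nonneg (fun n => integral_nonneg fun ω => norm_nonneg _) hsE]
          exact tsum_congr fun n => (ofReal_integral_norm_eq_lintegral_enorm (hE n).1).symm
      _ < ∞ := ENNReal.ofReal_lt_top
  · rw [← hHS.tsum_eq]
    simp_rw [fun n => (hE n).2.1, ← fun M => (det_one_add_eq_sum (gram (weighted p ϕ M) g)).tsum_eq]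
    refine tendsto_tsum_of_dominated_convergence hsum (fun n => ?_)
      (Eventually.of_forall fun M n => ?_)
    · exact ((h.tendsto_integral_det hg hi n).1).const_mul _
    · rw [Real.norm_eq_abs, abs_mul, abs_of_nonneg (by positivity : (0 : ℝ) ≤ (n ! : ℝ)⁻¹)]
      exact mul_le_mul_of_nonneg_left ((h.tendsto_integral_det hg hi n).2 M) (by positivity)

end IsSpectral

theorem sum_det_fin_one {M : ℕ} (A : Matrix (Fin M) (Fin M) ℝ) :
    ∑ κ : Fin 1 → Fin M, (A.submatrix κ κ).det = A.trace := by
  rw [← (Equiv.funUnique (Fin 1) (Fin M)).symm.sum_comp]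
  refine Finset.sum_congr rfl fun k _ => ?_
  simp

/-- With `sum_det_fin_one`, this reads the first two factorial moments of a linear statistic as
traces. -/
theorem sum_det_fin_two {M : ℕ} (A : Matrix (Fin M) (Fin M) ℝ) :
    ∑ κ : Fin 2 → Fin M, (A.submatrix κ κ).det = A.trace ^ 2 - (A * A).trace := by
  rw [← (finTwoArrowEquiv (Fin M)).symm.sum_comp, Fintype.sum_prod_type]
  simp only [finTwoArrowEquiv_symm_apply, Matrix.det_fin_two, Matrix.submatrix_apply,
    Matrix.cons_val_zero, Matrix.cons_val_one, Finset.sum_sub_distrib]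
  rw [sq, Matrix.trace, Finset.sum_mul_sum]
  rfl

theorem integrable_of_sq {L : ℝ} {f : ℝ → ℝ} (hf2 : MemLp f 2)
    (hs : ∀ x, x ∉ Set.Icc (-L) L → f x = 0) : Integrable f := by
  have h1 : IntegrableOn f (Set.Icc (-L) L) := (hf2.restrict _).integrable one_le_two
  exact h1.integrable_of_forall_notMem_eq_zero hs

namespace PointProcess

variable {Ω : Type*} [MeasurableSpace Ω] (Ξ : PointProcess Ω)

theorem sum_eq_esum (L : ℝ) (f : ℝ → ℝ) (ω : Ω) :
    ∑ x ∈ Ξ.pointsIn L ω, f x = Ξ.esum L f 1 ω := by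
  simp [esum, Finset.powersetCard_one]

/-- The case n = 2 of Newton's identities: (Σf)² = Σf² + 2e₂. -/
theorem sum_sq_eq_esum (L : ℝ) (f : ℝ → ℝ) (ω : Ω) :
    (∑ x ∈ Ξ.pointsIn L ω, f x) ^ 2
      = Ξ.esum L (fun x => f x ^ 2) 1 ω + 2 * Ξ.esum L f 2 ω := by
  have h := newton_identity (Ξ.pointsIn L ω) f 2
  have hA : (Finset.HasAntidiagonal.antidiagonal 2).filter (fun a : ℕ × ℕ => a.1 < 2)
      = {(0, 2), (1, 1)} := by decide
  rw [hA, Finset.sum_pair (by decide)] at h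
  rw [← sum_eq_esum]
  have h1 := Ξ.sum_eq_esum L f ω
  simp only [esum] at h1 ⊢
  rw [← h1] at h
  simp at h
  rw [h]
  ring

end PointProcess

namespace IsSpectral

variable {p : ℕ → ℝ} {ϕ : ℕ → ℝ → ℝ} (h : IsSpectral p ϕ) {Ω : Type*} [MeasurableSpace Ω]
  {Ξ : PointProcess Ω} {P : Measure Ω} [IsProbabilityMeasure P]
  (hΞ : Ξ.IsDeterminantal P (spectralKernel p ϕ))
include h

/-- By orthonormality the Gram matrix of the weighted functions is diag(p_k), and p_k ≤ 1. -/
theorem posSemidef_one_sub_gram (M : ℕ) : (1 - gram (weighted p ϕ M) 1).PosSemidef := by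
  have e : 1 - gram (weighted p ϕ M) 1 = Matrix.diagonal fun k : Fin M => 1 - p k := by
    ext j k
    have h1 : gram (weighted p ϕ M) 1 j k = √(p j) * √(p k) * ∫ x, ϕ j x * ϕ k x := by
      rw [gram, Matrix.of_apply, ← integral_const_mul]
      congr 1
      ext x
      simp only [weighted, Pi.one_apply]
      ring
    rw [Matrix.sub_apply, h1, h.orthonormal]
    by_cases hjk : j = k
    · subst hjk
      simp [Real.mul_self_sqrt (h.mem_Icc _).1]
    · simp [hjk, Fin.val_injective.ne hjk]
  rw [e]
  exact Matrix.PosSemidef.diagonal fun k => sub_nonneg.2 (h.mem_Icc k).2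

theorem tilt_eq {f : ℝ → ℝ} (hf : Measurable f) {C : ℝ} (hC : ∀ x, |f x| ≤ C) (s : ℝ) (M : ℕ) :
    tilt (weighted p ϕ M) f s = 1 + gram (weighted p ϕ M) fun x => Real.exp (s * f x) - 1 := by
  have hi : ∀ j k, Integrable fun x =>
      Real.exp (s * f x) * (weighted p ϕ M j x * weighted p ϕ M k x) := fun j k => by
    simpa using integrable_mul_mul (h.memLp_weighted M) (by fun_prop)
      (abs_pow_mul_exp_le hC 0 s) j k
  ext j k
  have : gramExp (weighted p ϕ M) f 0 s j k - gram (weighted p ϕ M) 1 j k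
      = gram (weighted p ϕ M) (fun x => Real.exp (s * f x) - 1) j k := by
    simp only [gramExp, gram, Matrix.of_apply, pow_zero, one_mul, Pi.one_apply, sub_mul]
    exact (integral_sub (hi j k)
      ((h.memLp_weighted M j).integrable_mul (h.memLp_weighted M k))).symm
  simp only [tilt, Matrix.add_apply, Matrix.sub_apply]
  rw [← this]
  ring

variable {L : ℝ} {f : ℝ → ℝ} (hf : Measurable f) (hs : ∀ x, x ∉ Set.Icc (-L) L → f x = 0)

include hΞ hf hs

/-- Moments of a linear statistic, as limits of traces. -/
theorem moments (hf2 : MemLp f 2) :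
    MemLp (fun ω => ∑ x ∈ Ξ.pointsIn L ω, f x) 2 P ∧
    Tendsto (fun M => (gram (weighted p ϕ M) f).trace) atTop
      (𝓝 (∫ ω, ∑ x ∈ Ξ.pointsIn L ω, f x ∂P)) ∧
    Tendsto (fun M => (gram (weighted p ϕ M) fun x => f x ^ 2).trace
        - (gram (weighted p ϕ M) f * gram (weighted p ϕ M) f).trace) atTop
      (𝓝 (variance (fun ω => ∑ x ∈ Ξ.pointsIn L ω, f x) P)) := by
  have hfi := integrable_of_sq hf2 hs
  have hi := h.integrable_mul_self hfi hs
  have hs2 : ∀ x, x ∉ Set.Icc (-L) L → f x ^ 2 = 0 := fun x hx => by rw [hs x hx]; simp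
  have hi2 := h.integrable_mul_self hf2.integrable_sq hs2
  have E : ∀ n, _ := fun n => Ξ.integral_esum (hΞ n) (h.measurable_det n)
    (fun x => (h.det_mem n x).1) (fun x => (h.det_mem n x).2) hf hs hi
  have E2 := Ξ.integral_esum (hΞ 1) (h.measurable_det 1)
    (fun x => (h.det_mem 1 x).1) (fun x => (h.det_mem 1 x).2) (hf.pow_const 2) hs2 hi2
  have t1 := (h.tendsto_integral_det hf hi 1).1
  have t2 := (h.tendsto_integral_det hf hi 2).1
  have t3 := (h.tendsto_integral_det (hf.pow_const 2) hi2 1).1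
  simp only [sum_det_fin_one, sum_det_fin_two] at t1 t2 t3
  have e1 := (E 1).2.1
  have e2 := (E 2).2.1
  have e3 := E2.2.1
  simp only [Nat.factorial_one, Nat.cast_one, inv_one, one_mul, Nat.factorial_two,
    Nat.cast_ofNat] at e1 e2 e3
  rw [← e1] at t1
  rw [← e3] at t3
  have e2' : ∫ x : Fin 2 → ℝ, (∏ i, f (x i)) *
      (Matrix.of fun i j => spectralKernel p ϕ (x i) (x j)).det
        = 2 * ∫ ω, Ξ.esum L f 2 ω ∂P := by rw [e2]; ring
  rw [e2'] at t2
  have hm : Measurable fun ω => ∑ x ∈ Ξ.pointsIn L ω, f x := Ξ.measurable_sum_pointsIn hf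
  have hsq : Integrable (fun ω => (∑ x ∈ Ξ.pointsIn L ω, f x) ^ 2) P := by
    simp_rw [Ξ.sum_sq_eq_esum]
    exact E2.1.add ((E 2).1.const_mul 2)
  have hL : MemLp (fun ω => ∑ x ∈ Ξ.pointsIn L ω, f x) 2 P :=
    (memLp_two_iff_integrable_sq hm.aestronglyMeasurable).2 hsq
  refine ⟨hL, ?_, ?_⟩
  · simpa only [Ξ.sum_eq_esum] using t1
  · rw [variance_eq_sub hL]
    have e4 : ∫ ω, ((fun ω => ∑ x ∈ Ξ.pointsIn L ω, f x) ^ 2) ω ∂P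
        = (∫ ω, Ξ.esum L (fun x => f x ^ 2) 1 ω ∂P) + 2 * ∫ ω, Ξ.esum L f 2 ω ∂P := by
      simp only [Pi.pow_apply]
      simp_rw [Ξ.sum_sq_eq_esum]
      rw [integral_add E2.1 ((E 2).1.const_mul 2), integral_const_mul]
    rw [e4]
    simp_rw [Ξ.sum_eq_esum]
    -- The squared trace in the second factorial moment cancels the squared mean.
    convert (t3.add t2).sub (t1.pow 2) using 2
    ring

/-- A linear statistic of a determinantal process has a Laplace transform close to that of a
Gaussian variable with the same mean and variance. -/
theorem log_mgf_bound {C : ℝ} (hC : ∀ x, |f x| ≤ C) (s : ℝ) :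
    let X := fun ω => ∑ x ∈ Ξ.pointsIn L ω, f x
    Integrable (fun ω => Real.exp (s * X ω)) P ∧
    s ^ 2 / 2 * (variance X P * Real.exp (-(2 * C * |s|)))
      ≤ Real.log (∫ ω, Real.exp (s * X ω) ∂P) - s * ∫ ω, X ω ∂P ∧
    Real.log (∫ ω, Real.exp (s * X ω) ∂P) - s * ∫ ω, X ω ∂P
      ≤ s ^ 2 / 2 * (variance X P * Real.exp (2 * C * |s|)) := by
  intro X
  have hf2 : MemLp f 2 := by
    have h1 : MemLp f 2 (volume.restrict (Set.Icc (-L) L)) :=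
      MemLp.of_bound hf.aestronglyMeasurable C (ae_of_all _ hC)
    refine (memLp_indicator_iff_restrict measurableSet_Icc).2 h1 |>.ae_eq (ae_of_all _ fun x => ?_)
    by_cases hx : x ∈ Set.Icc (-L) L
    · simp [hx]
    · simp [hx, hs x hx]
  obtain ⟨-, hm, hv⟩ := h.moments hΞ hf hs hf2
  have hsg : ∀ x, x ∉ Set.Icc (-L) L → Real.exp (s * f x) - 1 = 0 := fun x hx => by
    simp [hs x hx]
  have hgm : Measurable fun x => Real.exp (s * f x) - 1 := by fun_prop
  have hgi : Integrable fun x => Real.exp (s * f x) - 1 := by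
    have h1 : IntegrableOn (fun x => Real.exp (s * f x) - 1) (Set.Icc (-L) L) := by
      refine Measure.integrableOn_of_bounded (M := Real.exp (|s| * C) + 1)
        isCompact_Icc.measure_lt_top.ne hgm.aestronglyMeasurable (ae_of_all _ fun x => ?_)
      have := abs_pow_mul_exp_le hC 0 s x
      simp only [pow_zero, one_mul] at this
      exact (norm_sub_le _ _).trans (by simpa using this)
    exact h1.integrable_of_forall_notMem_eq_zero hsg
  obtain ⟨hI, hT⟩ := h.integral_prod_one_add hΞ hgm hgi hsg
  have hprod : ∀ ω, ∏ x ∈ Ξ.pointsIn L ω, (1 + (Real.exp (s * f x) - 1))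
      = Real.exp (s * X ω) := fun ω => by
    simp only [add_sub_cancel, X]
    rw [← Real.exp_sum, Finset.mul_sum]
  simp_rw [hprod] at hI hT
  simp_rw [← fun M => h.tilt_eq hf hC s M] at hT
  -- The bounds hold for each truncation with constants independent of M, so they pass to the limit.
  have hlog := ((hT.log (integral_exp_pos hI).ne').sub (hm.const_mul s))
  have hb := fun M => log_det_tilt_bound (h.memLp_weighted M) (h.posSemidef_one_sub_gram M) hf hC s
  exact ⟨hI, le_of_tendsto_of_tendsto' ((hv.mul_const _).const_mul _) hlog fun M => (hb M).1,
    le_of_tendsto_of_tendsto' hlog ((hv.mul_const _).const_mul _) fun M => (hb M).2⟩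

end IsSpectral

/-! ### From Laplace transforms to characteristic functions. -/

theorem coeff_eq_zero_of_forall_hasSum {d : ℕ → ℝ} (hd : ∀ s : ℝ, HasSum (fun k => d k * s ^ k) 0)
    (k : ℕ) : d k = 0 := by
  have hp : HasFPowerSeriesOnBall (fun _ : ℝ => (0 : ℝ))
      (FormalMultilinearSeries.ofScalars ℝ d) 0 1 := by
    refine ⟨?_, one_pos, ?_⟩
    · have h1 : Summable fun n => ‖FormalMultilinearSeries.ofScalars ℝ d n‖ * ((1 : ℝ≥0) : ℝ) ^ n := by
        have := (hd 1).summable.abs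
        simpa [FormalMultilinearSeries.ofScalars_norm] using this
      simpa using FormalMultilinearSeries.le_radius_of_summable _ h1
    · intro y _
      simpa [FormalMultilinearSeries.ofScalars_apply_eq, mul_comm] using hd y
  have h0 := HasFPowerSeriesAt.eq_zero (p := FormalMultilinearSeries.ofScalars ℝ d) (x := 0)
    hp.hasFPowerSeriesAt
  have := FormalMultilinearSeries.coeff_ofScalars (𝕜 := ℝ) (p := d) (n := k)
  rw [← this, h0]
  rfl

/-- Since e^{r|Y|} ≤ e^{rY} + e^{-rY}, the moment series converges on all of ℂ. The first bound
plays the role of Cauchy's estimate for its coefficients. -/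
theorem hasSum_moments {Ω : Type*} [MeasurableSpace Ω] {P : Measure Ω}
    {Y : Ω → ℝ} (hY : AEMeasurable Y P) (hI : ∀ s : ℝ, Integrable (fun ω => Real.exp (s * Y ω)) P) :
    (∀ r : ℝ, 0 ≤ r → ∀ k : ℕ, |(k ! : ℝ)⁻¹ * ∫ ω, Y ω ^ k ∂P| * r ^ k
      ≤ (∫ ω, Real.exp (r * Y ω) ∂P) + ∫ ω, Real.exp (-r * Y ω) ∂P) ∧
    ∀ z : ℂ, HasSum (fun k : ℕ => (((k ! : ℝ)⁻¹ * ∫ ω, Y ω ^ k ∂P : ℝ) : ℂ) * z ^ k)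
      (∫ ω, Complex.exp (z * Y ω) ∂P) := by
  have hexp : ∀ r : ℝ, ∀ ω, Real.exp (|r| * |Y ω|) ≤ Real.exp (r * Y ω) + Real.exp (-r * Y ω) := by
    intro r ω
    rw [← abs_mul]
    rcases abs_cases (r * Y ω) with h | h
    · rw [h.1]; have := Real.exp_pos (-r * Y ω); linarith
    · rw [h.1, ← neg_mul]; have := Real.exp_pos (r * Y ω); linarith
  have hIa : ∀ r : ℝ, Integrable (fun ω => Real.exp (|r| * |Y ω|)) P := fun r => by
    refine ((hI r).add (hI (-r))).mono' (by fun_prop) (ae_of_all _ fun ω => ?_)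
    rw [Real.norm_of_nonneg (Real.exp_pos _).le]
    exact hexp r ω
  have hk : ∀ r : ℝ, 0 ≤ r → ∀ k : ℕ, ∀ ω, (k ! : ℝ)⁻¹ * (r * |Y ω|) ^ k ≤ Real.exp (r * |Y ω|) := by
    intro r hr k ω
    have := Real.pow_div_factorial_le_exp (r * |Y ω|) (by positivity) k
    rwa [div_eq_inv_mul] at this
  have hIk : ∀ k : ℕ, Integrable (fun ω => |Y ω| ^ k) P := fun k => by
    refine ((hIa 1).const_mul (k ! : ℝ)).mono' (by fun_prop) (ae_of_all _ fun ω => ?_)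
    have := hk 1 zero_le_one k ω
    rw [Real.norm_of_nonneg (by positivity)]
    rw [inv_mul_le_iff₀ (by positivity)] at this
    simpa using this
  constructor
  · intro r hr k
    rw [← integral_add (hI r) (hI (-r)), ← integral_const_mul]
    calc |∫ ω, (k ! : ℝ)⁻¹ * Y ω ^ k ∂P| * r ^ k ≤ (∫ ω, (k ! : ℝ)⁻¹ * |Y ω| ^ k ∂P) * r ^ k := by
          refine mul_le_mul_of_nonneg_right (abs_integral_le_integral_abs.trans (le_of_eq ?_))
            (by positivity)
          congr 1; ext ω
          rw [abs_mul, abs_pow, abs_of_pos (by positivity : (0 : ℝ) < (k ! : ℝ)⁻¹)]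
      _ = ∫ ω, (k ! : ℝ)⁻¹ * (r * |Y ω|) ^ k ∂P := by
          rw [← integral_mul_const]
          congr 1; ext ω; rw [mul_pow]; ring
      _ ≤ _ := by
          refine integral_mono ?_ ((hI r).add (hI (-r))) fun ω => ?_
          · simp_rw [mul_pow, ← mul_assoc]
            exact (hIk k).const_mul _
          · refine (hk r hr k ω).trans ?_
            have := hexp r ω
            rwa [abs_of_nonneg hr] at this
  · intro z
    have hsum : ∀ ω, HasSum (fun k : ℕ => ((k ! : ℂ)⁻¹ * (z * Y ω) ^ k))
        (Complex.exp (z * Y ω)) := fun ω => by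
      rw [Complex.exp_eq_exp_ℂ]
      simpa [div_eq_inv_mul] using NormedSpace.expSeries_div_hasSum_exp (z * (Y ω : ℂ))
    have hn : ∀ ω, HasSum (fun k : ℕ => ((k ! : ℝ)⁻¹ * (‖z‖ * |Y ω|) ^ k))
        (Real.exp (‖z‖ * |Y ω|)) := fun ω => by
      rw [Real.exp_eq_exp_ℝ]
      simpa [div_eq_inv_mul] using NormedSpace.expSeries_div_hasSum_exp (‖z‖ * |Y ω|)
    have hd := hasSum_integral_of_dominated_convergence (μ := P)
      (F := fun k ω => ((k ! : ℂ)⁻¹ * (z * Y ω) ^ k))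
      (fun k ω => (k ! : ℝ)⁻¹ * (‖z‖ * |Y ω|) ^ k)
      (fun k => by fun_prop) (fun k => ae_of_all _ fun ω => by simp)
      (ae_of_all _ fun ω => (hn ω).summable)
      (by
        have : (fun ω => ∑' k : ℕ, (k ! : ℝ)⁻¹ * (‖z‖ * |Y ω|) ^ k)
            = fun ω => Real.exp (‖z‖ * |Y ω|) := funext fun ω => (hn ω).tsum_eq
        rw [this]
        simpa using hIa ‖z‖) (ae_of_all _ hsum)
    have h1 : ∀ k : ℕ, (((k ! : ℝ)⁻¹ * ∫ ω, Y ω ^ k ∂P : ℝ) : ℂ) * z ^ k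
        = ∫ ω, (k ! : ℂ)⁻¹ * (z * Y ω) ^ k ∂P := by
      intro k
      have h2 : ∀ ω, (k ! : ℂ)⁻¹ * (z * Y ω) ^ k
          = ((k ! : ℂ)⁻¹ * z ^ k) * ((Y ω ^ k : ℝ) : ℂ) := fun ω => by
        rw [mul_pow]; push_cast; ring
      simp_rw [h2]
      rw [integral_const_mul, integral_complex_ofReal]
      push_cast
      ring
    simp_rw [h1]
    exact hd

/-- Convergence of the Laplace transforms to a Gaussian one implies the convergence of the
characteristic functions. -/
theorem tendsto_charFun_of_tendsto_mgf {ι : Type*} {l : Filter ι} {Ω : ι → Type*}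
    [∀ i, MeasurableSpace (Ω i)] {P : ∀ i, Measure (Ω i)} {Y : ∀ i, Ω i → ℝ}
    (hY : ∀ i, AEMeasurable (Y i) (P i))
    (hI : ∀ i, ∀ s : ℝ, Integrable (fun ω => Real.exp (s * Y i ω)) (P i)) {v : ℝ}
    (hlim : ∀ s : ℝ, Tendsto (fun i => ∫ ω, Real.exp (s * Y i ω) ∂(P i)) l
      (𝓝 (Real.exp (v * s ^ 2 / 2)))) (t : ℝ) :
    Tendsto (fun i => ∫ ω, Complex.exp (t * Complex.I * Y i ω) ∂(P i)) l
      (𝓝 (Complex.exp (-(v * t ^ 2 / 2)))) := by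
  -- Along an ultrafilter every bounded coefficient sequence converges, so no diagonal extraction of
  -- subsequences is needed.
  rw [tendsto_iff_ultrafilter]
  intro U hU
  set a : ι → ℕ → ℝ := fun i k => (k ! : ℝ)⁻¹ * ∫ ω, Y i ω ^ k ∂(P i) with ha
  set B : ℝ → ℝ := fun r => 2 * Real.exp (v * r ^ 2 / 2) + 1 with hB
  have hbd : ∀ r : ℝ, 0 ≤ r → ∀ᶠ i in (U : Filter ι), ∀ k, |a i k| * r ^ k ≤ B r := by
    intro r hr
    have h1 := ((hlim r).add (hlim (-r))).mono_left hU
    have h2 : Real.exp (v * r ^ 2 / 2) + Real.exp (v * (-r) ^ 2 / 2) < B r := by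
      simp only [hB, neg_sq]; linarith
    filter_upwards [h1.eventually (gt_mem_nhds h2)] with i hi k
    exact ((hasSum_moments (hY i) (hI i)).1 r hr k).trans hi.le
  have hconv : ∀ k, ∃ b, Tendsto (fun i => a i k) U (𝓝 b) := by
    intro k
    have h1 : ∀ᶠ i in (U : Filter ι), a i k ∈ Set.Icc (-B 1) (B 1) := by
      filter_upwards [hbd 1 zero_le_one] with i hi
      have := hi k
      rw [one_pow, mul_one] at this
      exact abs_le.1 this
    obtain ⟨b, _, hb⟩ := isCompact_Icc.ultrafilter_le_nhds (U.map fun i => a i k)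
      (le_principal_iff.2 h1)
    exact ⟨b, hb⟩
  choose b hb using hconv
  -- convergence of the entire functions
  have hpow : ∀ z : ℂ, Tendsto (fun i => ∫ ω, Complex.exp (z * Y i ω) ∂(P i)) U
      (𝓝 (∑' k : ℕ, (b k : ℂ) * z ^ k)) ∧ Summable fun k : ℕ => (b k : ℂ) * z ^ k := by
    intro z
    -- A radius exceeding 2‖z‖ makes the coefficient bounds at r dominate the series at z by a
    -- geometric one.
    set r := 2 * ‖z‖ + 1 with hr
    have hr0 : 0 < r := by positivity
    have hq : ‖z‖ / r ≤ 1 / 2 := by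
      rw [div_le_div_iff₀ hr0 two_pos]; linarith
    have hg : Summable fun k : ℕ => B r * (1 / 2 : ℝ) ^ k :=
      (summable_geometric_of_lt_one (by norm_num) (by norm_num)).mul_left _
    have hB0 : 0 ≤ B r := by simp only [hB]; positivity
    have hle : ∀ c : ℝ, ∀ k : ℕ, |c| * r ^ k ≤ B r → ‖(c : ℂ) * z ^ k‖ ≤ B r * (1 / 2 : ℝ) ^ k := by
      intro c k hc
      rw [norm_mul, norm_pow, Complex.norm_real, Real.norm_eq_abs]
      calc |c| * ‖z‖ ^ k = (|c| * r ^ k) * (‖z‖ / r) ^ k := by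
            rw [div_pow]; field_simp
        _ ≤ B r * (1 / 2) ^ k := by gcongr
    have hbb : ∀ k, |b k| * r ^ k ≤ B r := fun k =>
      le_of_tendsto ((hb k).abs.mul_const _) ((hbd r hr0.le).mono fun i hi => hi k)
    constructor
    · have h1 : (fun i => ∫ ω, Complex.exp (z * Y i ω) ∂(P i))
          = fun i => ∑' k : ℕ, (a i k : ℂ) * z ^ k := by
        ext i
        exact ((hasSum_moments (hY i) (hI i)).2 z).tsum_eq.symm
      rw [h1]
      refine tendsto_tsum_of_dominated_convergence hg (fun k => ?_) ?_
      · exact ((Complex.continuous_ofReal.tendsto _).comp (hb k)).mul_const _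
      · filter_upwards [hbd r hr0.le] with i hi k
        exact hle _ k (hi k)
    · exact Summable.of_norm_bounded hg fun k => hle _ k (hbb k)
  -- the coefficients of the limit
  set c : ℕ → ℝ := fun k => if Even k then (v / 2) ^ (k / 2) / (k / 2)! else 0 with hc
  have hcs : ∀ z : ℂ, HasSum (fun k : ℕ => (c k : ℂ) * z ^ k) (Complex.exp (v / 2 * z ^ 2)) := by
    intro z
    have h1 : HasSum (fun j : ℕ => (v / 2 * z ^ 2 : ℂ) ^ j / (j ! : ℂ))
        (Complex.exp (v / 2 * z ^ 2)) := by
      rw [Complex.exp_eq_exp_ℂ]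
      exact NormedSpace.expSeries_div_hasSum_exp (v / 2 * z ^ 2 : ℂ)
    have hinj : Function.Injective fun j : ℕ => 2 * j := fun i j hij => by
      simpa using hij
    rw [← hinj.hasSum_iff (f := fun k : ℕ => (c k : ℂ) * z ^ k)]
    · convert h1 using 1
      ext j
      have : 2 * j / 2 = j := by omega
      simp only [Function.comp, hc, even_two_mul, if_true, this, mul_pow, pow_mul]
      push_cast
      ring
    · intro k hk
      have : ¬ Even k := fun ⟨m, hm⟩ => hk ⟨m, by simp only; omega⟩
      simp [hc, this]
  -- On the real axis the limiting power series has the value exp(vs²/2), so its coefficients are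
  -- those of the Gaussian; evaluation at z = it gives the characteristic function.
  have hbc : ∀ k, b k = c k := by
    intro k
    rw [← sub_eq_zero]
    refine coeff_eq_zero_of_forall_hasSum (d := fun k => b k - c k) (fun s => ?_) k
    have h1 := (hpow (s : ℂ)).1
    have h2 : Tendsto (fun i => ∫ ω, Complex.exp ((s : ℂ) * Y i ω) ∂(P i)) U
        (𝓝 (Complex.exp (v / 2 * (s : ℂ) ^ 2))) := by
      have h3 := (Complex.continuous_ofReal.tendsto _).comp ((hlim s).mono_left hU)
      have h4 : (Complex.ofReal ∘ fun i => ∫ ω, Real.exp (s * Y i ω) ∂(P i))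
          = fun i => ∫ ω, Complex.exp ((s : ℂ) * Y i ω) ∂(P i) := by
        ext i
        simp only [Function.comp]
        rw [← integral_complex_ofReal]
        push_cast
        rfl
      rw [h4] at h3
      convert h3 using 2
      push_cast
      ring_nf
    have h5 := (hpow (s : ℂ)).2.hasSum
    rw [tendsto_nhds_unique h1 h2] at h5
    have h6 := h5.sub (hcs s)
    rw [sub_self] at h6
    have h7 : (fun k : ℕ => (b k : ℂ) * (s : ℂ) ^ k - (c k : ℂ) * (s : ℂ) ^ k)
        = fun k : ℕ => (((b k - c k) * s ^ k : ℝ) : ℂ) := by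
      ext k; push_cast; ring
    rw [h7] at h6
    exact Complex.hasSum_ofReal.1 (by simpa using h6)
  have h1 := (hpow (t * Complex.I)).1
  simp_rw [hbc] at h1
  rw [(hcs _).tsum_eq] at h1
  convert h1 using 2
  rw [mul_pow, Complex.I_sq]
  ring_nf

/-! ### Hermite functions: recurrence, oscillator equation, orthonormality. -/

section Hermite

/-- The coefficients of the three-term recurrence of the Hermite functions. -/
def jac (n : ℕ) : ℝ := √((n : ℝ) / 2)

/-- This makes the truncated index n - 1 harmless at n = 0: its coefficient vanishes. -/
theorem jac_zero : jac 0 = 0 := by simp [jac]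

theorem jac_sq (n : ℕ) : jac n ^ 2 = n / 2 := Real.sq_sqrt (by positivity)

theorem jac_nonneg (n : ℕ) : 0 ≤ jac n := Real.sqrt_nonneg _

theorem jac_succ_pos (n : ℕ) : 0 < jac (n + 1) := Real.sqrt_pos.2 (by positivity)

theorem contDiff_gauss : ContDiff ℝ ⊤ fun t : ℝ => Real.exp (-t ^ 2) := by fun_prop

theorem hasDerivAt_iteratedDeriv_gauss (n : ℕ) (x : ℝ) :
    HasDerivAt (iteratedDeriv n fun t : ℝ => Real.exp (-t ^ 2))
      (iteratedDeriv (n + 1) (fun t : ℝ => Real.exp (-t ^ 2)) x) x := by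
  rw [iteratedDeriv_succ]
  exact ((contDiff_gauss.of_le le_top).differentiable_iteratedDeriv n
    (by exact_mod_cast WithTop.coe_lt_top _) x).hasDerivAt

theorem iteratedDeriv_gauss_one (x : ℝ) :
    iteratedDeriv 1 (fun t : ℝ => Real.exp (-t ^ 2)) x = -2 * x * Real.exp (-x ^ 2) := by
  rw [iteratedDeriv_one]
  have : HasDerivAt (fun t : ℝ => Real.exp (-t ^ 2)) (Real.exp (-x ^ 2) * -(2 * x)) x := by
    simpa using ((hasDerivAt_pow 2 x).neg).exp
  rw [this.deriv]; ring

theorem iteratedDeriv_gauss_add_two (n : ℕ) (x : ℝ) :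
    iteratedDeriv (n + 2) (fun t : ℝ => Real.exp (-t ^ 2)) x
      = -2 * x * iteratedDeriv (n + 1) (fun t : ℝ => Real.exp (-t ^ 2)) x
        - 2 * (n + 1) * iteratedDeriv n (fun t : ℝ => Real.exp (-t ^ 2)) x := by
  induction n generalizing x with
  | zero =>
    have h1 : HasDerivAt (iteratedDeriv 1 fun t : ℝ => Real.exp (-t ^ 2)) _ x :=
      hasDerivAt_iteratedDeriv_gauss 1 x
    have h2 : HasDerivAt (iteratedDeriv 1 fun t : ℝ => Real.exp (-t ^ 2))
        (-2 * 1 * Real.exp (-x ^ 2) + -2 * x * (Real.exp (-x ^ 2) * -(2 * x))) x := by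
      have e : (iteratedDeriv 1 fun t : ℝ => Real.exp (-t ^ 2))
          = fun x => -2 * x * Real.exp (-x ^ 2) := funext iteratedDeriv_gauss_one
      rw [e]
      have h3 : HasDerivAt (fun t : ℝ => Real.exp (-t ^ 2)) (Real.exp (-x ^ 2) * -(2 * x)) x := by
        simpa using ((hasDerivAt_pow 2 x).neg).exp
      exact ((hasDerivAt_id x).const_mul (-2)).mul h3
    rw [h1.unique h2, iteratedDeriv_gauss_one, iteratedDeriv_zero]
    push_cast
    ring
  | succ n ih =>
    have h1 := hasDerivAt_iteratedDeriv_gauss (n + 2) x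
    have h2 := (((hasDerivAt_id x).const_mul (-2)).mul
      (hasDerivAt_iteratedDeriv_gauss (n + 1) x)).sub
        ((hasDerivAt_iteratedDeriv_gauss n x).const_mul (2 * ((n : ℝ) + 1)))
    have h3 := h1.unique (h2.congr_of_eventuallyEq (Eventually.of_forall ih))
    rw [h3]
    simp only [id_eq]
    push_cast
    ring

/-- The normalisation constant of the Hermite functions. -/
def hermiteConst (n : ℕ) : ℝ := (-1) ^ n / √((n ! : ℝ) * 2 ^ n * √Real.pi)

theorem hermiteConst_succ (n : ℕ) :
    hermiteConst n = -(2 * jac (n + 1)) * hermiteConst (n + 1) := by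
  have h1 : √(((n + 1)! : ℝ) * 2 ^ (n + 1) * √Real.pi)
      = 2 * jac (n + 1) * √((n ! : ℝ) * 2 ^ n * √Real.pi) := by
    have h2 : (2 * jac (n + 1)) = √(2 * (n + 1)) := by
      rw [jac, show (2 : ℝ) = √4 by rw [show (4 : ℝ) = 2 ^ 2 by norm_num]; simp,
        ← Real.sqrt_mul (by norm_num)]
      congr 1
      rw [show (4 : ℝ) = 2 ^ 2 by norm_num]
      simp only [Nat.ofNat_nonneg, Real.sqrt_sq]
      push_cast; ring
    rw [h2, ← Real.sqrt_mul (by positivity)]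
    congr 1
    rw [Nat.factorial_succ]
    push_cast
    ring
  have hj := jac_succ_pos n
  have hp : 0 < √((n ! : ℝ) * 2 ^ n * √Real.pi) := by
    have := Real.pi_pos
    positivity
  rw [hermiteConst, hermiteConst, h1, pow_succ]
  field_simp

theorem hermiteFun_eq (n : ℕ) (x : ℝ) : hermiteFun n x = Real.exp (x ^ 2 / 2) *
    (hermiteConst n * iteratedDeriv n (fun t : ℝ => Real.exp (-t ^ 2)) x) := by
  rw [hermiteFun, hermiteConst]; ring

/-- Three-term recurrence. -/
theorem mul_hermiteFun (n : ℕ) (x : ℝ) :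
    x * hermiteFun n x = jac (n + 1) * hermiteFun (n + 1) x + jac n * hermiteFun (n - 1) x := by
  rcases n with _ | n
  · simp only [jac_zero, zero_mul, add_zero, zero_add, hermiteFun_eq, iteratedDeriv_gauss_one,
      iteratedDeriv_zero]
    rw [hermiteConst_succ 0]
    simp only [zero_add]
    ring
  · simp only [Nat.add_sub_cancel, hermiteFun_eq]
    rw [iteratedDeriv_gauss_add_two, hermiteConst_succ n, hermiteConst_succ (n + 1)]
    have h1 := jac_sq (n + 1)
    push_cast at h1
    linear_combination (-4 * Real.exp (x ^ 2 / 2) * jac (n + 1 + 1) * hermiteConst (n + 1 + 1)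
      * iteratedDeriv n (fun t : ℝ => Real.exp (-t ^ 2)) x) * h1

theorem hasDerivAt_hermiteFun (n : ℕ) (x : ℝ) : HasDerivAt (hermiteFun n)
    (jac n * hermiteFun (n - 1) x - jac (n + 1) * hermiteFun (n + 1) x) x := by
  have h1 : HasDerivAt (fun x : ℝ => Real.exp (x ^ 2 / 2)) (Real.exp (x ^ 2 / 2) * x) x := by
    simpa using ((hasDerivAt_pow 2 x).div_const 2).exp
  have h2 := h1.mul ((hasDerivAt_iteratedDeriv_gauss n x).const_mul (hermiteConst n))
  have e : hermiteFun n = _ := funext (hermiteFun_eq n)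
  rw [e]
  convert! h2 using 1
  have h3 := mul_hermiteFun n x
  have h4 := hermiteFun_eq (n + 1) x
  have h5 := hermiteFun_eq n x
  rw [hermiteConst_succ n] at h5 ⊢
  linear_combination -h3 + x * h5 - 2 * jac (n + 1) * h4

/-- The derivative of the Hermite functions. -/
def hermiteDeriv (n : ℕ) (x : ℝ) : ℝ :=
  jac n * hermiteFun (n - 1) x - jac (n + 1) * hermiteFun (n + 1) x

/-- The oscillator equation h'' = -(2n + 1 - x²) h, obtained from the ladder form of the derivative
and the three-term recurrence. -/
theorem hasDerivAt_hermiteDeriv (n : ℕ) (x : ℝ) :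
    HasDerivAt (hermiteDeriv n) (-((2 * n + 1 - x ^ 2) * hermiteFun n x)) x := by
  have h := ((hasDerivAt_hermiteFun (n - 1) x).const_mul (jac n)).sub
    ((hasDerivAt_hermiteFun (n + 1) x).const_mul (jac (n + 1)))
  convert! h using 1
  have t1 := mul_hermiteFun n x
  have t2 := mul_hermiteFun (n + 1) x
  have j1 := jac_sq (n + 1)
  simp only [Nat.add_sub_cancel] at t2 ⊢
  push_cast at j1
  rcases n with _ | n
  · simp only [jac_zero, zero_mul, add_zero, zero_add] at *
    push_cast
    linear_combination (x * t1) + jac 1 * t2 + 2 * hermiteFun 0 x * j1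
  · have t3 := mul_hermiteFun n x
    have j2 := jac_sq (n + 1)
    simp only [Nat.add_sub_cancel] at *
    push_cast at *
    linear_combination x * t1 + jac (n + 1 + 1) * t2 + jac (n + 1) * t3
      + 2 * hermiteFun (n + 1) x * j1 + 2 * hermiteFun (n + 1) x * j2

theorem continuous_hermiteFun (n : ℕ) : Continuous (hermiteFun n) :=
  continuous_iff_continuousAt.2 fun x => (hasDerivAt_hermiteFun n x).continuousAt

theorem continuous_hermiteDeriv (n : ℕ) : Continuous (hermiteDeriv n) :=
  continuous_iff_continuousAt.2 fun x => (hasDerivAt_hermiteDeriv n x).continuousAt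

theorem exists_polynomial_hermiteFun (n : ℕ) : ∃ Q : Polynomial ℝ, ∀ x,
    hermiteFun n x = Q.eval x * Real.exp (-x ^ 2 / 2) := by
  have h0 : ∀ n, ∃ Q : Polynomial ℝ, ∀ x,
      iteratedDeriv n (fun t : ℝ => Real.exp (-t ^ 2)) x = Q.eval x * Real.exp (-x ^ 2) := by
    intro n
    induction n using Nat.strong_induction_on with
    | _ n ih =>
      rcases n with _ | _ | n
      · exact ⟨1, fun x => by simp⟩
      · exact ⟨Polynomial.C (-2) * Polynomial.X, fun x => by
          rw [iteratedDeriv_gauss_one]; simp⟩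
      · obtain ⟨Q₁, h₁⟩ := ih n (by omega)
        obtain ⟨Q₂, h₂⟩ := ih (n + 1) (by omega)
        refine ⟨Polynomial.C (-2) * Polynomial.X * Q₂ - Polynomial.C (2 * ((n : ℝ) + 1)) * Q₁,
          fun x => ?_⟩
        rw [iteratedDeriv_gauss_add_two, h₁, h₂]
        simp only [Polynomial.eval_sub, Polynomial.eval_mul, Polynomial.eval_C, Polynomial.eval_X]
        ring
  obtain ⟨Q, hQ⟩ := h0 n
  refine ⟨Polynomial.C (hermiteConst n) * Q, fun x => ?_⟩
  rw [hermiteFun_eq, hQ]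
  have : Real.exp (x ^ 2 / 2) * Real.exp (-x ^ 2) = Real.exp (-x ^ 2 / 2) := by
    rw [← Real.exp_add]; congr 1; ring
  simp only [Polynomial.eval_mul, Polynomial.eval_C]
  linear_combination (hermiteConst n * Q.eval x) * this

theorem integrable_polynomial_mul_gauss (Q : Polynomial ℝ) :
    Integrable fun x : ℝ => Q.eval x * Real.exp (-x ^ 2) := by
  induction Q using Polynomial.induction_on' with
  | add p q hp hq =>
    simp only [Polynomial.eval_add, add_mul]
    exact hp.add hq
  | monomial n a =>
    have := (integrable_rpow_mul_exp_neg_mul_sq (b := 1) one_pos (s := n)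
      (by have : (0 : ℝ) ≤ n := by positivity
          linarith)).const_mul a
    simpa [Polynomial.eval_monomial, mul_assoc] using this

theorem integrable_hermiteFun_mul (j k : ℕ) :
    Integrable fun x => hermiteFun j x * hermiteFun k x := by
  obtain ⟨Q, hQ⟩ := exists_polynomial_hermiteFun j
  obtain ⟨R, hR⟩ := exists_polynomial_hermiteFun k
  have := integrable_polynomial_mul_gauss (Q * R)
  refine this.congr (ae_of_all _ fun x => ?_)
  have e : Real.exp (-x ^ 2) = Real.exp (-x ^ 2 / 2) * Real.exp (-x ^ 2 / 2) := by
    rw [← Real.exp_add]; congr 1; ring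
  simp only [Polynomial.eval_mul]
  rw [hQ, hR, e]; ring

theorem memLp_hermiteFun (k : ℕ) : MemLp (hermiteFun k) 2 := by
  rw [memLp_two_iff_integrable_sq (continuous_hermiteFun k).aestronglyMeasurable]
  simpa [sq] using integrable_hermiteFun_mul k k

theorem hasDerivAt_hermiteFun_mul (j k : ℕ) (x : ℝ) :
    HasDerivAt (fun x => hermiteFun j x * hermiteFun k x)
      ((jac j * (hermiteFun (j - 1) x * hermiteFun k x)
        - jac (j + 1) * (hermiteFun (j + 1) x * hermiteFun k x))
      + (jac k * (hermiteFun j x * hermiteFun (k - 1) x)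
        - jac (k + 1) * (hermiteFun j x * hermiteFun (k + 1) x))) x := by
  convert! (hasDerivAt_hermiteFun j x).mul (hasDerivAt_hermiteFun k x) using 1
  ring

/-- The lowering operator is adjoint to the raising one: add the identity ∫ (h_j h_k)' = 0 to the
symmetry of multiplication by x. -/
theorem jac_mul_integral (j k : ℕ) : jac j * ∫ x, hermiteFun (j - 1) x * hermiteFun k x
    = jac (k + 1) * ∫ x, hermiteFun j x * hermiteFun (k + 1) x := by
  have I := integrable_hermiteFun_mul
  have i1 := (I (j - 1) k).const_mul (jac j)
  have i2 := (I (j + 1) k).const_mul (jac (j + 1))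
  have i3 := (I j (k - 1)).const_mul (jac k)
  have i4 := (I j (k + 1)).const_mul (jac (k + 1))
  have i12 : Integrable fun x => jac j * (hermiteFun (j - 1) x * hermiteFun k x)
      - jac (j + 1) * (hermiteFun (j + 1) x * hermiteFun k x) := i1.sub i2
  have i34 : Integrable fun x => jac k * (hermiteFun j x * hermiteFun (k - 1) x)
      - jac (k + 1) * (hermiteFun j x * hermiteFun (k + 1) x) := i3.sub i4
  have h1 := integral_eq_zero_of_hasDerivAt_of_integrable (hasDerivAt_hermiteFun_mul j k)
    (i12.add i34) (I j k)
  rw [integral_add i12 i34, integral_sub i1 i2, integral_sub i3 i4] at h1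
  have h2 : ∫ x, (jac (j + 1) * (hermiteFun (j + 1) x * hermiteFun k x)
      + jac j * (hermiteFun (j - 1) x * hermiteFun k x))
      = ∫ x, (jac (k + 1) * (hermiteFun j x * hermiteFun (k + 1) x)
      + jac k * (hermiteFun j x * hermiteFun (k - 1) x)) := by
    congr 1
    ext x
    have t1 := mul_hermiteFun j x
    have t2 := mul_hermiteFun k x
    linear_combination -hermiteFun k x * t1 + hermiteFun j x * t2
  rw [integral_add i2 i1, integral_add i4 i3] at h2
  simp only [integral_const_mul] at h1 h2
  linarith

/-- By adjointness the inner product at (j + 1, k + 1) reduces to the one at (j, k), ending at index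
0 with the Gaussian integral. -/
theorem hermiteFun_orthonormal (j k : ℕ) :
    ∫ x, hermiteFun j x * hermiteFun k x = if j = k then 1 else 0 := by
  have h0 : ∀ k, ∫ x, hermiteFun 0 x * hermiteFun (k + 1) x = 0 := fun k => by
    have := jac_mul_integral 0 k
    rw [jac_zero, zero_mul] at this
    exact (mul_eq_zero.1 this.symm).resolve_left (jac_succ_pos k).ne'
  induction j generalizing k with
  | zero =>
    rcases k with _ | k
    · have h1 : ∀ x, hermiteFun 0 x * hermiteFun 0 x
          = (√Real.pi)⁻¹ * Real.exp (-1 * x ^ 2) := by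
        intro x
        have e : Real.exp (x ^ 2 / 2) * Real.exp (x ^ 2 / 2) * Real.exp (-x ^ 2) = 1 := by
          rw [← Real.exp_add, ← Real.exp_add]; simp
        have hp : √(√Real.pi) * √(√Real.pi) = √Real.pi := Real.mul_self_sqrt (Real.sqrt_nonneg _)
        have hp0 : 0 < √Real.pi := Real.sqrt_pos.2 Real.pi_pos
        have hc : hermiteConst 0 * hermiteConst 0 = (√Real.pi)⁻¹ := by
          simp only [hermiteConst, pow_zero, Nat.factorial_zero, Nat.cast_one, one_mul]
          rw [div_mul_div_comm, hp]; simp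
        rw [hermiteFun_eq, iteratedDeriv_zero, neg_one_mul, ← hc]
        linear_combination (hermiteConst 0 * hermiteConst 0 * Real.exp (-x ^ 2)) * e
      simp_rw [h1]
      rw [integral_const_mul, integral_gaussian]
      have hp0 : 0 < √Real.pi := Real.sqrt_pos.2 Real.pi_pos
      simp [hp0.ne']
    · rw [h0]; simp
  | succ j ih =>
    rcases k with _ | k
    · simp_rw [mul_comm (hermiteFun (j + 1) _)]
      rw [h0]; simp
    · have := jac_mul_integral (j + 1) k
      simp only [Nat.add_sub_cancel] at this
      rw [ih] at this
      by_cases hjk : j = k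
      · subst hjk
        simp only [if_true, mul_one] at this ⊢
        exact (mul_left_cancel₀ (jac_succ_pos j).ne' (by linarith))
      · have hjk' : ¬ j + 1 = k + 1 := by omega
        simp only [hjk, hjk', if_false, mul_zero] at this ⊢
        exact (mul_eq_zero.1 this.symm).resolve_left (jac_succ_pos k).ne'

/-- The partial sums of the squares of the Hermite functions are uniformly bounded. -/
theorem sum_hermiteFun_sq_le (n : ℕ) (x : ℝ) :
    ∑ k ∈ Finset.range n, hermiteFun k x ^ 2 ≤ 2 * jac n := by
  -- The derivative of the sum telescopes to a single product. Integrating from x to ∞ and using 2ab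
  -- ≤ a² + b² with unit norms yields a bound independent of x.
  have hd : ∀ y, HasDerivAt (fun y => ∑ k ∈ Finset.range n, hermiteFun k y ^ 2)
      (-(2 * jac n * (hermiteFun n y * hermiteFun (n - 1) y))) y := by
    intro y
    have h1 : HasDerivAt (fun y => ∑ k ∈ Finset.range n, hermiteFun k y ^ 2)
        (∑ k ∈ Finset.range n, (2 * jac k * (hermiteFun k y * hermiteFun (k - 1) y)
          - 2 * jac (k + 1) * (hermiteFun (k + 1) y * hermiteFun (k + 1 - 1) y))) y := by
      refine HasDerivAt.fun_sum fun k _ => ?_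
      convert! (hasDerivAt_hermiteFun k y).pow 2 using 1
      simp only [Nat.add_sub_cancel]
      push_cast
      ring
    rw [Finset.sum_range_sub'] at h1
    simpa [jac_zero] using h1
  have hi1 : Integrable fun y => ∑ k ∈ Finset.range n, hermiteFun k y ^ 2 :=
    integrable_finsetSum _ fun k _ => by simpa [sq] using integrable_hermiteFun_mul k k
  have hi2 : Integrable fun y => -(2 * jac n * (hermiteFun n y * hermiteFun (n - 1) y)) :=
    ((integrable_hermiteFun_mul n (n - 1)).const_mul _).neg
  have hlim := tendsto_zero_of_hasDerivAt_of_integrableOn_Ioi (a := x) (fun y _ => hd y)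
    hi2.integrableOn hi1.integrableOn
  have h2 := integral_Ioi_of_hasDerivAt_of_tendsto' (a := x) (fun y _ => hd y) hi2.integrableOn hlim
  have h3 : ∑ k ∈ Finset.range n, hermiteFun k x ^ 2
      = ∫ y in Set.Ioi x, 2 * jac n * (hermiteFun n y * hermiteFun (n - 1) y) := by
    rw [integral_neg] at h2
    linarith
  rw [h3]
  have hj := jac_nonneg n
  have hsq : ∀ k, Integrable fun y => hermiteFun k y ^ 2 := fun k => by
    simpa [sq] using integrable_hermiteFun_mul k k
  have hone : ∀ k, ∫ y, hermiteFun k y ^ 2 = 1 := fun k => by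
    simpa [sq] using hermiteFun_orthonormal k k
  calc ∫ y in Set.Ioi x, 2 * jac n * (hermiteFun n y * hermiteFun (n - 1) y)
      ≤ ∫ y in Set.Ioi x, jac n * (hermiteFun n y ^ 2 + hermiteFun (n - 1) y ^ 2) := by
        refine integral_mono ((integrable_hermiteFun_mul n (n - 1)).const_mul _).integrableOn
          (((hsq n).add (hsq (n - 1))).const_mul _).integrableOn fun y => ?_
        simp only
        nlinarith [sq_nonneg (hermiteFun n y - hermiteFun (n - 1) y)]
    _ ≤ ∫ y, jac n * (hermiteFun n y ^ 2 + hermiteFun (n - 1) y ^ 2) :=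
        setIntegral_le_integral (((hsq n).add (hsq (n - 1))).const_mul _)
          (ae_of_all _ fun y => by simp only [Pi.zero_apply]; positivity)
    _ = 2 * jac n := by
        rw [integral_const_mul, integral_add (hsq n) (hsq (n - 1)), hone, hone]; ring

end Hermite

/-! ### Oscillator energy: pointwise bounds and local averages of Hermite functions. -/

section Energy

/-- The energy of the Hermite function, seen as a solution of the oscillator equation. -/
def energy (k : ℕ) (x : ℝ) : ℝ :=
  hermiteDeriv k x ^ 2 + (2 * k + 1 - x ^ 2) * hermiteFun k x ^ 2

theorem hasDerivAt_hermiteFun' (k : ℕ) (x : ℝ) :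
    HasDerivAt (hermiteFun k) (hermiteDeriv k x) x := hasDerivAt_hermiteFun k x

theorem hasDerivAt_energy (k : ℕ) (x : ℝ) :
    HasDerivAt (energy k) (-(2 * x * hermiteFun k x ^ 2)) x := by
  have h := ((hasDerivAt_hermiteDeriv k x).pow 2).add
    (((hasDerivAt_pow 2 x).const_sub (2 * (k : ℝ) + 1)).mul ((hasDerivAt_hermiteFun' k x).pow 2))
  convert! h using 1
  simp
  ring

/-- Following the ray from 0 to x treats both signs of x at once; the energy decreases along it. -/
theorem hasDerivAt_energy_ray (k : ℕ) (x t : ℝ) :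
    HasDerivAt (fun t => energy k (t * x)) (-(2 * t * x ^ 2 * hermiteFun k (t * x) ^ 2)) t := by
  have := (hasDerivAt_energy k (t * x)).comp t ((hasDerivAt_id t).mul_const x)
  convert! this using 1
  simp; ring

theorem energy_le (k : ℕ) (x : ℝ) : energy k x ≤ energy k 0 := by
  have h : AntitoneOn (fun t => energy k (t * x)) (Set.Icc 0 1) :=
    antitoneOn_of_hasDerivWithinAt_nonpos (convex_Icc 0 1)
      (fun t _ => (hasDerivAt_energy_ray k x t).continuousAt.continuousWithinAt)
      (fun t _ => (hasDerivAt_energy_ray k x t).hasDerivWithinAt) fun t ht => by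
        have := (interior_subset ht).1
        have : 0 ≤ 2 * t * x ^ 2 * hermiteFun k (t * x) ^ 2 := by positivity
        linarith
  simpa using h (Set.left_mem_Icc.2 zero_le_one) (Set.right_mem_Icc.2 zero_le_one) zero_le_one

/-- The energy lost between 0 and x is ∫ 2y h², which is small as long as h² is. -/
theorem energy_ge (k : ℕ) {x B : ℝ} (hB : ∀ y, |y| ≤ |x| → hermiteFun k y ^ 2 ≤ B) :
    energy k 0 - x ^ 2 * B ≤ energy k x := by
  have hd : ∀ t, HasDerivAt (fun t => energy k (t * x) + t ^ 2 * (x ^ 2 * B))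
      (-(2 * t * x ^ 2 * hermiteFun k (t * x) ^ 2) + (2 * t) * (x ^ 2 * B)) t := fun t => by
    have := (hasDerivAt_energy_ray k x t).add ((hasDerivAt_pow 2 t).mul_const (x ^ 2 * B))
    convert! this using 1
    simp
  have h : MonotoneOn (fun t => energy k (t * x) + t ^ 2 * (x ^ 2 * B)) (Set.Icc 0 1) :=
    monotoneOn_of_hasDerivWithinAt_nonneg (convex_Icc 0 1)
      (fun t _ => (hd t).continuousAt.continuousWithinAt)
      (fun t _ => (hd t).hasDerivWithinAt) fun t ht => by
        have ht' := interior_subset ht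
        have h1 : |t * x| ≤ |x| := by
          rw [abs_mul, abs_of_nonneg ht'.1]
          exact mul_le_of_le_one_left (abs_nonneg _) ht'.2
        have h2 := mul_le_mul_of_nonneg_left (hB _ h1)
          (mul_nonneg (mul_nonneg two_pos.le ht'.1) (sq_nonneg x))
        linarith
  have := h (Set.left_mem_Icc.2 zero_le_one) (Set.right_mem_Icc.2 zero_le_one) zero_le_one
  simp at this
  linarith

theorem jac_mul_hermiteFun_zero (n : ℕ) :
    jac n * hermiteFun (n - 1) 0 = -(jac (n + 1) * hermiteFun (n + 1) 0) := by
  have := mul_hermiteFun n 0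
  linarith

theorem hermiteFun_odd_zero (m : ℕ) : hermiteFun (2 * m + 1) 0 = 0 := by
  induction m with
  | zero =>
    have h := jac_mul_hermiteFun_zero 0
    rw [jac_zero, zero_mul] at h
    have := jac_succ_pos 0
    simpa [this.ne'] using h
  | succ m ih =>
    have h := jac_mul_hermiteFun_zero (2 * m + 2)
    simp only [show 2 * m + 2 - 1 = 2 * m + 1 by omega, ih, mul_zero] at h
    have := jac_succ_pos (2 * m + 2)
    have h2 : hermiteFun (2 * m + 2 + 1) 0 = 0 := by
      simpa [this.ne'] using h
    exact h2

theorem hermiteFun_even_zero_succ (m : ℕ) : (2 * m + 2) * hermiteFun (2 * m + 2) 0 ^ 2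
    = (2 * m + 1) * hermiteFun (2 * m) 0 ^ 2 := by
  have h := jac_mul_hermiteFun_zero (2 * m + 1)
  simp only [Nat.add_sub_cancel] at h
  have h2 := congrArg (fun x => x ^ 2) h
  simp only [neg_sq, mul_pow, jac_sq] at h2
  push_cast at h2
  have e : 2 * m + 1 + 1 = 2 * m + 2 := by omega
  rw [e] at h2
  linarith

/-- The ratio ((2m + 1)/(2m + 2))² of successive fourth powers is exactly what the Wallis factor and
the change of 2m + 1 cancel. -/
theorem hermiteFun_even_zero_wallis (m : ℕ) :
    hermiteFun (2 * m) 0 ^ 4 * (Real.pi * Real.Wallis.W m * (2 * m + 1)) = 1 := by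
  induction m with
  | zero =>
    have h1 : hermiteFun 0 0 ^ 2 = (√Real.pi)⁻¹ := by
      rw [hermiteFun_eq, iteratedDeriv_zero]
      simp [hermiteConst, Real.sqrt_nonneg]
    have h2 : √Real.pi ^ 2 = Real.pi := Real.sq_sqrt Real.pi_pos.le
    have h3 : hermiteFun 0 0 ^ 4 = Real.pi⁻¹ := by
      rw [show (4 : ℕ) = 2 * 2 by norm_num, pow_mul, h1, inv_pow, h2]
    simp [h3, Real.Wallis.W, Real.pi_ne_zero]
  | succ m ih =>
    have h := hermiteFun_even_zero_succ m
    rw [Real.Wallis.W_succ, show 2 * (m + 1) = 2 * m + 2 by ring]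
    have h2 : hermiteFun (2 * m + 2) 0 ^ 2 = (2 * m + 1) / (2 * m + 2) * hermiteFun (2 * m) 0 ^ 2 := by
      field_simp
      linarith
    have h4 : hermiteFun (2 * m + 2) 0 ^ 4
        = ((2 * m + 1) / (2 * m + 2)) ^ 2 * hermiteFun (2 * m) 0 ^ 4 := by
      rw [show (4 : ℕ) = 2 * 2 by norm_num, pow_mul, h2, pow_mul]; ring
    rw [h4]
    refine Eq.trans ?_ ih
    push_cast
    field_simp
    ring

theorem energy_zero (k : ℕ) : energy k 0
    = 2 * (k + 1) * hermiteFun (k + 1) 0 ^ 2 + (2 * k + 1) * hermiteFun k 0 ^ 2 := by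
  have h := jac_mul_hermiteFun_zero k
  have j := jac_sq (k + 1)
  push_cast at j
  simp only [energy, hermiteDeriv]
  rw [h]
  linear_combination 4 * hermiteFun (k + 1) 0 ^ 2 * j

theorem energy_nonneg (k : ℕ) : 0 ≤ energy k 0 := by
  rw [energy_zero]; positivity

/-- At 0 only one of h_k and h_{k+1} survives. For odd k the product equals 4k; for k = 2m it equals
(4m + 1)²/(2m + 1), which lies between 8m and 8m + 1. -/
theorem energy_zero_sq_mul (k : ℕ) :
    energy k 0 ^ 2 * (Real.pi * Real.Wallis.W (k / 2)) ∈ Set.Icc (4 * (k : ℝ)) (4 * k + 1) := by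
  rcases Nat.even_or_odd' k with ⟨m, rfl | rfl⟩
  · have hw := hermiteFun_even_zero_wallis m
    have e : energy (2 * m) 0 = (4 * m + 1) * hermiteFun (2 * m) 0 ^ 2 := by
      rw [energy_zero, hermiteFun_odd_zero]; push_cast; ring
    have hd : 2 * m / 2 = m := by omega
    have h2 : energy (2 * m) 0 ^ 2 * (Real.pi * Real.Wallis.W m)
        = (4 * m + 1) ^ 2 / (2 * m + 1) := by
      rw [e, eq_div_iff (by positivity)]
      linear_combination (4 * (m : ℝ) + 1) ^ 2 * hw
    rw [hd, h2]
    push_cast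
    constructor
    · rw [le_div_iff₀ (by positivity)]; nlinarith
    · rw [div_le_iff₀ (by positivity)]; nlinarith
  · have hw := hermiteFun_even_zero_wallis m
    have h := hermiteFun_even_zero_succ m
    have e : energy (2 * m + 1) 0 = 2 * (2 * m + 1) * hermiteFun (2 * m) 0 ^ 2 := by
      rw [energy_zero, hermiteFun_odd_zero]
      push_cast
      linear_combination 2 * h
    have hd : (2 * m + 1) / 2 = m := by omega
    have h2 : energy (2 * m + 1) 0 ^ 2 * (Real.pi * Real.Wallis.W m) = 4 * (2 * m + 1) := by
      rw [e]
      linear_combination (4 * (2 * (m : ℝ) + 1)) * hw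
    rw [hd, h2]
    push_cast
    constructor <;> linarith

/-- A non-asymptotic bound from W ≥ π/4, valid for all k ≥ 1, with π² /4 replaced by 9/4. -/
theorem energy_zero_le {k : ℕ} (hk : 1 ≤ k) : energy k 0 ≤ 2 * √k := by
  have h1 := (energy_zero_sq_mul k).2
  have hW : Real.pi / 4 ≤ Real.Wallis.W (k / 2) := by
    refine le_trans ?_ (Real.Wallis.le_W _)
    rw [div_mul_div_comm, le_div_iff₀ (by positivity)]
    have : (0 : ℝ) ≤ ((k / 2 : ℕ) : ℝ) := by positivity
    nlinarith [Real.pi_pos]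
  have hk' : (1 : ℝ) ≤ k := by exact_mod_cast hk
  have hpi := Real.pi_gt_three
  have h2 : energy k 0 ^ 2 * (9 / 4) ≤ 4 * k + 1 := by
    refine le_trans (mul_le_mul_of_nonneg_left ?_ (sq_nonneg _)) h1
    nlinarith
  refine abs_le_of_sq_le_sq' ?_ (by positivity) |>.2
  rw [mul_pow, Real.sq_sqrt (by positivity)]
  nlinarith

theorem tendsto_energy_zero_sq_div :
    Tendsto (fun k : ℕ => energy k 0 ^ 2 / k) atTop (𝓝 (8 / Real.pi ^ 2)) := by
  have hW : Tendsto (fun k : ℕ => Real.pi * Real.Wallis.W (k / 2)) atTop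
      (𝓝 (Real.pi * (Real.pi / 2))) :=
    (Real.Wallis.tendsto_W_nhds_pi_div_two.comp
      (Nat.tendsto_div_const_atTop two_ne_zero)).const_mul _
  have h1 : Tendsto (fun k : ℕ => energy k 0 ^ 2 * (Real.pi * Real.Wallis.W (k / 2)) / k) atTop
      (𝓝 4) := by
    have h2 : Tendsto (fun k : ℕ => 4 + 1 / (k : ℝ)) atTop (𝓝 4) := by
      simpa using (tendsto_const_div_atTop_nhds_zero_nat (1 : ℝ)).const_add 4
    refine tendsto_of_tendsto_of_tendsto_of_le_of_le' tendsto_const_nhds h2 ?_ ?_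
    · filter_upwards [eventually_ge_atTop 1] with k hk
      have hk' : (0 : ℝ) < k := by exact_mod_cast hk
      rw [le_div_iff₀ hk']
      exact (energy_zero_sq_mul k).1
    · filter_upwards [eventually_ge_atTop 1] with k hk
      have hk' : (0 : ℝ) < k := by exact_mod_cast hk
      rw [div_le_iff₀ hk']
      refine (energy_zero_sq_mul k).2.trans (le_of_eq ?_)
      field_simp
  have h3 := h1.div hW (by have := Real.pi_pos; positivity)
  have hpi := Real.pi_pos
  convert h3 using 1
  · ext k
    have : 0 < Real.Wallis.W (k / 2) := Real.Wallis.W_pos _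
    simp only [Pi.div_apply]
    field_simp
  · congr 1
    field_simp
    norm_num

/-- For x² ≤ k the coefficient 2k + 1 - x² is at least k, so k h² is bounded by the energy, which is
at most its value at 0. -/
theorem hermiteFun_sq_le {k : ℕ} (hk : 1 ≤ k) {x : ℝ} (hx : x ^ 2 ≤ k) :
    hermiteFun k x ^ 2 ≤ 2 / √k := by
  have h1 := (energy_le k x).trans (energy_zero_le hk)
  have hk' : (0 : ℝ) < k := by exact_mod_cast hk
  have hs : 0 < √(k : ℝ) := Real.sqrt_pos.2 hk'
  have hss : √(k : ℝ) * √(k : ℝ) = k := Real.mul_self_sqrt hk'.le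
  have h2 : (k : ℝ) * hermiteFun k x ^ 2 ≤ 2 * √k := by
    refine le_trans ?_ h1
    rw [energy]
    nlinarith [sq_nonneg (hermiteDeriv k x), sq_nonneg (hermiteFun k x)]
  rw [le_div_iff₀ hs]
  have h3 : (hermiteFun k x ^ 2 * √k) * √k ≤ 2 * √k := by
    rw [mul_assoc, hss]; linarith
  exact le_of_mul_le_mul_right h3 hs

/-- The energy bounds h'² + k h² by 2√k, while 2√k |h h'| ≤ h'² + k h². -/
theorem abs_hermiteFun_mul_hermiteDeriv_le {k : ℕ} (hk : 1 ≤ k) {x : ℝ} (hx : x ^ 2 ≤ k) :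
    |hermiteFun k x * hermiteDeriv k x| ≤ 1 := by
  have h1 := (energy_le k x).trans (energy_zero_le hk)
  have hk' : (0 : ℝ) < k := by exact_mod_cast hk
  have hs : 0 < √(k : ℝ) := Real.sqrt_pos.2 hk'
  have hss : √(k : ℝ) * √(k : ℝ) = k := Real.mul_self_sqrt hk'.le
  have h2 : hermiteDeriv k x ^ 2 + (√k * √k) * hermiteFun k x ^ 2 ≤ 2 * √k := by
    refine le_trans ?_ h1
    rw [energy, hss]
    nlinarith [sq_nonneg (hermiteFun k x)]
  rw [abs_le]
  constructor
  · have : 2 * √k * (-(hermiteFun k x * hermiteDeriv k x)) ≤ 2 * √k * 1 := by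
      nlinarith [sq_nonneg (hermiteDeriv k x + √k * hermiteFun k x)]
    have := le_of_mul_le_mul_left this (by positivity)
    linarith
  · have : 2 * √k * (hermiteFun k x * hermiteDeriv k x) ≤ 2 * √k * 1 := by
      nlinarith [sq_nonneg (hermiteDeriv k x - √k * hermiteFun k x)]
    exact le_of_mul_le_mul_left this (by positivity)

/-- Local averages of the squares of the Hermite functions. -/
theorem abs_average_sub_le {k : ℕ} (hk : 1 ≤ k) {r Y : ℝ} (hr : 0 < r)
    (hrY : (r * Y) ^ 2 ≤ k) {w : ℝ → ℝ} (hw : ContDiff ℝ 1 w) (hwc : HasCompactSupport w)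
    (hs : ∀ y, y ∉ Set.Icc (-Y) Y → w y = 0) :
    |4 * k * (∫ y, w y * hermiteFun k (r * y) ^ 2) - energy k 0 * ∫ y, w y|
      ≤ 1 / r * (∫ y, |deriv w y|) + (4 + 6 * (r * Y) ^ 2) / √k * ∫ y, |w y| := by
  have hk' : (0 : ℝ) < k := by exact_mod_cast hk
  have hsk : 0 < √(k : ℝ) := Real.sqrt_pos.2 hk'
  have hin : ∀ y ∈ Set.Icc (-Y) Y, (r * y) ^ 2 ≤ (r * Y) ^ 2 := fun y hy => by
    rw [mul_pow, mul_pow]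
    exact mul_le_mul_of_nonneg_left (sq_le_sq.2 ((abs_le.2 hy).trans (le_abs_self _)))
      (sq_nonneg _)
  have hwcont := hw.continuous
  have hw'cont : Continuous (deriv w) := hw.continuous_deriv le_rfl
  have hw'c : HasCompactSupport (deriv w) := hwc.deriv
  have hw's : ∀ y, y ∉ Set.Icc (-Y) Y → deriv w y = 0 := by
    intro y hy
    have : w =ᶠ[𝓝 y] fun _ => 0 := by
      filter_upwards [isClosed_Icc.isOpen_compl.mem_nhds hy] with z hz using hs z hz
    rw [this.deriv_eq]; simp
  have cH : Continuous fun y => hermiteFun k (r * y) := (continuous_hermiteFun k).comp (by fun_prop)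
  have cD : Continuous fun y => hermiteDeriv k (r * y) :=
    (continuous_hermiteDeriv k).comp (by fun_prop)
  have cE : Continuous fun y => energy k (r * y) :=
    (continuous_iff_continuousAt.2 fun x => (hasDerivAt_energy k x).continuousAt).comp (by fun_prop)
  -- integration by parts
  set q : ℝ → ℝ := fun y => 2 * k + 1 - (r * y) ^ 2 with hq
  have cq : Continuous q := by fun_prop
  -- Equipartition: (h h')' = h'² - q h² is the energy minus 2q h², so this difference has small
  -- average against w.
  have hparts : ∫ y, w y * (energy k (r * y) - 2 * q y * hermiteFun k (r * y) ^ 2)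
      = -(1 / r) * ∫ y, deriv w y * (hermiteFun k (r * y) * hermiteDeriv k (r * y)) := by
    have hd : ∀ y, HasDerivAt
        (fun y => w y * (hermiteFun k (r * y) * hermiteDeriv k (r * y)))
        (deriv w y * (hermiteFun k (r * y) * hermiteDeriv k (r * y))
          + r * (w y * (energy k (r * y) - 2 * q y * hermiteFun k (r * y) ^ 2))) y := by
      intro y
      have h1 : HasDerivAt (fun y => hermiteFun k (r * y)) (hermiteDeriv k (r * y) * r) y := by
        have := (hasDerivAt_hermiteFun' k (r * y)).comp y ((hasDerivAt_id y).const_mul r)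
        convert! this using 1
        simp
      have h2 : HasDerivAt (fun y => hermiteDeriv k (r * y))
          (-((2 * k + 1 - (r * y) ^ 2) * hermiteFun k (r * y)) * r) y := by
        have := (hasDerivAt_hermiteDeriv k (r * y)).comp y ((hasDerivAt_id y).const_mul r)
        convert! this using 1
        simp
      have h3 := ((hw.differentiable one_ne_zero y).hasDerivAt).mul (h1.mul h2)
      convert! h3 using 1
      simp only [energy, hq, Pi.mul_apply]
      ring
    have i1 : Integrable fun y => deriv w y * (hermiteFun k (r * y) * hermiteDeriv k (r * y)) :=
      (hw'cont.mul (cH.mul cD)).integrable_of_hasCompactSupport hw'c.mul_right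
    have i2 : Integrable fun y => r * (w y * (energy k (r * y) - 2 * q y * hermiteFun k (r * y) ^ 2)) := by
      refine Integrable.const_mul ?_ r
      exact (hwcont.mul (cE.sub ((continuous_const.mul cq).mul (cH.pow 2)))).integrable_of_hasCompactSupport
        hwc.mul_right
    have i3 : Integrable fun y => w y * (hermiteFun k (r * y) * hermiteDeriv k (r * y)) :=
      (hwcont.mul (cH.mul cD)).integrable_of_hasCompactSupport hwc.mul_right
    have h0 := integral_eq_zero_of_hasDerivAt_of_integrable hd (i1.add i2) i3
    rw [integral_add i1 i2, integral_const_mul] at h0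
    generalize (∫ y, w y * (energy k (r * y) - 2 * q y * hermiteFun k (r * y) ^ 2)) = A at h0 ⊢
    generalize (∫ y, deriv w y * (hermiteFun k (r * y) * hermiteDeriv k (r * y))) = D at h0 ⊢
    field_simp
    linarith
  have iw : ∀ u : ℝ → ℝ, Continuous u → Integrable fun y => w y * u y := fun u hu =>
    (hwcont.mul hu).integrable_of_hasCompactSupport hwc.mul_right
  have hwi : Integrable w := hwcont.integrable_of_hasCompactSupport hwc
  -- Replacing 2q by 4k and the energy by its value at 0 costs only the last integrand, which is
  -- O((1 + (rY)²)/√k).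
  have e : 4 * k * (∫ y, w y * hermiteFun k (r * y) ^ 2) - energy k 0 * ∫ y, w y
      = 1 / r * (∫ y, deriv w y * (hermiteFun k (r * y) * hermiteDeriv k (r * y)))
        + ∫ y, w y * (energy k (r * y) - energy k 0
          - 2 * (1 - (r * y) ^ 2) * hermiteFun k (r * y) ^ 2) := by
    have h1 : 1 / r * (∫ y, deriv w y * (hermiteFun k (r * y) * hermiteDeriv k (r * y)))
        = -∫ y, w y * (energy k (r * y) - 2 * q y * hermiteFun k (r * y) ^ 2) := by
      rw [hparts]; ring
    have j1 : Integrable fun y => 4 * k * (w y * hermiteFun k (r * y) ^ 2) :=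
      (iw _ (cH.pow 2)).const_mul _
    have j2 : Integrable fun y => energy k 0 * w y := hwi.const_mul _
    have j3 : Integrable fun y => -(w y * (energy k (r * y) - 2 * q y * hermiteFun k (r * y) ^ 2)) :=
      (iw _ (cE.sub ((continuous_const.mul cq).mul (cH.pow 2)))).neg
    have j4 : Integrable fun y => w y * (energy k (r * y) - energy k 0
        - 2 * (1 - (r * y) ^ 2) * hermiteFun k (r * y) ^ 2) :=
      iw _ ((cE.sub continuous_const).sub ((by fun_prop : Continuous fun y => 2 * (1 - (r * y) ^ 2)).mul
        (cH.pow 2)))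
    rw [h1, ← integral_const_mul, ← integral_const_mul, ← integral_neg,
      ← integral_sub j1 j2, ← integral_add j3 j4]
    congr 1
    ext y
    simp only [hq]
    ring
  rw [e]
  refine (abs_add_le _ _).trans (add_le_add ?_ ?_)
  · rw [abs_mul, abs_of_pos (by positivity : 0 < 1 / r)]
    refine mul_le_mul_of_nonneg_left (abs_integral_le_integral_abs.trans ?_) (by positivity)
    refine integral_mono_of_nonneg (ae_of_all _ fun y => abs_nonneg _)
      (hw'cont.abs.integrable_of_hasCompactSupport hw'c.abs) (ae_of_all _ fun y => ?_)
    simp only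
    rw [abs_mul]
    by_cases hy : y ∈ Set.Icc (-Y) Y
    · exact mul_le_of_le_one_right (abs_nonneg _)
        (abs_hermiteFun_mul_hermiteDeriv_le hk ((hin y hy).trans hrY))
    · rw [hw's y hy]; simp
  · refine abs_integral_le_integral_abs.trans ?_
    rw [← integral_const_mul]
    refine integral_mono_of_nonneg (ae_of_all _ fun y => abs_nonneg _)
      (hwi.abs.const_mul _) (ae_of_all _ fun y => ?_)
    simp only
    by_cases hy : y ∈ Set.Icc (-Y) Y
    · rw [abs_mul, mul_comm]
      refine mul_le_mul_of_nonneg_right ?_ (abs_nonneg _)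
      have hy1 := hin y hy
      have hh := hermiteFun_sq_le hk (hy1.trans hrY)
      have e1 := energy_le k (r * y)
      have e2 := energy_ge k (x := r * y) (B := 2 / √k) fun z hz => by
        refine hermiteFun_sq_le hk ?_
        exact ((sq_le_sq.2 hz).trans hy1).trans hrY
      set B := 2 / √(k : ℝ) with hB
      have hB0 : 0 ≤ B := by positivity
      have h4 : (4 + 6 * (r * Y) ^ 2) / √k = (2 + 3 * (r * Y) ^ 2) * B := by
        rw [hB]; ring
      rw [h4]
      have hh0 := sq_nonneg (hermiteFun k (r * y))
      have p1 : (r * y) ^ 2 * B ≤ (r * Y) ^ 2 * B := mul_le_mul_of_nonneg_right hy1 hB0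
      have p2 : (r * y) ^ 2 * hermiteFun k (r * y) ^ 2 ≤ (r * Y) ^ 2 * B :=
        mul_le_mul hy1 hh hh0 (sq_nonneg _)
      have p3 : 0 ≤ (r * y) ^ 2 * hermiteFun k (r * y) ^ 2 := by positivity
      rw [abs_le]
      constructor <;> nlinarith
    · rw [hs y hy]; simp

end Energy

/-! ### Local averages of the rescaled Hermite functions for k ~ N. -/

section LocalAverage

/-- The dilation factor of the rescaled Hermite functions. -/
def scale (N : ℝ) : ℝ := Real.pi * √N / √2

theorem scale_nonneg (N : ℝ) : 0 ≤ scale N := by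
  have := Real.pi_pos
  unfold scale; positivity

theorem scale_pos {N : ℝ} (hN : 0 < N) : 0 < scale N := by
  have := Real.pi_pos
  have := Real.sqrt_pos.2 hN
  unfold scale; positivity

theorem scale_sq {N : ℝ} (hN : 0 ≤ N) : scale N ^ 2 = Real.pi ^ 2 / 2 * N := by
  rw [scale, div_pow, mul_pow, Real.sq_sqrt hN, Real.sq_sqrt two_pos.le]; ring

theorem hermiteScaled_eq (N : ℝ) (k : ℕ) (x : ℝ) :
    hermiteScaled N k x = √(scale N) * hermiteFun k (x * scale N) := rfl

theorem hermiteScaled_mul (N : ℝ) (j k : ℕ) (x y : ℝ) :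
    hermiteScaled N j x * hermiteScaled N k y
      = scale N * (hermiteFun j (x * scale N) * hermiteFun k (y * scale N)) := by
  rw [hermiteScaled_eq, hermiteScaled_eq, mul_mul_mul_comm, Real.mul_self_sqrt (scale_nonneg N)]

theorem hermiteScaled_sq (N : ℝ) (k : ℕ) (x : ℝ) :
    hermiteScaled N k x ^ 2 = scale N * hermiteFun k (x * scale N) ^ 2 := by
  rw [sq, hermiteScaled_mul, sq]

theorem continuous_hermiteScaled (N : ℝ) (k : ℕ) : Continuous (hermiteScaled N k) :=
  continuous_const.mul ((continuous_hermiteFun k).comp (by fun_prop))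

theorem hermiteScaled_sq_le {N : ℝ} {k : ℕ} (hk : 1 ≤ k) {x : ℝ} (hx : (x * scale N) ^ 2 ≤ k) :
    hermiteScaled N k x ^ 2 ≤ 2 * scale N / √k := by
  rw [hermiteScaled_sq]
  calc _ ≤ scale N * (2 / √k) :=
        mul_le_mul_of_nonneg_left (hermiteFun_sq_le hk hx) (scale_nonneg N)
    _ = _ := by ring

theorem sum_hermiteScaled_sq_le (N : ℝ) (n : ℕ) (x : ℝ) :
    ∑ k ∈ Finset.range n, hermiteScaled N k x ^ 2 ≤ scale N * (2 * jac n) := by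
  simp only [hermiteScaled_sq, ← Finset.mul_sum]
  exact mul_le_mul_of_nonneg_left (sum_hermiteFun_sq_le n _) (scale_nonneg N)

theorem hermiteScaled_sq_le_jac (N : ℝ) (k : ℕ) (x : ℝ) :
    hermiteScaled N k x ^ 2 ≤ scale N * (2 * jac (k + 1)) :=
  (Finset.single_le_sum (f := fun k => hermiteScaled N k x ^ 2) (fun _ _ => sq_nonneg _)
    (Finset.self_mem_range_succ k)).trans (sum_hermiteScaled_sq_le N (k + 1) x)

theorem hermiteScaled_orthonormal {N : ℝ} (hN : 0 < N) (j k : ℕ) :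
    ∫ x, hermiteScaled N j x * hermiteScaled N k x = if j = k then 1 else 0 := by
  have hc := scale_pos hN
  simp only [hermiteScaled_mul, integral_const_mul]
  rw [Measure.integral_comp_mul_right (fun x => hermiteFun j x * hermiteFun k x),
    hermiteFun_orthonormal, abs_of_pos (inv_pos.2 hc), smul_eq_mul, ← mul_assoc,
    mul_inv_cancel₀ hc.ne', one_mul]

theorem memLp_hermiteScaled {N : ℝ} (hN : 0 < N) (k : ℕ) : MemLp (hermiteScaled N k) 2 := by
  rw [memLp_two_iff_integrable_sq (continuous_hermiteScaled N k).aestronglyMeasurable]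
  simp only [hermiteScaled_sq]
  refine Integrable.const_mul ?_ _
  have := (memLp_two_iff_integrable_sq (continuous_hermiteFun k).aestronglyMeasurable).1
    (memLp_hermiteFun k)
  exact this.comp_mul_right' (scale_pos hN).ne'

theorem integrable_mul_hermiteScaled_sq {w : ℝ → ℝ} (hw : Integrable w) (N r : ℝ) (k : ℕ) :
    Integrable fun y => w y * hermiteScaled N k (y * r) ^ 2 := by
  refine hw.mul_bdd (c := scale N * (2 * jac (k + 1))) ?_ (ae_of_all _ fun y => ?_)
  · exact (((continuous_hermiteScaled N k).comp (by fun_prop : Continuous fun y => y * r)).pow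
      2).aestronglyMeasurable
  · rw [Real.norm_eq_abs, abs_of_nonneg (sq_nonneg _)]
    exact hermiteScaled_sq_le_jac N k _

theorem abs_integral_mul_hermiteScaled_sq_le {w : ℝ → ℝ} (hw : Integrable w) {N r Y : ℝ} {k : ℕ}
    (hk : 1 ≤ k) (hY : (Y * r * scale N) ^ 2 ≤ k) (hs : ∀ y, y ∉ Set.Icc (-Y) Y → w y = 0) :
    |∫ y, w y * hermiteScaled N k (y * r) ^ 2| ≤ 2 * scale N / √k * ∫ y, |w y| := by
  refine abs_integral_le_integral_abs.trans ?_
  rw [← integral_const_mul]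
  refine integral_mono (integrable_mul_hermiteScaled_sq hw N r k).abs (hw.abs.const_mul _)
    fun y => ?_
  simp only
  by_cases hy : y ∈ Set.Icc (-Y) Y
  · rw [abs_mul, abs_of_nonneg (sq_nonneg (hermiteScaled _ _ _)), mul_comm]
    refine mul_le_mul_of_nonneg_right (hermiteScaled_sq_le hk (le_trans ?_ hY)) (abs_nonneg _)
    rw [mul_pow, mul_pow, mul_pow (Y * r), mul_pow Y]
    have : y ^ 2 ≤ Y ^ 2 := sq_le_sq.2 ((abs_le.2 hy).trans (le_abs_self _))
    gcongr
  · rw [hs y hy]; simp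

variable {k : ℝ → ℕ} (hk : Tendsto (fun N => (k N : ℝ) / N) atTop (𝓝 1))
include hk

theorem tendsto_natCast_of_div : Tendsto (fun N => (k N : ℝ)) atTop atTop := by
  have := hk.pos_mul_atTop one_pos tendsto_id
  refine this.congr' ?_
  filter_upwards [eventually_gt_atTop 0] with N hN
  simp only [id]; field_simp

theorem tendsto_scale_sq_div :
    Tendsto (fun N => scale N ^ 2 / k N) atTop (𝓝 (Real.pi ^ 2 / 2)) := by
  have := (hk.inv₀ one_ne_zero).const_mul (Real.pi ^ 2 / 2)
  rw [inv_one, mul_one] at this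
  refine this.congr' ?_
  filter_upwards [eventually_gt_atTop 0] with N hN
  rw [scale_sq hN.le, inv_div]; ring

theorem tendsto_scale_div_sqrt :
    Tendsto (fun N => scale N / √(k N)) atTop (𝓝 √(Real.pi ^ 2 / 2)) := by
  refine (tendsto_scale_sq_div hk).sqrt.congr fun N => ?_
  rw [Real.sqrt_div (sq_nonneg _), Real.sqrt_sq (scale_nonneg N)]

/-- The source of the density 1/2: scale²/k → π²/2 and energy²/k → 8/π² have product 4, and a
quarter of its square root is 1/2. -/
theorem tendsto_scale_mul_energy :
    Tendsto (fun N => scale N / (4 * k N) * energy (k N) 0) atTop (𝓝 (1 / 2)) := by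
  have h1 := ((tendsto_scale_sq_div hk).mul (tendsto_energy_zero_sq_div.comp
    (tendsto_natCast_atTop_iff.1 (tendsto_natCast_of_div hk)))).sqrt.const_mul (1 / 4)
  have e : √(Real.pi ^ 2 / 2 * (8 / Real.pi ^ 2)) = 2 := by
    have := Real.pi_pos
    rw [show Real.pi ^ 2 / 2 * (8 / Real.pi ^ 2) = 2 ^ 2 by field_simp; norm_num]
    exact Real.sqrt_sq two_pos.le
  rw [e] at h1
  convert! h1 using 2
  · simp only [Function.comp_apply]
    rename_i N
    rw [← mul_div_mul_comm, ← mul_pow, ← sq, ← div_pow, Real.sqrt_sq]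
    · ring
    · have := scale_nonneg N
      have := energy_nonneg (k N)
      positivity
  · norm_num

theorem tendsto_scaled_endpoint {δ : ℝ} (hδ : 0 < δ) (Y : ℝ) :
    Tendsto (fun N => (Y * N ^ (-δ) * scale N) ^ 2 / k N) atTop (𝓝 0) := by
  have := (((tendsto_rpow_neg_atTop hδ).const_mul Y).pow 2).mul (tendsto_scale_sq_div hk)
  simp only [mul_zero, ne_eq, OfNat.ofNat_ne_zero, not_false_eq_true, zero_pow, zero_mul] at this
  refine this.congr fun N => ?_
  ring

theorem eventually_scaled_endpoint_le {δ : ℝ} (hδ : 0 < δ) (Y : ℝ) :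
    ∀ᶠ N in atTop, 1 ≤ k N ∧ (Y * N ^ (-δ) * scale N) ^ 2 ≤ k N := by
  filter_upwards [(tendsto_scaled_endpoint hk hδ Y).eventually (eventually_lt_nhds one_pos),
    (tendsto_natCast_atTop_iff.1 (tendsto_natCast_of_div hk)).eventually_ge_atTop 1] with N h1 h2
  have : (0 : ℝ) < k N := by exact_mod_cast h2
  exact ⟨h2, ((div_lt_one this).1 h1).le⟩

/-- The integration by parts error is of order N^(δ-1), which vanishes since δ < 1; the other error
vanishes because the window at scale N^(-δ) is small compared with the turning points. -/
theorem tendsto_local_average_of_contDiff {δ : ℝ} (hδ : 0 < δ) (hδ1 : δ < 1) {w : ℝ → ℝ}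
    (hw : ContDiff ℝ 1 w) (hwc : HasCompactSupport w) {Y : ℝ}
    (hs : ∀ y, y ∉ Set.Icc (-Y) Y → w y = 0) :
    Tendsto (fun N => ∫ y, w y * hermiteScaled N (k N) (y * N ^ (-δ)) ^ 2) atTop
      (𝓝 (1 / 2 * ∫ y, w y)) := by
  have hkt := tendsto_natCast_of_div hk
  have e1 : Tendsto (fun N => 1 / 4 * (N ^ (-(1 - δ)) * ((k N : ℝ) / N)⁻¹) * (∫ y, |deriv w y|))
      atTop (𝓝 0) := by
    have := (((tendsto_rpow_neg_atTop (sub_pos.2 hδ1)).mul (hk.inv₀ one_ne_zero)).const_mul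
      (1 / 4)).mul_const (∫ y, |deriv w y|)
    simpa using this
  have e2 : Tendsto (fun N => 1 / 4 * (scale N / √(k N)) *
      (4 * (k N : ℝ)⁻¹ + 6 * ((Y * N ^ (-δ) * scale N) ^ 2 / k N)) * ∫ y, |w y|) atTop (𝓝 0) := by
    have := (((tendsto_scale_div_sqrt hk).const_mul (1 / 4)).mul
      (((tendsto_inv_atTop_zero.comp hkt).const_mul 4).add
        ((tendsto_scaled_endpoint hk hδ Y).const_mul 6))).mul_const (∫ y, |w y|)
    simpa using this
  have e := e1.add e2
  rw [add_zero] at e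
  have h := (tendsto_scale_mul_energy hk).mul_const (∫ y, w y)
  refine tendsto_of_tendsto_of_dist h ?_
  refine squeeze_zero' (Eventually.of_forall fun N => dist_nonneg) ?_ e
  filter_upwards [eventually_scaled_endpoint_le hk hδ Y, eventually_gt_atTop 0] with N hN hN0
  obtain ⟨h1, h2⟩ := hN
  have hc := scale_pos hN0
  have hr : 0 < N ^ (-δ) * scale N := mul_pos (Real.rpow_pos_of_pos hN0 _) hc
  have hk0 : (0 : ℝ) < k N := by exact_mod_cast h1
  have hq : 0 < scale N / (4 * k N) := by positivity
  have key := abs_average_sub_le h1 hr (Y := Y) (by rwa [mul_comm, ← mul_assoc]) hw hwc hs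
  have e3 : ∫ y, w y * hermiteScaled N (k N) (y * N ^ (-δ)) ^ 2
      = scale N / (4 * k N) * (4 * k N * ∫ y, w y * hermiteFun (k N) (N ^ (-δ) * scale N * y) ^ 2) := by
    rw [← mul_assoc, div_mul_cancel₀ _ (by positivity), ← integral_const_mul]
    congr 1
    ext y
    rw [hermiteScaled_sq, show y * N ^ (-δ) * scale N = N ^ (-δ) * scale N * y by ring]
    ring
  rw [dist_comm, Real.dist_eq, e3, mul_assoc _ (energy (k N) 0), ← mul_sub, abs_mul, abs_of_pos hq]
  refine (mul_le_mul_of_nonneg_left key hq.le).trans (le_of_eq ?_)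
  rw [mul_add]
  congr 1
  · rw [← mul_assoc]
    congr 1
    rw [show -(1 - δ) = δ + -1 by ring, Real.rpow_add hN0, Real.rpow_neg hN0.le, Real.rpow_neg_one]
    have := Real.rpow_pos_of_pos hN0 δ
    field_simp
  · rw [← mul_assoc]
    congr 1
    rw [mul_comm (N ^ (-δ) * scale N) Y, ← mul_assoc Y]
    have := Real.sqrt_pos.2 hk0
    field_simp

/-- Local averages of the squares of the rescaled Hermite functions near the spectral edge index
are asymptotically uniform. -/
theorem tendsto_local_average {δ : ℝ} (hδ : 0 < δ) (hδ1 : δ < 1) {w : ℝ → ℝ}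
    (hw : Integrable w) {Y : ℝ} (hs : ∀ y, y ∉ Set.Icc (-Y) Y → w y = 0) :
    Tendsto (fun N => ∫ y, w y * hermiteScaled N (k N) (y * N ^ (-δ)) ^ 2) atTop
      (𝓝 (1 / 2 * ∫ y, w y)) := by
  rw [Metric.tendsto_atTop']
  intro ε hε
  -- C exceeds the limit of 2 · scale/√k, which bounds φ_k² on the window.
  set C : ℝ := 2 * √(Real.pi ^ 2 / 2) + 1
  have hC : 0 < C := by positivity
  set η : ℝ := ε / (2 * (C + 1)) with hη
  have hη0 : 0 < η := by positivity
  -- Smooth compactly supported functions are dense in L¹. The uniform bound C on φ_k² makes the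
  -- replacement error at most (C + 1)η = ε/2.
  obtain ⟨g, hgc, hgs, hg⟩ := (memLp_one_iff_integrable.2 hw).exist_eLpNorm_sub_le
    ENNReal.one_ne_top le_rfl hη0
  have hgi : Integrable g := hgs.continuous.integrable_of_hasCompactSupport hgc
  have hd : ∫ y, |w y - g y| ≤ η := by
    have := ENNReal.toReal_le_of_le_ofReal hη0.le hg
    rw [eLpNorm_one_eq_lintegral_enorm] at this
    rw [← integral_norm_eq_lintegral_enorm (hw.sub hgi).aestronglyMeasurable] at this
    exact this
  obtain ⟨R, hR⟩ := hgc.isBounded.subset_closedBall 0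
  rw [Real.closedBall_eq_Icc, zero_sub, zero_add] at hR
  set Z := max Y R
  have hsg : ∀ y, y ∉ Set.Icc (-Z) Z → g y = 0 := fun y hy => by
    by_contra h
    have := hR (subset_tsupport g h)
    exact hy ⟨by linarith [this.1, le_max_right Y R], this.2.trans (le_max_right _ _)⟩
  have hsw : ∀ y, y ∉ Set.Icc (-Z) Z → w y = 0 := fun y hy => hs y fun h =>
    hy ⟨by linarith [h.1, le_max_left Y R], h.2.trans (le_max_left _ _)⟩
  have hlim := tendsto_local_average_of_contDiff hk hδ hδ1 (hgs.of_le (by simp)) hgc hsg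
  have hC' : ∀ᶠ N in atTop, 2 * (scale N / √(k N)) < C :=
    ((tendsto_scale_div_sqrt hk).const_mul 2).eventually (eventually_lt_nhds (lt_add_one _))
  have hev : ∀ᶠ N in atTop, dist (∫ y, w y * hermiteScaled N (k N) (y * N ^ (-δ)) ^ 2)
      (1 / 2 * ∫ y, w y) < ε := by
    filter_upwards [hlim.eventually (Metric.ball_mem_nhds _ (half_pos (half_pos hε))), hC',
      eventually_scaled_endpoint_le hk hδ Z] with N h1 h2 h3
    rw [Real.dist_eq] at h1
    have k1 := abs_integral_mul_hermiteScaled_sq_le (hw.sub hgi) h3.1 h3.2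
      (fun y hy => by simp [hsg y hy, hsw y hy])
    simp only [Pi.sub_apply, sub_mul] at k1
    rw [integral_sub (integrable_mul_hermiteScaled_sq hw _ _ _)
      (integrable_mul_hermiteScaled_sq hgi _ _ _)] at k1
    have k2 : |(∫ y, w y) - ∫ y, g y| ≤ η := by
      rw [← integral_sub hw hgi]
      exact abs_integral_le_integral_abs.trans hd
    have k3 : 2 * scale N / √(k N) * (∫ y, |w y - g y|) ≤ C * η := by
      refine mul_le_mul ?_ hd (integral_nonneg fun _ => abs_nonneg _) hC.le
      rw [mul_div_assoc]; exact h2.le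
    have k4 : C * η + η = ε / 2 := by rw [hη]; field_simp
    rw [Real.dist_eq]
    have k5 := k1.trans k3
    rw [abs_le] at k2 k5
    rw [abs_lt] at h1 ⊢
    constructor <;> linarith
  obtain ⟨a, ha⟩ := eventually_atTop.1 hev
  exact ⟨a, fun n hn => ha n hn.le⟩

end LocalAverage

/-! ### Shapes: tail estimates, the constant B², and spectral properties of the kernel. -/

section Shape

theorem half_mul_le_sub {g : ℝ → ℝ} (hg : Antitone g) {t : ℝ} (ht : 0 ≤ t) :
    t / 2 * g t ≤ (∫ u in (0 : ℝ)..t, g u) - ∫ u in (0 : ℝ)..(t / 2), g u := by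
  have hi : ∀ a b, IntervalIntegrable g volume a b := fun a b => hg.intervalIntegrable
  rw [intervalIntegral.integral_interval_sub_left (hi _ _) (hi _ _)]
  have h := intervalIntegral.integral_mono_on (a := t / 2) (b := t) (f := fun _ => g t) (g := g)
    (by linarith) intervalIntegrable_const (hi _ _) fun u hu => hg hu.2
  rw [intervalIntegral.integral_const, smul_eq_mul] at h
  linarith

/-- Monotonicity gives (t/2) g(t) ≤ ∫ g over [t/2, t], and this tail of a convergent integral tends
to 0. -/
theorem tendsto_mul_of_antitone {g : ℝ → ℝ} (hg : Antitone g) (h0 : ∀ t, 0 ≤ g t)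
    (hi : IntegrableOn g (Set.Ioi 0)) : Tendsto (fun t => t * g t) atTop (𝓝 0) := by
  have h1 := intervalIntegral_tendsto_integral_Ioi 0 hi tendsto_id
  have h2 := intervalIntegral_tendsto_integral_Ioi 0 hi (tendsto_id.atTop_div_const (two_pos (α := ℝ)))
  have h := (h1.sub h2).const_mul 2
  rw [sub_self, mul_zero] at h
  refine squeeze_zero' ?_ ?_ h
  · filter_upwards [eventually_ge_atTop 0] with t ht using mul_nonneg ht (h0 t)
  · filter_upwards [eventually_ge_atTop 0] with t ht
    have := half_mul_le_sub hg ht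
    simp only [id]
    linarith

theorem exists_mul_le_of_antitone {g : ℝ → ℝ} (hg : Antitone g) (h0 : ∀ t, 0 ≤ g t)
    (hi : IntegrableOn g (Set.Ioi 0)) : ∃ C, 0 ≤ C ∧ ∀ t, 0 ≤ t → t * g t ≤ C := by
  refine ⟨2 * ∫ u in Set.Ioi 0, g u, ?_, fun t ht => ?_⟩
  · exact mul_nonneg two_pos.le (integral_nonneg fun _ => h0 _)
  · have h1 := half_mul_le_sub hg ht
    have h2 : (∫ u in (0 : ℝ)..t, g u) ≤ ∫ u in Set.Ioi 0, g u := by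
      rw [intervalIntegral.integral_of_le ht]
      exact setIntegral_mono_set hi (ae_of_all _ fun _ => h0 _)
        (ae_of_all _ Set.Ioc_subset_Ioi_self)
    have h3 : 0 ≤ ∫ u in (0 : ℝ)..(t / 2), g u :=
      intervalIntegral.integral_nonneg (by linarith) fun _ _ => h0 _
    linarith

theorem tendsto_zero_of_antitone {g : ℝ → ℝ} (hg : Antitone g) (h0 : ∀ t, 0 ≤ g t)
    (hi : IntegrableOn g (Set.Ioi 0)) : Tendsto g atTop (𝓝 0) := by
  refine squeeze_zero' (Eventually.of_forall h0) ?_ (tendsto_mul_of_antitone hg h0 hi)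
  filter_upwards [eventually_ge_atTop 1] with t ht
  exact le_mul_of_one_le_left (h0 t) ht

/-- A series as the integral of a step function. -/
theorem hasSum_of_integrableOn_floor {a : ℕ → ℝ}
    (ha : IntegrableOn (fun u : ℝ => a ⌊u⌋₊) (Set.Ici 0)) :
    HasSum a (∫ u in Set.Ici (0 : ℝ), a ⌊u⌋₊) := by
  have hU : ⋃ n : ℕ, Set.Ico (n : ℝ) (n + 1) = Set.Ici 0 := by
    ext u
    simp only [Set.mem_iUnion, Set.mem_Ici]
    constructor
    · rintro ⟨n, hn, -⟩
      exact (Nat.cast_nonneg n).trans hn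
    · exact fun hu => ⟨⌊u⌋₊, Nat.floor_le hu, Nat.lt_floor_add_one u⟩
  have hfl : ∀ n : ℕ, ∀ u ∈ Set.Ico (n : ℝ) (n + 1), ⌊u⌋₊ = n := fun n u hu =>
    Nat.floor_eq_on_Ico n u hu
  have h := hasSum_integral_iUnion (μ := volume) (f := fun u : ℝ => a ⌊u⌋₊)
    (s := fun n : ℕ => Set.Ico (n : ℝ) (n + 1)) (fun n => measurableSet_Ico)
    (fun i j hij => Set.disjoint_left.2 fun u hi hj => hij (by
      rw [← hfl i u hi, ← hfl j u hj])) (by rwa [hU])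
  rw [hU] at h
  have e : ∀ n : ℕ, ∫ u in Set.Ico (n : ℝ) (n + 1), a ⌊u⌋₊ = a n := fun n => by
    rw [setIntegral_congr_fun (g := fun _ => a n) measurableSet_Ico fun u hu => by
      simp only [hfl n u hu], setIntegral_const]
    simp
  simpa only [e] using h

namespace IsShape

variable {Ψ : ℝ → ℝ} (hΨ : IsShape Ψ)
include hΨ

theorem nonneg (t : ℝ) : 0 ≤ Ψ t := (hΨ.mem_Icc t).1

theorem le_one (t : ℝ) : Ψ t ≤ 1 := (hΨ.mem_Icc t).2

theorem antitone : Antitone Ψ := antitone_of_deriv_nonpos hΨ.differentiable hΨ.deriv_nonpos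

theorem continuous : Continuous Ψ := hΨ.differentiable.continuous

theorem antitone_reflect : Antitone fun t => 1 - Ψ (-t) := fun s t h => by
  have := hΨ.antitone (neg_le_neg h)
  simp only; linarith

theorem integrableOn_reflect : IntegrableOn (fun t => 1 - Ψ (-t)) (Set.Ioi 0) := by
  have h := (integrable_indicator_iff measurableSet_Iio).2 hΨ.integrable_left
  rw [← integrable_indicator_iff measurableSet_Ioi]
  refine h.comp_neg.congr (ae_of_all _ fun t => ?_)
  simp only [Set.indicator, Set.mem_Iio, Set.mem_Ioi, Left.neg_neg_iff]

theorem tendsto_mul_one_sub : Tendsto (fun t => t * (1 - Ψ (-t))) atTop (𝓝 0) :=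
  tendsto_mul_of_antitone hΨ.antitone_reflect (fun _ => sub_nonneg.2 (hΨ.le_one _))
    hΨ.integrableOn_reflect

/-- The function that dominates the step function approximations of `Ψ (1 - Ψ)`. -/
theorem integrable_shift (s : ℝ) : Integrable fun t => Ψ (t - s) * (1 - Ψ t) := by
  have hc : Continuous fun t => Ψ (t - s) * (1 - Ψ t) :=
    (hΨ.continuous.comp (by fun_prop)).mul (continuous_const.sub hΨ.continuous)
  have h1 : IntegrableOn (fun t => Ψ (t - s) * (1 - Ψ t)) (Set.Iio 0) := by
    refine hΨ.integrable_left.mono' hc.aestronglyMeasurable (ae_of_all _ fun t => ?_)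
    have a := hΨ.nonneg (t - s)
    have b := hΨ.le_one (t - s)
    have c := sub_nonneg.2 (hΨ.le_one t)
    rw [Real.norm_eq_abs, abs_of_nonneg (mul_nonneg a c)]
    exact mul_le_of_le_one_left c b
  have h2 : IntegrableOn (fun t => Ψ (t - s) * (1 - Ψ t)) (Set.Icc 0 s) :=
    hc.continuousOn.integrableOn_Icc
  have h3 : IntegrableOn (fun t => Ψ (t - s) * (1 - Ψ t)) (Set.Ioi s) := by
    have h := (integrable_indicator_iff measurableSet_Ioi).2 hΨ.integrable_right
    have h' : IntegrableOn (fun t => Ψ (t - s)) (Set.Ioi s) := by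
      rw [← integrable_indicator_iff measurableSet_Ioi]
      refine (h.comp_sub_right s).congr (ae_of_all _ fun t => ?_)
      simp only [Set.indicator, Set.mem_Ioi, sub_pos]
    refine h'.mono' hc.aestronglyMeasurable (ae_of_all _ fun t => ?_)
    have a := hΨ.nonneg (t - s)
    have b := hΨ.nonneg t
    have c := sub_nonneg.2 (hΨ.le_one t)
    rw [Real.norm_eq_abs, abs_of_nonneg (mul_nonneg a c)]
    exact mul_le_of_le_one_right a (by linarith)
  rw [← integrableOn_univ]
  refine ((h1.union h2).union h3).mono_set fun t _ => ?_
  simp only [Set.mem_union, Set.mem_Iio, Set.mem_Icc, Set.mem_Ioi]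
  by_cases h : t < 0
  · exact .inl (.inl h)
  · by_cases h' : t ≤ s
    · exact .inl (.inr ⟨not_lt.1 h, h'⟩)
    · exact .inr (not_le.1 h')

theorem integrable : Integrable fun t => Ψ t * (1 - Ψ t) := by
  simpa using hΨ.integrable_shift 0

/-- The integrand is nonnegative and continuous, and Ψ takes the value 1/2 because its limits are 0
and 1. -/
theorem shapeConst_pos : 0 < shapeConst Ψ := by
  have hc : Continuous fun t => Ψ t * (1 - Ψ t) :=
    hΨ.continuous.mul (continuous_const.sub hΨ.continuous)
  rw [shapeConst, integral_pos_iff_support_of_nonneg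
    (fun t => mul_nonneg (hΨ.nonneg t) (sub_nonneg.2 (hΨ.le_one t))) hΨ.integrable]
  refine hc.isOpen_support.measure_pos _ ?_
  obtain ⟨a, ha⟩ := ((tendsto_zero_of_antitone hΨ.antitone hΨ.nonneg
    hΨ.integrable_right).eventually (eventually_lt_nhds (half_pos one_pos))).exists
  obtain ⟨b, hb⟩ := ((tendsto_zero_of_antitone hΨ.antitone_reflect
    (fun t => sub_nonneg.2 (hΨ.le_one _)) hΨ.integrableOn_reflect).eventually
      (eventually_lt_nhds (half_pos one_pos))).exists
  obtain ⟨t, ht⟩ := mem_range_of_exists_le_of_exists_ge hΨ.continuous (c := 1 / 2) ⟨a, ha.le⟩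
    ⟨-b, by linarith⟩
  exact ⟨t, by rw [Function.mem_support, ht]; norm_num⟩

end IsShape

/-- The eigenvalues of the kernel of the modified GUE. -/
def eig (Ψ : ℝ → ℝ) (τ α N : ℝ) (k : ℕ) : ℝ := Ψ (((k : ℝ) - N) / (τ * N ^ α))

namespace IsShape

variable {Ψ : ℝ → ℝ} (hΨ : IsShape Ψ) {τ α N : ℝ} (hτ : 0 < τ) (hN : 0 < N)
include hΨ hτ hN

theorem eig_antitone : Antitone (eig Ψ τ α N) := fun j k h => by
  have : 0 < τ * N ^ α := mul_pos hτ (Real.rpow_pos_of_pos hN α)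
  refine hΨ.antitone ?_
  gcongr

/-- Comparison with the integral of Ψ; the shift by 1 in the dominating function compensates for the
floor. -/
theorem eig_summable : Summable (eig Ψ τ α N) := by
  have hT : 0 < τ * N ^ α := mul_pos hτ (Real.rpow_pos_of_pos hN α)
  set T := τ * N ^ α with hTdef
  refine (hasSum_of_integrableOn_floor ?_).summable
  have hint : ∀ a : ℝ, IntegrableOn Ψ (Set.Ioi a) := fun a => by
    rcases le_total 0 a with h | h
    · exact hΨ.integrable_right.mono_set (Set.Ioi_subset_Ioi h)
    · refine ((hΨ.continuous.continuousOn.integrableOn_Icc (a := a) (b := 0)).union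
        hΨ.integrable_right).mono_set fun t ht => ?_
      rcases le_or_gt t 0 with h' | h'
      · exact .inl ⟨ht.le, h'⟩
      · exact .inr h'
  have h1 : IntegrableOn (fun u : ℝ => Ψ ((u - 1 - N) / T)) (Set.Ici 0) := by
    rw [integrableOn_Ici_iff_integrableOn_Ioi, ← integrable_indicator_iff measurableSet_Ioi]
    have h := (integrable_indicator_iff measurableSet_Ioi).2 (hint ((0 - 1 - N) / T))
    have h2 := (h.comp_mul_right' (R := T⁻¹) (inv_ne_zero hT.ne')).comp_sub_right (1 + N)
    refine h2.congr (ae_of_all _ fun u => ?_)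
    have e : (u - (1 + N)) * T⁻¹ = (u - 1 - N) / T := by rw [div_eq_mul_inv]; ring
    simp only [Set.indicator, Set.mem_Ioi, e, div_lt_div_iff_of_pos_right hT]
    simp
  refine h1.mono' ?_ ((ae_restrict_iff' measurableSet_Ici).2 (ae_of_all _ fun u hu => ?_))
  · exact ((measurable_from_nat (f := eig Ψ τ α N)).comp Nat.measurable_floor).aestronglyMeasurable
  · have h0 : 0 ≤ eig Ψ τ α N ⌊u⌋₊ := hΨ.nonneg _
    rw [Real.norm_eq_abs, abs_of_nonneg h0]
    refine hΨ.antitone ?_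
    have := Nat.lt_floor_add_one u
    gcongr
    linarith

omit hΨ hτ in
-- For N and L fixed, the energy bound covers all large k and the bound on partial sums covers the
-- finitely many others.
theorem exists_hermiteScaled_sq_le (L : ℝ) :
    ∃ B, 0 ≤ B ∧ ∀ k, ∀ x ∈ Set.Icc (-L) L, hermiteScaled N k x ^ 2 ≤ B := by
  have hc := scale_pos hN
  set K := ⌈(L * scale N) ^ 2⌉₊ + 1 with hK
  refine ⟨2 * scale N + scale N * (2 * jac K), ?_, fun k x hx => ?_⟩
  · have := jac_nonneg K
    positivity
  · rcases lt_or_ge k K with h | h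
    · have h1 := (Finset.single_le_sum (f := fun k => hermiteScaled N k x ^ 2)
        (fun _ _ => sq_nonneg _) (Finset.mem_range.2 h)).trans (sum_hermiteScaled_sq_le N K x)
      linarith
    · have hk1 : 1 ≤ k := le_trans (by omega) h
      have hk1' : (1 : ℝ) ≤ k := by exact_mod_cast hk1
      have h2 : (x * scale N) ^ 2 ≤ k := by
        have : (K : ℝ) ≤ k := by exact_mod_cast h
        have h3 := Nat.le_ceil ((L * scale N) ^ 2)
        have h4 : (x * scale N) ^ 2 ≤ (L * scale N) ^ 2 := by
          rw [mul_pow, mul_pow]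
          have : x ^ 2 ≤ L ^ 2 := sq_le_sq.2 ((abs_le.2 hx).trans (le_abs_self _))
          gcongr
        rw [hK] at this
        push_cast at this
        linarith
      refine (hermiteScaled_sq_le hk1 h2).trans ?_
      have h5 : 2 * scale N / √(k : ℝ) ≤ 2 * scale N :=
        div_le_self (by positivity) (Real.one_le_sqrt.2 hk1')
      have := mul_nonneg hc.le (mul_nonneg two_pos.le (jac_nonneg K))
      linarith

theorem isSpectral : IsSpectral (eig Ψ τ α N) (hermiteScaled N) where
  mem_Icc k := hΨ.mem_Icc _
  measurable k := (continuous_hermiteScaled N k).measurable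
  memLp := memLp_hermiteScaled hN
  orthonormal := hermiteScaled_orthonormal hN
  summable x := by
    obtain ⟨B, hB0, hB⟩ := exists_hermiteScaled_sq_le hN |x|
    refine Summable.of_nonneg_of_le (fun k => mul_nonneg (hΨ.nonneg _) (sq_nonneg _)) (fun k => ?_)
      ((hΨ.eig_summable (α := α) hτ hN).mul_right B)
    exact mul_le_mul_of_nonneg_left (hB k x (abs_le.1 le_rfl)) (hΨ.nonneg _)
  bounded L := by
    obtain ⟨B, hB0, hB⟩ := exists_hermiteScaled_sq_le hN L
    have hs := (hΨ.eig_summable (α := α) hτ hN).mul_right B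
    refine ⟨∑' k, eig Ψ τ α N k * B, fun x hx => ?_⟩
    have hle : ∀ k, eig Ψ τ α N k * hermiteScaled N k x ^ 2 ≤ eig Ψ τ α N k * B := fun k =>
      mul_le_mul_of_nonneg_left (hB k x hx) (hΨ.nonneg _)
    exact Summable.tsum_le_tsum hle
      (Summable.of_nonneg_of_le (fun k => mul_nonneg (hΨ.nonneg _) (sq_nonneg _)) hle hs) hs

end IsShape

end Shape

/-! ### The diagonal part of the variance: the cut at N/4 and the low indices. -/

section Diagonal

/-- An index of order `N` below the spectral edge index. -/
def cut (N : ℝ) : ℕ := ⌈N / 4⌉₊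

theorem le_cut (N : ℝ) : N / 4 ≤ cut N := Nat.le_ceil _

theorem cut_pos {N : ℝ} (hN : 0 < N) : 0 < cut N := Nat.ceil_pos.2 (by linarith)

theorem cut_le {N : ℝ} (hN : 4 ≤ N) : (cut N : ℝ) ≤ N / 2 := by
  have := (Nat.ceil_lt_add_one (a := N / 4) (by linarith)).le
  unfold cut
  linarith

theorem scale_mul_jac_le {N : ℝ} (hN : 4 ≤ N) : scale N * (2 * jac (cut N)) ≤ 3 * N := by
  have h0 : 0 ≤ N := by linarith
  refine abs_le_of_sq_le_sq' ?_ (by positivity) |>.2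
  rw [mul_pow, mul_pow, jac_sq, scale_sq h0]
  have h1 := cut_le hN
  have h2 : Real.pi ^ 2 ≤ 16 := by nlinarith [Real.pi_pos, Real.pi_le_four]
  have h3 : Real.pi ^ 2 * (N * cut N) ≤ 16 * (N * (N / 2)) := by gcongr
  nlinarith

/-- The thresholds match: for |x| ≤ 1/5 the squared rescaled point is at most (1/25)(12/2)N ≤ N/4,
so the energy bounds hold on [-1/5, 1/5] for every k above the cut. -/
theorem scaled_endpoint_le {N : ℝ} (hN : 0 < N) {k : ℕ} (hk : cut N ≤ k) {x : ℝ}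
    (hx : |x| ≤ 1 / 5) : (x * scale N) ^ 2 ≤ k := by
  have h1 : (cut N : ℝ) ≤ k := by exact_mod_cast hk
  refine le_trans ?_ ((le_cut N).trans h1)
  rw [mul_pow, scale_sq hN.le]
  have h2 : Real.pi ^ 2 ≤ 12 := by nlinarith [Real.pi_pos, Real.pi_lt_d2]
  have h3 : x ^ 2 ≤ (1 / 5) ^ 2 := sq_le_sq.2 (hx.trans (le_abs_self _))
  calc x ^ 2 * (Real.pi ^ 2 / 2 * N) ≤ (1 / 5) ^ 2 * (12 / 2 * N) := by gcongr
    _ ≤ N / 4 := by linarith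

theorem scale_div_sqrt_le {N : ℝ} (hN : 0 < N) {k : ℕ} (hk : cut N ≤ k) :
    scale N / √k ≤ 6 := by
  have h1 : (cut N : ℝ) ≤ k := by exact_mod_cast hk
  have h0 : (0 : ℝ) < k := lt_of_lt_of_le (by exact_mod_cast cut_pos hN) h1
  rw [div_le_iff₀ (Real.sqrt_pos.2 h0)]
  refine abs_le_of_sq_le_sq' ?_ (by positivity) |>.2
  rw [mul_pow, Real.sq_sqrt h0.le, scale_sq hN.le]
  have h2 : Real.pi ^ 2 ≤ 16 := by nlinarith [Real.pi_pos, Real.pi_le_four]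
  have := le_cut N
  have : Real.pi ^ 2 * N ≤ 16 * N := by gcongr
  nlinarith

theorem hermiteScaled_sq_le_of_cut_le {N : ℝ} (hN : 0 < N) {k : ℕ} (hk : cut N ≤ k) {x : ℝ}
    (hx : |x| ≤ 1 / 5) : hermiteScaled N k x ^ 2 ≤ 12 := by
  refine (hermiteScaled_sq_le ((cut_pos hN).trans_le hk) (scaled_endpoint_le hN hk hx)).trans ?_
  have := scale_div_sqrt_le hN hk
  rw [mul_div_assoc]; linarith

/-- The averages of the squares of the rescaled Hermite functions against `w`, at scale `N ^ (-δ)`. -/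
def average (w : ℝ → ℝ) (δ N : ℝ) (k : ℕ) : ℝ := ∫ y, w y * hermiteScaled N k (y * N ^ (-δ)) ^ 2

variable {w : ℝ → ℝ} (hw : Integrable w) (hw0 : ∀ y, 0 ≤ w y)

include hw0 in
theorem average_nonneg (δ N : ℝ) (k : ℕ) : 0 ≤ average w δ N k :=
  integral_nonneg fun y => mul_nonneg (hw0 y) (sq_nonneg _)

include hw hw0 in
theorem sum_average_le (δ N : ℝ) (n : ℕ) :
    ∑ k ∈ Finset.range n, average w δ N k ≤ scale N * (2 * jac n) * ∫ y, w y := by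
  have hi := integrable_mul_hermiteScaled_sq hw N (N ^ (-δ))
  simp only [average]
  rw [← integral_finsetSum _ fun k _ => hi k, ← integral_const_mul]
  refine integral_mono (integrable_finsetSum _ fun k _ => hi k) (hw.const_mul _) fun y => ?_
  simp only
  rw [← Finset.mul_sum, mul_comm]
  exact mul_le_mul_of_nonneg_right (sum_hermiteScaled_sq_le N n _) (hw0 y)

include hw hw0 in
theorem average_le_of_forall {δ N Y B : ℝ} {k : ℕ} (hN : 0 < N)
    (hs : ∀ y, y ∉ Set.Icc (-Y) Y → w y = 0)
    (hB : ∀ x, |x| ≤ Y * N ^ (-δ) → hermiteScaled N k x ^ 2 ≤ B) :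
    average w δ N k ≤ B * ∫ y, w y := by
  rw [average, ← integral_const_mul]
  refine integral_mono (integrable_mul_hermiteScaled_sq hw N (N ^ (-δ)) k) (hw.const_mul _)
    fun y => ?_
  have hp := Real.rpow_pos_of_pos hN (-δ)
  simp only
  by_cases hy : y ∈ Set.Icc (-Y) Y
  · rw [mul_comm]
    refine mul_le_mul_of_nonneg_right (hB _ ?_) (hw0 y)
    rw [abs_mul, abs_of_pos hp]
    exact mul_le_mul_of_nonneg_right (abs_le.2 hy) hp.le
  · rw [hs y hy]; simp

theorem eventually_mul_rpow_neg_le {δ : ℝ} (hδ : 0 < δ) (Y : ℝ) {ε : ℝ} (hε : 0 < ε) :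
    ∀ᶠ N : ℝ in atTop, Y * N ^ (-δ) ≤ ε := by
  have := (tendsto_rpow_neg_atTop hδ).const_mul Y
  rw [mul_zero] at this
  filter_upwards [this.eventually (eventually_lt_nhds hε)] with N h using h.le

variable {Ψ : ℝ → ℝ} (hΨ : IsShape Ψ) {τ α : ℝ} (hτ : 0 < τ)

include hΨ hτ in
-- At the cut the argument of Ψ is at most -N^(1-α)/(2τ), and 1 - Ψ(-t) = o(1/t).
theorem tendsto_one_sub_eig_cut (hα : α < 1) :
    Tendsto (fun N : ℝ => N ^ (1 - α) * (1 - eig Ψ τ α N (cut N))) atTop (𝓝 0) := by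
  have hlow : ∀ N : ℝ, 4 ≤ N → N ^ (1 - α) / (2 * τ) ≤ (N - cut N) / (τ * N ^ α) := by
    intro N hN
    have hN0 : 0 < N := by linarith
    have hp := Real.rpow_pos_of_pos hN0 α
    rw [Real.rpow_sub hN0, Real.rpow_one, div_div, div_le_div_iff₀ (by positivity) (by positivity)]
    have := cut_le hN
    have h2 : N / 2 ≤ N - cut N := by linarith
    have : N / 2 * (N ^ α * (2 * τ)) ≤ (N - cut N) * (N ^ α * (2 * τ)) := by gcongr
    linarith
  have hu : Tendsto (fun N : ℝ => (N - cut N) / (τ * N ^ α)) atTop atTop := by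
    refine tendsto_atTop_mono' _ ?_
      ((tendsto_rpow_atTop (sub_pos.2 hα)).atTop_div_const (by positivity : 0 < 2 * τ))
    filter_upwards [eventually_ge_atTop 4] with N hN using hlow N hN
  have h := (hΨ.tendsto_mul_one_sub.comp hu).const_mul (2 * τ)
  rw [mul_zero] at h
  refine squeeze_zero' ?_ ?_ h
  · filter_upwards [eventually_gt_atTop 0] with N hN
    exact mul_nonneg (Real.rpow_nonneg hN.le _) (sub_nonneg.2 (hΨ.le_one _))
  · filter_upwards [eventually_ge_atTop 4] with N hN
    have h1 := hlow N hN
    rw [div_le_iff₀ (by positivity)] at h1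
    have e : Ψ (-((N - cut N) / (τ * N ^ α))) = eig Ψ τ α N (cut N) := by
      rw [eig, ← neg_div, neg_sub]
    simp only [Function.comp_apply]
    rw [e, ← mul_assoc]
    refine mul_le_mul_of_nonneg_right ?_ (sub_nonneg.2 (hΨ.le_one _))
    linarith

include hΨ hτ hw hw0 in
theorem summable_diagonal {δ N Y : ℝ} (hN : 0 < N) (hs : ∀ y, y ∉ Set.Icc (-Y) Y → w y = 0) :
    Summable fun k => eig Ψ τ α N k * (1 - eig Ψ τ α N k) * average w δ N k := by
  obtain ⟨B, hB0, hB⟩ := IsShape.exists_hermiteScaled_sq_le hN (Y * N ^ (-δ))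
  refine Summable.of_nonneg_of_le (fun k => ?_) (fun k => ?_)
    ((hΨ.eig_summable (α := α) hτ hN).mul_right (B * ∫ y, w y))
  · exact mul_nonneg (mul_nonneg (hΨ.nonneg _) (sub_nonneg.2 (hΨ.le_one _)))
      (average_nonneg hw0 δ N k)
  · refine mul_le_mul ?_ (average_le_of_forall hw hw0 hN hs fun x hx => hB k x (abs_le.1 hx))
      (average_nonneg hw0 δ N k) (hΨ.nonneg _)
    exact mul_le_of_le_one_right (hΨ.nonneg _) (sub_le_self 1 (hΨ.nonneg _))

include hΨ hτ hw hw0 in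
-- Below the cut, p(1 - p) ≤ 1 - p_cut by monotonicity, and the sum of all averages there is O(N).
-- So the head is O(N(1 - p_cut)) = o(N^α).
theorem tendsto_diagonal_head (hα : α < 1) (δ : ℝ) :
    Tendsto (fun N : ℝ => N ^ (-α) * ∑ k ∈ Finset.range (cut N),
      eig Ψ τ α N k * (1 - eig Ψ τ α N k) * average w δ N k) atTop (𝓝 0) := by
  have h := ((tendsto_one_sub_eig_cut hΨ hτ hα).const_mul (3 * ∫ y, w y))
  rw [mul_zero] at h
  refine squeeze_zero' ?_ ?_ h
  · filter_upwards [eventually_gt_atTop 0] with N hN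
    refine mul_nonneg (Real.rpow_nonneg hN.le _) (Finset.sum_nonneg fun k _ => ?_)
    exact mul_nonneg (mul_nonneg (hΨ.nonneg _) (sub_nonneg.2 (hΨ.le_one _)))
      (average_nonneg hw0 δ N k)
  · filter_upwards [eventually_ge_atTop 4] with N hN
    have hN0 : 0 < N := by linarith
    have hp := Real.rpow_pos_of_pos hN0 (-α)
    have h1 : 0 ≤ 1 - eig Ψ τ α N (cut N) := sub_nonneg.2 (hΨ.le_one _)
    have hI : 0 ≤ ∫ y, w y := integral_nonneg hw0
    calc N ^ (-α) * ∑ k ∈ Finset.range (cut N),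
          eig Ψ τ α N k * (1 - eig Ψ τ α N k) * average w δ N k
        ≤ N ^ (-α) * ∑ k ∈ Finset.range (cut N),
          (1 - eig Ψ τ α N (cut N)) * average w δ N k := by
          gcongr with k hk
          · exact average_nonneg hw0 δ N k
          · have a := hΨ.eig_antitone (α := α) hτ hN0 (Finset.mem_range.1 hk).le
            have b : 0 ≤ 1 - eig Ψ τ α N k := sub_nonneg.2 (hΨ.le_one _)
            have c : eig Ψ τ α N k ≤ 1 := hΨ.le_one _
            have d := mul_le_of_le_one_left b c
            linarith
      _ ≤ N ^ (-α) * ((1 - eig Ψ τ α N (cut N)) * (3 * N * ∫ y, w y)) := by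
          rw [← Finset.mul_sum]
          gcongr
          refine (sum_average_le hw hw0 δ N _).trans ?_
          exact mul_le_mul_of_nonneg_right (scale_mul_jac_le hN) hI
      _ = 3 * (∫ y, w y) * (N ^ (1 - α) * (1 - eig Ψ τ α N (cut N))) := by
          rw [show 1 - α = 1 + -α by ring, Real.rpow_add hN0, Real.rpow_one]
          ring

end Diagonal

/-! ### The diagonal part above the cut, as a Riemann sum. -/

section DiagonalTail

variable {w : ℝ → ℝ} (hw : Integrable w) (hw0 : ∀ y, 0 ≤ w y)
  {Ψ : ℝ → ℝ} (hΨ : IsShape Ψ) {τ α δ : ℝ} (hτ : 0 < τ)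

/-- The summands of the diagonal sum above the cut. -/
def diagonalTail (w Ψ : ℝ → ℝ) (τ α δ N : ℝ) (k : ℕ) : ℝ :=
  if cut N ≤ k then eig Ψ τ α N k * (1 - eig Ψ τ α N k) * average w δ N k else 0

/-- The step function of `diagonalTail` in the spectral variable. -/
def diagonalStep (w Ψ : ℝ → ℝ) (τ α δ N t : ℝ) : ℝ :=
  (Set.Ici (0 : ℝ)).indicator (fun u => diagonalTail w Ψ τ α δ N ⌊u⌋₊) (τ * N ^ α * t + N)

theorem measurable_diagonalStep (N : ℝ) : Measurable (diagonalStep w Ψ τ α δ N) :=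
  (((measurable_from_nat (f := diagonalTail w Ψ τ α δ N)).comp Nat.measurable_floor).indicator
    measurableSet_Ici).comp (by fun_prop : Measurable fun t => τ * N ^ α * t + N)

include hw0 hΨ in
theorem diagonalTail_nonneg (N : ℝ) (k : ℕ) : 0 ≤ diagonalTail w Ψ τ α δ N k := by
  unfold diagonalTail
  split_ifs
  · exact mul_nonneg (mul_nonneg (hΨ.nonneg _) (sub_nonneg.2 (hΨ.le_one _)))
      (average_nonneg hw0 δ N k)
  · exact le_rfl

include hw hw0 hΨ in
-- The floor moves the argument of Ψ by at most 1/(τN^α) ≤ 1, hence the shift t - 1 in the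
-- dominating function. The factor 12 bounds φ_k² above the cut.
theorem diagonalStep_le {N Y : ℝ} (hN : 0 < N) (hT : 1 ≤ τ * N ^ α) (hY : Y * N ^ (-δ) ≤ 1 / 5)
    (hs : ∀ y, y ∉ Set.Icc (-Y) Y → w y = 0) (t : ℝ) :
    diagonalStep w Ψ τ α δ N t ≤ 12 * (∫ y, w y) * (Ψ (t - 1) * (1 - Ψ t)) := by
  have hI : 0 ≤ ∫ y, w y := integral_nonneg hw0
  have h0 : 0 ≤ 12 * (∫ y, w y) * (Ψ (t - 1) * (1 - Ψ t)) :=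
    mul_nonneg (mul_nonneg (by norm_num) hI) (mul_nonneg (hΨ.nonneg _) (sub_nonneg.2 (hΨ.le_one _)))
  have hT0 : 0 < τ * N ^ α := by linarith
  unfold diagonalStep Set.indicator
  split_ifs with hu
  · unfold diagonalTail
    beta_reduce
    split_ifs with hk
    · set k := ⌊τ * N ^ α * t + N⌋₊ with hkdef
      have f1 := Nat.floor_le (Set.mem_Ici.1 hu)
      have f2 := Nat.lt_floor_add_one (τ * N ^ α * t + N)
      rw [← hkdef] at f1 f2
      have e1 : eig Ψ τ α N k ≤ Ψ (t - 1) := by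
        refine hΨ.antitone ?_
        rw [le_div_iff₀ hT0]
        linarith
      have e2 : Ψ t ≤ eig Ψ τ α N k := by
        refine hΨ.antitone ?_
        rw [div_le_iff₀ hT0]
        linarith
      have e3 : average w δ N k ≤ 12 * ∫ y, w y :=
        average_le_of_forall hw hw0 hN hs fun x hx =>
          hermiteScaled_sq_le_of_cut_le hN hk (hx.trans hY)
      have e4 := average_nonneg hw0 δ N k
      have e5 : 0 ≤ 1 - eig Ψ τ α N k := sub_nonneg.2 (hΨ.le_one _)
      rw [mul_comm (12 * _)]
      refine mul_le_mul (mul_le_mul e1 (by linarith) e5 (hΨ.nonneg _)) e3 e4 ?_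
      exact mul_nonneg (hΨ.nonneg _) (sub_nonneg.2 (hΨ.le_one _))
    · exact h0
  · exact h0

include hw0 hΨ in
theorem diagonalStep_nonneg (N t : ℝ) : 0 ≤ diagonalStep w Ψ τ α δ N t :=
  Set.indicator_nonneg (fun _ _ => diagonalTail_nonneg hw0 hΨ _ _) _

include hw hw0 hΨ hτ in
-- The substitution u = τN^α t + N turns the integral of the step function into the sum.
theorem integral_diagonalStep {N Y : ℝ} (hN : 0 < N) (hT : 1 ≤ τ * N ^ α)
    (hY : Y * N ^ (-δ) ≤ 1 / 5) (hs : ∀ y, y ∉ Set.Icc (-Y) Y → w y = 0) :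
    τ * ∫ t, diagonalStep w Ψ τ α δ N t = N ^ (-α) * ∑' k, diagonalTail w Ψ τ α δ N k := by
  have hT0 : 0 < τ * N ^ α := by linarith
  have hint : Integrable (diagonalStep w Ψ τ α δ N) := by
    refine ((hΨ.integrable_shift 1).const_mul (12 * ∫ y, w y)).mono'
      (measurable_diagonalStep N).aestronglyMeasurable (ae_of_all _ fun t => ?_)
    rw [Real.norm_eq_abs, abs_of_nonneg (diagonalStep_nonneg hw0 hΨ N t)]
    exact diagonalStep_le hw hw0 hΨ hN hT hY hs t
  set G : ℝ → ℝ := (Set.Ici (0 : ℝ)).indicator fun u => diagonalTail w Ψ τ α δ N ⌊u⌋₊ with hG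
  have hGi : Integrable G := by
    have h := (hint.comp_sub_right (N / (τ * N ^ α))).comp_mul_right' (R := (τ * N ^ α)⁻¹)
      (inv_ne_zero hT0.ne')
    refine h.congr (ae_of_all _ fun u => ?_)
    simp only [diagonalStep, ← hG]
    congr 1
    field_simp
    ring
  have hsum := hasSum_of_integrableOn_floor (a := diagonalTail w Ψ τ α δ N)
    ((integrable_indicator_iff measurableSet_Ici).1 hGi)
  rw [← integral_indicator measurableSet_Ici, ← hG] at hsum
  rw [hsum.tsum_eq]
  have e : ∫ t, diagonalStep w Ψ τ α δ N t = (τ * N ^ α)⁻¹ * ∫ u, G u := by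
    change ∫ t, G (τ * N ^ α * t + N) = _
    rw [Measure.integral_comp_mul_left (fun u => G (u + N)) (τ * N ^ α),
      integral_add_right_eq_self G N, abs_of_pos (inv_pos.2 hT0), smul_eq_mul]
  rw [e, mul_inv, Real.rpow_neg hN.le, ← mul_assoc, ← mul_assoc, mul_inv_cancel₀ hτ.ne', one_mul]

variable (hα : 0 < α) (hα1 : α < 1)

include hτ hα hα1

omit hτ hα in
theorem tendsto_floor_div (t : ℝ) :
    Tendsto (fun N : ℝ => (⌊τ * N ^ α * t + N⌋₊ : ℝ) / N) atTop (𝓝 1) := by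
  have h1 : Tendsto (fun N : ℝ => τ * t * N ^ (-(1 - α)) + 1) atTop (𝓝 1) := by
    simpa using ((tendsto_rpow_neg_atTop (sub_pos.2 hα1)).const_mul (τ * t)).add_const 1
  have h2 : Tendsto (fun N : ℝ => τ * t * N ^ (-(1 - α)) + 1 - N⁻¹) atTop (𝓝 1) := by
    simpa using h1.sub tendsto_inv_atTop_zero
  have e : ∀ N : ℝ, 0 < N → τ * t * N ^ (-(1 - α)) + 1 = (τ * N ^ α * t + N) / N := by
    intro N hN
    rw [show -(1 - α) = α - 1 by ring, Real.rpow_sub hN, Real.rpow_one]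
    field_simp
  refine tendsto_of_tendsto_of_tendsto_of_le_of_le' h2 h1 ?_ ?_
  · filter_upwards [eventually_gt_atTop 0] with N hN
    rw [e N hN, ← one_div, ← sub_div]
    have := (Nat.lt_floor_add_one (τ * N ^ α * t + N)).le
    gcongr
    linarith
  · filter_upwards [eventually_gt_atTop 0, h1.eventually (eventually_gt_nhds one_pos)] with N hN hp
    rw [e N hN] at hp ⊢
    have := Nat.floor_le ((div_pos_iff_of_pos_right hN).1 hp).le
    gcongr

include hΨ in
theorem tendsto_eig_floor (t : ℝ) :
    Tendsto (fun N : ℝ => eig Ψ τ α N ⌊τ * N ^ α * t + N⌋₊) atTop (𝓝 (Ψ t)) := by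
  refine (hΨ.continuous.tendsto t).comp ?_
  have hinv : Tendsto (fun N : ℝ => (τ * N ^ α)⁻¹) atTop (𝓝 0) :=
    ((tendsto_rpow_atTop hα).const_mul_atTop hτ).inv_tendsto_atTop
  have h1 : Tendsto (fun N : ℝ => t - (τ * N ^ α)⁻¹) atTop (𝓝 t) := by
    simpa using tendsto_const_nhds.sub hinv
  refine tendsto_of_tendsto_of_tendsto_of_le_of_le' h1 tendsto_const_nhds ?_ ?_
  · filter_upwards [eventually_gt_atTop 0] with N hN
    have hT := mul_pos hτ (Real.rpow_pos_of_pos hN α)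
    rw [le_div_iff₀ hT, sub_mul, inv_mul_cancel₀ hT.ne']
    have := (Nat.lt_floor_add_one (τ * N ^ α * t + N)).le
    linarith
  · filter_upwards [eventually_gt_atTop 0, (tendsto_floor_div (τ := τ) hα1 t).eventually
      (eventually_gt_nhds one_pos)] with N hN hp
    have hT := mul_pos hτ (Real.rpow_pos_of_pos hN α)
    rw [div_le_iff₀ hT]
    have hpos : 0 < ⌊τ * N ^ α * t + N⌋₊ := by
      exact_mod_cast (div_pos_iff_of_pos_right hN).1 hp
    have := Nat.floor_le (Nat.pos_of_floor_pos hpos).le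
    linarith

include hw hΨ in
-- For fixed t the index ⌊τN^α t + N⌋ is asymptotic to N because α < 1, so the local average 1/2
-- applies, while the eigenvalue tends to Ψ(t).
theorem tendsto_diagonalStep {Y : ℝ} (hδ : 0 < δ) (hδ1 : δ < 1)
    (hs : ∀ y, y ∉ Set.Icc (-Y) Y → w y = 0) (t : ℝ) :
    Tendsto (fun N => diagonalStep w Ψ τ α δ N t) atTop
      (𝓝 (Ψ t * (1 - Ψ t) * (1 / 2 * ∫ y, w y))) := by
  have hk := tendsto_floor_div (τ := τ) hα1 t
  have he := tendsto_eig_floor hΨ hτ hα hα1 t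
  have h := (he.mul (he.const_sub 1)).mul (tendsto_local_average hk hδ hδ1 hw hs)
  refine h.congr' ?_
  filter_upwards [hk.eventually (eventually_gt_nhds one_half_lt_one), eventually_ge_atTop 4] with N h1 hN
  have hN0 : 0 < N := by linarith
  rw [lt_div_iff₀ hN0] at h1
  have h2 : cut N ≤ ⌊τ * N ^ α * t + N⌋₊ := by
    have := cut_le hN
    have : (cut N : ℝ) ≤ ⌊τ * N ^ α * t + N⌋₊ := by linarith
    exact_mod_cast this
  have h3 : 0 ≤ τ * N ^ α * t + N :=
    (Nat.pos_of_floor_pos ((cut_pos hN0).trans_le h2)).le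
  rw [diagonalStep, Set.indicator_of_mem (Set.mem_Ici.2 h3), diagonalTail, if_pos h2, average]

include hw hw0 hΨ in
/-- The diagonal part of the variance. -/
theorem tendsto_diagonal {Y : ℝ} (hδ : 0 < δ) (hδ1 : δ < 1)
    (hs : ∀ y, y ∉ Set.Icc (-Y) Y → w y = 0) :
    Tendsto (fun N : ℝ => N ^ (-α) *
      ∑' k, eig Ψ τ α N k * (1 - eig Ψ τ α N k) * average w δ N k) atTop
      (𝓝 (τ / 2 * shapeConst Ψ * ∫ y, w y)) := by
  have hT : ∀ᶠ N : ℝ in atTop, 1 ≤ τ * N ^ α :=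
    ((tendsto_rpow_atTop hα).const_mul_atTop hτ).eventually_ge_atTop 1
  have hev := hT.and ((eventually_mul_rpow_neg_le hδ Y (by norm_num : (0 : ℝ) < 1 / 5)).and
    (eventually_gt_atTop 0))
  have h1 : Tendsto (fun N => ∫ t, diagonalStep w Ψ τ α δ N t) atTop
      (𝓝 (∫ t, Ψ t * (1 - Ψ t) * (1 / 2 * ∫ y, w y))) := by
    refine tendsto_integral_filter_of_dominated_convergence
      (fun t => 12 * (∫ y, w y) * (Ψ (t - 1) * (1 - Ψ t)))
      (Eventually.of_forall fun N => (measurable_diagonalStep N).aestronglyMeasurable) ?_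
      ((hΨ.integrable_shift 1).const_mul _)
      (ae_of_all _ fun t => tendsto_diagonalStep hw hΨ hτ hα hα1 hδ hδ1 hs t)
    filter_upwards [hev] with N hN
    refine ae_of_all _ fun t => ?_
    rw [Real.norm_eq_abs, abs_of_nonneg (diagonalStep_nonneg hw0 hΨ N t)]
    exact diagonalStep_le hw hw0 hΨ hN.2.2 hN.1 hN.2.1 hs t
  rw [integral_mul_const] at h1
  have h2 := (tendsto_diagonal_head hw hw0 hΨ hτ hα1 δ).add (h1.const_mul τ)
  have e : 0 + τ * ((∫ t, Ψ t * (1 - Ψ t)) * (1 / 2 * ∫ y, w y))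
      = τ / 2 * shapeConst Ψ * ∫ y, w y := by rw [shapeConst]; ring
  rw [e] at h2
  refine h2.congr' ?_
  filter_upwards [hev] with N hN
  rw [integral_diagonalStep hw hw0 hΨ hτ hN.2.2 hN.1 hN.2.1 hs, ← mul_add]
  congr 1
  have hsum := summable_diagonal hw hw0 hΨ (α := α) (δ := δ) hτ hN.2.2 hs
  have h3 : diagonalTail w Ψ τ α δ N = ((Finset.range (cut N) : Set ℕ)ᶜ).indicator
      fun k => eig Ψ τ α N k * (1 - eig Ψ τ α N k) * average w δ N k := by
    ext k
    simp only [diagonalTail, Set.indicator, Set.mem_compl_iff, Finset.coe_range, Set.mem_Iio, not_lt]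
  rw [h3, ← tsum_subtype]
  exact hsum.sum_add_tsum_compl

end DiagonalTail

/-! ### Christoffel–Darboux and bounds on (x - y) K(x, y). -/

section Christoffel

/-- The kernel with finitely many eigenvalues `b 0, …, b (M - 1)`. -/
def partialKernel (N : ℝ) (b : ℕ → ℝ) (M : ℕ) (x y : ℝ) : ℝ :=
  ∑ k ∈ Finset.range M, b k * (hermiteScaled N k x * hermiteScaled N k y)

/-- The Christoffel–Darboux numerators. -/
def christoffel (N : ℝ) (k : ℕ) (x y : ℝ) : ℝ :=
  jac k * (hermiteScaled N k x * hermiteScaled N (k - 1) y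
    - hermiteScaled N (k - 1) x * hermiteScaled N k y)

theorem partialKernel_comm (N : ℝ) (b : ℕ → ℝ) (M : ℕ) (x y : ℝ) :
    partialKernel N b M x y = partialKernel N b M y x := by
  simp only [partialKernel, mul_comm (hermiteScaled N _ x)]

theorem continuous_partialKernel (N : ℝ) (b : ℕ → ℝ) (M : ℕ) :
    Continuous fun z : ℝ × ℝ => partialKernel N b M z.1 z.2 :=
  continuous_finsetSum _ fun k _ => continuous_const.mul
    (((continuous_hermiteScaled N k).comp continuous_fst).mul
      ((continuous_hermiteScaled N k).comp continuous_snd))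

theorem mul_hermiteScaled (N : ℝ) (k : ℕ) (x : ℝ) : x * scale N * hermiteScaled N k x
    = jac (k + 1) * hermiteScaled N (k + 1) x + jac k * hermiteScaled N (k - 1) x := by
  simp only [hermiteScaled_eq]
  linear_combination √(scale N) * mul_hermiteFun k (x * scale N)

/-- The three-term recurrence writes (x - y) φ_k(x) φ_k(y) as a difference in k, the local form of
Christoffel–Darboux. -/
theorem scale_mul_sub_mul (N : ℝ) (k : ℕ) (x y : ℝ) :
    scale N * (x - y) * (hermiteScaled N k x * hermiteScaled N k y)
      = christoffel N (k + 1) x y - christoffel N k x y := by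
  have h1 := mul_hermiteScaled N k x
  have h2 := mul_hermiteScaled N k y
  simp only [christoffel, Nat.add_sub_cancel]
  linear_combination hermiteScaled N k y * h1 - hermiteScaled N k x * h2

/-- Summation by parts: only the increments of the coefficients remain, besides a boundary term that
vanishes when b M = 0. -/
theorem scale_mul_sub_mul_partialKernel (N : ℝ) (b : ℕ → ℝ) (M : ℕ) (x y : ℝ) :
    scale N * (x - y) * partialKernel N b M x y = b M * christoffel N M x y
      + ∑ k ∈ Finset.range M, (b k - b (k + 1)) * christoffel N (k + 1) x y := by
  induction M with
  | zero => simp [partialKernel, christoffel, jac_zero]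
  | succ M ih =>
    have h := scale_mul_sub_mul N M x y
    rw [partialKernel] at ih ⊢
    rw [Finset.sum_range_succ, Finset.sum_range_succ, mul_add, ih]
    linear_combination b M * h

theorem integral_sum_hermiteScaled_sq {N : ℝ} (hN : 0 < N) (u : ℕ → ℝ) (r : ℕ → ℕ)
    (hr : Function.Injective r) (M : ℕ) :
    Integrable (fun y => (∑ k ∈ Finset.range M, u k * hermiteScaled N (r k) y) ^ 2) ∧
    ∫ y, (∑ k ∈ Finset.range M, u k * hermiteScaled N (r k) y) ^ 2
      = ∑ k ∈ Finset.range M, u k ^ 2 := by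
  have hi : ∀ j k, Integrable fun y => hermiteScaled N j y * hermiteScaled N k y := fun j k =>
    (memLp_hermiteScaled hN j).integrable_mul (memLp_hermiteScaled hN k)
  have e : ∀ y, (∑ k ∈ Finset.range M, u k * hermiteScaled N (r k) y) ^ 2
      = ∑ j ∈ Finset.range M, ∑ k ∈ Finset.range M,
        u j * u k * (hermiteScaled N (r j) y * hermiteScaled N (r k) y) := fun y => by
    rw [sq, Finset.sum_mul_sum]
    exact Finset.sum_congr rfl fun j _ => Finset.sum_congr rfl fun k _ => by ring
  simp only [e]
  have hi' : ∀ j, Integrable fun y => ∑ k ∈ Finset.range M,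
      u j * u k * (hermiteScaled N (r j) y * hermiteScaled N (r k) y) := fun j =>
    integrable_finsetSum _ fun k _ => (hi _ _).const_mul _
  refine ⟨integrable_finsetSum _ fun j _ => hi' j, ?_⟩
  rw [integral_finsetSum _ fun j _ => hi' j]
  refine Finset.sum_congr rfl fun j hj => ?_
  rw [integral_finsetSum _ fun k _ => (hi _ _).const_mul _]
  simp only [integral_const_mul, hermiteScaled_orthonormal hN, hr.eq_iff]
  rw [Finset.sum_eq_single j (fun k _ hk => by simp [hk.symm]) (fun h => absurd hj h)]
  simp [sq]

/-- Coefficients that decrease from a constant below the cut to zero above `M`. -/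
structure IsCutoff (N C : ℝ) (b : ℕ → ℝ) (M : ℕ) : Prop where
  antitone : Antitone b
  le_one : ∀ k, b k ≤ 1
  zero : ∀ k, M ≤ k → b k = 0
  const : ∀ k < cut N, b k = b (k + 1)
  mul_le : ∀ k : ℕ, k * b k ≤ C * N

namespace IsCutoff

variable {N C : ℝ} {b : ℕ → ℝ} {M : ℕ} (h : IsCutoff N C b M)
include h

theorem nonneg (k : ℕ) : 0 ≤ b k := by
  rw [← h.zero (max k M) (le_max_right _ _)]
  exact h.antitone (le_max_left _ _)

theorem diff_nonneg (k : ℕ) : 0 ≤ b k - b (k + 1) := sub_nonneg.2 (h.antitone k.le_succ)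

theorem sum_diff_le : ∑ k ∈ Finset.range M, (b k - b (k + 1)) ≤ 1 := by
  rw [Finset.sum_range_sub']
  linarith [h.le_one 0, h.nonneg M]

theorem expansion (x y : ℝ) : scale N * (x - y) * partialKernel N b M x y
    = ∑ k ∈ Finset.range M, (b k - b (k + 1)) * christoffel N (k + 1) x y := by
  rw [scale_mul_sub_mul_partialKernel, h.zero M le_rfl, zero_mul, zero_add]

/-- Constancy below the cut leaves only indices with pointwise bounds. There each
Christoffel–Darboux term is at most √k · 2 · (2 scale/√k) = 4 scale, and the increments of b sum to
at most 1. -/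
theorem abs_mul_partialKernel_le (hN : 0 < N) {x y : ℝ} (hx : |x| ≤ 1 / 5) (hy : |y| ≤ 1 / 5) :
    |(x - y) * partialKernel N b M x y| ≤ 4 := by
  have hc := scale_pos hN
  have key : ∀ k ∈ Finset.range M, |(b k - b (k + 1)) * christoffel N (k + 1) x y|
      ≤ (b k - b (k + 1)) * (4 * scale N) := by
    intro k _
    rcases lt_or_ge k (cut N) with hk | hk
    · rw [h.const k hk]; simp
    rw [abs_mul, abs_of_nonneg (h.diff_nonneg k)]
    refine mul_le_mul_of_nonneg_left ?_ (h.diff_nonneg k)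
    have hk1 : 1 ≤ k := (cut_pos hN).trans_le hk
    have hk1' : (1 : ℝ) ≤ k := by exact_mod_cast hk1
    have hs : 0 < √(k : ℝ) := Real.sqrt_pos.2 (by linarith)
    set B := 2 * scale N / √(k : ℝ) with hB
    have hB0 : 0 ≤ B := by positivity
    have b1 : ∀ z, |z| ≤ 1 / 5 → |hermiteScaled N k z| ≤ √B := fun z hz =>
      Real.abs_le_sqrt (hermiteScaled_sq_le hk1 (scaled_endpoint_le hN hk hz))
    have b2 : ∀ z, |z| ≤ 1 / 5 → |hermiteScaled N (k + 1) z| ≤ √B := fun z hz => by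
      refine Real.abs_le_sqrt ((hermiteScaled_sq_le (by omega)
        (scaled_endpoint_le hN (hk.trans k.le_succ) hz)).trans ?_)
      rw [hB]
      gcongr
      exact k.le_succ
    have b3 : |hermiteScaled N (k + 1) x * hermiteScaled N k y
        - hermiteScaled N k x * hermiteScaled N (k + 1) y| ≤ B + B := by
      refine (abs_sub _ _).trans (add_le_add ?_ ?_)
      · rw [abs_mul, ← Real.mul_self_sqrt hB0]
        exact mul_le_mul (b2 x hx) (b1 y hy) (abs_nonneg _) (Real.sqrt_nonneg _)
      · rw [abs_mul, ← Real.mul_self_sqrt hB0]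
        exact mul_le_mul (b1 x hx) (b2 y hy) (abs_nonneg _) (Real.sqrt_nonneg _)
    have b4 : jac (k + 1) ≤ √k := Real.sqrt_le_sqrt (by push_cast; linarith)
    simp only [christoffel, Nat.add_sub_cancel]
    rw [abs_mul, abs_of_nonneg (jac_nonneg _)]
    calc _ ≤ √(k : ℝ) * (B + B) := mul_le_mul b4 b3 (abs_nonneg _) hs.le
      _ = 4 * scale N := by rw [hB]; field_simp; ring
  have h1 := (Finset.abs_sum_le_sum_abs _ _).trans (Finset.sum_le_sum key)
  rw [← h.expansion, ← Finset.sum_mul, mul_assoc, abs_mul, abs_of_pos hc] at h1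
  have h2 := mul_le_mul_of_nonneg_right h.sum_diff_le (mul_nonneg (by norm_num : (0 : ℝ) ≤ 4) hc.le)
  refine le_of_mul_le_mul_left (h1.trans (h2.trans (le_of_eq ?_))) hc
  ring

/-- For fixed x the Christoffel–Darboux sum is an expansion in y along orthonormal functions, so
Parseval applies. The bound k b_k ≤ CN absorbs the growth of `jac (k + 1) ^ 2`. -/
theorem lintegral_mul_partialKernel_le (hN : 0 < N) {x : ℝ} (hx : |x| ≤ 1 / 5) :
    ∫⁻ y, ENNReal.ofReal (((x - y) * partialKernel N b M x y) ^ 2) ≤ ENNReal.ofReal (12 * C) := by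
  have hc := scale_pos hN
  set d : ℕ → ℝ := fun k => (b k - b (k + 1)) * jac (k + 1) with hd
  obtain ⟨i1, e1⟩ := integral_sum_hermiteScaled_sq hN
    (fun k => d k * hermiteScaled N (k + 1) x) id Function.injective_id M
  obtain ⟨i2, e2⟩ := integral_sum_hermiteScaled_sq hN
    (fun k => d k * hermiteScaled N k x) (· + 1) (add_left_injective 1) M
  have hle : ∀ y, ((x - y) * partialKernel N b M x y) ^ 2 ≤ 2 / scale N ^ 2 *
      ((∑ k ∈ Finset.range M, d k * hermiteScaled N (k + 1) x * hermiteScaled N (id k) y) ^ 2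
      + (∑ k ∈ Finset.range M, d k * hermiteScaled N k x * hermiteScaled N (k + 1) y) ^ 2) := by
    intro y
    have h1 : scale N * ((x - y) * partialKernel N b M x y)
        = (∑ k ∈ Finset.range M, d k * hermiteScaled N (k + 1) x * hermiteScaled N (id k) y)
        - (∑ k ∈ Finset.range M, d k * hermiteScaled N k x * hermiteScaled N (k + 1) y) := by
      rw [← mul_assoc, h.expansion, ← Finset.sum_sub_distrib]
      refine Finset.sum_congr rfl fun k _ => ?_
      simp only [christoffel, Nat.add_sub_cancel, hd, id]
      ring
    have h2 : (x - y) * partialKernel N b M x y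
        = (scale N * ((x - y) * partialKernel N b M x y)) / scale N := by field_simp
    rw [h2, h1, div_pow, div_mul_eq_mul_div]
    gcongr
    exact (fun A B : ℝ => by nlinarith [sq_nonneg (A + B)] :
      ∀ A B : ℝ, (A - B) ^ 2 ≤ 2 * (A ^ 2 + B ^ 2)) _ _
  have hi : Integrable fun y => 2 / scale N ^ 2 *
      ((∑ k ∈ Finset.range M, d k * hermiteScaled N (k + 1) x * hermiteScaled N (id k) y) ^ 2
      + (∑ k ∈ Finset.range M, d k * hermiteScaled N k x * hermiteScaled N (k + 1) y) ^ 2) :=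
    (i1.add i2).const_mul (2 / scale N ^ 2)
  refine (lintegral_mono fun y => ENNReal.ofReal_le_ofReal (hle y)).trans ?_
  rw [← ofReal_integral_eq_lintegral_ofReal hi (ae_of_all _ fun y => by positivity)]
  refine ENNReal.ofReal_le_ofReal ?_
  rw [integral_const_mul, integral_add i1 i2, e1, e2, ← Finset.sum_add_distrib]
  have hkey : ∀ k ∈ Finset.range M, (d k * hermiteScaled N (k + 1) x) ^ 2
      + (d k * hermiteScaled N k x) ^ 2 ≤ (b k - b (k + 1)) * (24 * (C * N)) := by
    intro k _
    rcases lt_or_ge k (cut N) with hk | hk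
    · simp only [hd, h.const k hk]; simp
    have f1 := hermiteScaled_sq_le_of_cut_le hN hk hx
    have f2 := hermiteScaled_sq_le_of_cut_le hN (hk.trans k.le_succ) hx
    have hk1 : 1 ≤ k := (cut_pos hN).trans_le hk
    have hk1' : (1 : ℝ) ≤ k := by exact_mod_cast hk1
    have g0 := h.diff_nonneg k
    have g1 : (b k - b (k + 1)) * jac (k + 1) ^ 2 ≤ C * N := by
      refine le_trans ?_ (h.mul_le k)
      rw [jac_sq, mul_comm]
      push_cast
      refine mul_le_mul (by linarith) (by linarith [h.nonneg (k + 1)]) g0 (by linarith)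
    have g2 : 0 ≤ C * N := (mul_nonneg g0 (sq_nonneg _)).trans g1
    calc (d k * hermiteScaled N (k + 1) x) ^ 2 + (d k * hermiteScaled N k x) ^ 2
        = (b k - b (k + 1)) * ((hermiteScaled N (k + 1) x ^ 2 + hermiteScaled N k x ^ 2) *
          ((b k - b (k + 1)) * jac (k + 1) ^ 2)) := by simp only [hd]; ring
      _ ≤ (b k - b (k + 1)) * (24 * (C * N)) := by
        refine mul_le_mul_of_nonneg_left (mul_le_mul (by linarith) g1 (by positivity)
          (by norm_num)) g0
  have hCN : 0 ≤ C * N := by have := h.mul_le 0; simpa using this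
  have h1 := Finset.sum_le_sum hkey
  rw [← Finset.sum_mul] at h1
  have h2 := mul_le_mul_of_nonneg_right h.sum_diff_le (mul_nonneg (by norm_num : (0 : ℝ) ≤ 24) hCN)
  rw [scale_sq hN.le]
  have h3 : (9 : ℝ) ≤ Real.pi ^ 2 := by nlinarith [Real.pi_gt_three]
  have h4 : 2 / (Real.pi ^ 2 / 2 * N) ≤ 1 / (2 * N) := by
    rw [div_le_div_iff₀ (by positivity) (by positivity)]
    nlinarith
  calc _ ≤ 1 / (2 * N) * (1 * (24 * (C * N))) :=
        mul_le_mul h4 (h1.trans h2) (Finset.sum_nonneg fun k _ => by positivity) (by positivity)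
    _ = 12 * C := by field_simp; ring

end IsCutoff

end Christoffel

/-! ### The off-diagonal part as a Dirichlet integral, bounded by the H^{1/2} seminorm. -/

section Dirichlet

theorem integrable_mul_hermiteScaled_mul {g : ℝ → ℝ} (hg : Integrable g) (N : ℝ) (j k : ℕ) :
    Integrable fun x => g x * (hermiteScaled N j x * hermiteScaled N k x) := by
  refine hg.mul_bdd (c := scale N * (2 * jac (j + 1)) + scale N * (2 * jac (k + 1)))
    ((continuous_hermiteScaled N j).mul (continuous_hermiteScaled N k)).aestronglyMeasurable
    (ae_of_all _ fun x => ?_)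
  have h1 := hermiteScaled_sq_le_jac N j x
  have h2 := hermiteScaled_sq_le_jac N k x
  rw [Real.norm_eq_abs, abs_le]
  constructor <;> nlinarith [sq_nonneg (hermiteScaled N j x + hermiteScaled N k x),
    sq_nonneg (hermiteScaled N j x - hermiteScaled N k x), sq_nonneg (hermiteScaled N j x),
    sq_nonneg (hermiteScaled N k x)]

/-- Half of the Dirichlet integral `∬ (f x - f y) ^ 2 K x y ^ 2` of the kernel `K` with
eigenvalues `b 0, …, b (M - 1)`. -/
def offDiagonal (f : ℝ → ℝ) (N : ℝ) (b : ℕ → ℝ) (M : ℕ) : ℝ :=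
  ∑ k ∈ Finset.range M, b k ^ 2 * (∫ x, f x ^ 2 * hermiteScaled N k x ^ 2)
    - ∑ j ∈ Finset.range M, ∑ k ∈ Finset.range M,
      b j * b k * (∫ x, f x * (hermiteScaled N j x * hermiteScaled N k x)) ^ 2

variable {f : ℝ → ℝ} {N : ℝ}

/-- Expanding both squares and integrating, orthonormality leaves only j = k in the two terms with
f². The representation as a square gives positivity and, below, subadditivity up to a factor 2. -/
theorem integral_offDiagonal (hf : Integrable f) (hf2 : Integrable fun x => f x ^ 2) (hN : 0 < N)
    (b : ℕ → ℝ) (M : ℕ) :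
    Integrable (fun z : ℝ × ℝ => (f z.1 - f z.2) ^ 2 * partialKernel N b M z.1 z.2 ^ 2) ∧
    ∫ z : ℝ × ℝ, (f z.1 - f z.2) ^ 2 * partialKernel N b M z.1 z.2 ^ 2
      = 2 * offDiagonal f N b M := by
  set u : ℕ → ℕ → ℝ → ℝ := fun j k x => hermiteScaled N j x * hermiteScaled N k x with hu
  have ui : ∀ j k, Integrable (u j k) := fun j k =>
    (memLp_hermiteScaled hN j).integrable_mul (memLp_hermiteScaled hN k)
  have fi : ∀ j k, Integrable fun x => f x * u j k x := fun j k =>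
    integrable_mul_hermiteScaled_mul hf N j k
  have f2i : ∀ j k, Integrable fun x => f x ^ 2 * u j k x := fun j k =>
    integrable_mul_hermiteScaled_mul hf2 N j k
  have i1 : ∀ j k, Integrable fun z : ℝ × ℝ => (f z.1 ^ 2 * u j k z.1) * u j k z.2 := fun j k =>
    (f2i j k).mul_prod (ui j k)
  have i2 : ∀ j k, Integrable fun z : ℝ × ℝ => u j k z.1 * (f z.2 ^ 2 * u j k z.2) := fun j k =>
    (ui j k).mul_prod (f2i j k)
  have i3 : ∀ j k, Integrable fun z : ℝ × ℝ => 2 * ((f z.1 * u j k z.1) * (f z.2 * u j k z.2)) :=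
    fun j k => ((fi j k).mul_prod (fi j k)).const_mul 2
  have i12 : ∀ j k, Integrable fun z : ℝ × ℝ => (f z.1 ^ 2 * u j k z.1) * u j k z.2
      + u j k z.1 * (f z.2 ^ 2 * u j k z.2) := fun j k => (i1 j k).add (i2 j k)
  set G : ℕ → ℕ → ℝ × ℝ → ℝ := fun j k z => b j * b k * ((f z.1 ^ 2 * u j k z.1) * u j k z.2
      + u j k z.1 * (f z.2 ^ 2 * u j k z.2)
      - 2 * ((f z.1 * u j k z.1) * (f z.2 * u j k z.2))) with hG
  have iG : ∀ j k, Integrable (G j k) := fun j k => ((i12 j k).sub (i3 j k)).const_mul _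
  have eG : ∀ j k, ∫ z, G j k z = b j * b k * (2 * ((∫ x, f x ^ 2 * u j k x) *
      (if j = k then 1 else 0)) - 2 * (∫ x, f x * u j k x) ^ 2) := by
    intro j k
    have o : ∫ x, u j k x = if j = k then 1 else 0 := hermiteScaled_orthonormal hN j k
    simp only [hG]
    rw [integral_const_mul, integral_sub (i12 j k) (i3 j k), integral_add (i1 j k) (i2 j k),
      integral_const_mul, Measure.volume_eq_prod,
      integral_prod_mul (fun x => f x ^ 2 * u j k x) (u j k),
      integral_prod_mul (u j k) (fun x => f x ^ 2 * u j k x),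
      integral_prod_mul (fun x => f x * u j k x) (fun x => f x * u j k x), o]
    ring
  have eF : ∀ z : ℝ × ℝ, (f z.1 - f z.2) ^ 2 * partialKernel N b M z.1 z.2 ^ 2
      = ∑ j ∈ Finset.range M, ∑ k ∈ Finset.range M, G j k z := by
    intro z
    rw [sq (partialKernel N b M z.1 z.2), partialKernel, Finset.sum_mul_sum, Finset.mul_sum]
    refine Finset.sum_congr rfl fun j _ => ?_
    rw [Finset.mul_sum]
    refine Finset.sum_congr rfl fun k _ => ?_
    simp only [hG, hu]
    ring
  simp only [eF]
  have iG' : ∀ j, Integrable fun z => ∑ k ∈ Finset.range M, G j k z := fun j =>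
    integrable_finsetSum _ fun k _ => iG j k
  refine ⟨integrable_finsetSum _ fun j _ => iG' j, ?_⟩
  rw [integral_finsetSum _ fun j _ => iG' j, offDiagonal, ← Finset.sum_sub_distrib, Finset.mul_sum]
  refine Finset.sum_congr rfl fun j hj => ?_
  rw [integral_finsetSum _ fun k _ => iG j k]
  simp only [eG, mul_sub, Finset.sum_sub_distrib]
  congr 1
  · rw [Finset.sum_eq_single j (fun k _ hk => by simp [hk.symm]) (fun h => absurd hj h)]
    simp only [hu, if_true, ← sq]
    ring
  · rw [Finset.mul_sum]
    exact Finset.sum_congr rfl fun k _ => by simp only [hu]; ring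

theorem offDiagonal_nonneg (hf : Integrable f) (hf2 : Integrable fun x => f x ^ 2) (hN : 0 < N)
    (b : ℕ → ℝ) (M : ℕ) : 0 ≤ offDiagonal f N b M := by
  have h := (integral_offDiagonal hf hf2 hN b M).2
  have : 0 ≤ ∫ z : ℝ × ℝ, (f z.1 - f z.2) ^ 2 * partialKernel N b M z.1 z.2 ^ 2 :=
    integral_nonneg fun z => by positivity
  linarith

theorem offDiagonal_le_diagonal {b : ℕ → ℝ} (hb : ∀ k, 0 ≤ b k) (M : ℕ) :
    offDiagonal f N b M
      ≤ ∑ k ∈ Finset.range M, b k ^ 2 * (∫ x, f x ^ 2 * hermiteScaled N k x ^ 2) :=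
  sub_le_self _ (Finset.sum_nonneg fun j _ => Finset.sum_nonneg fun k _ =>
    mul_nonneg (mul_nonneg (hb j) (hb k)) (sq_nonneg _))

theorem offDiagonal_congr {b c : ℕ → ℝ} {M : ℕ} (h : ∀ k < M, b k = c k) :
    offDiagonal f N b M = offDiagonal f N c M := by
  unfold offDiagonal
  congr 1
  · exact Finset.sum_congr rfl fun k hk => by rw [h k (Finset.mem_range.1 hk)]
  · exact Finset.sum_congr rfl fun j hj => Finset.sum_congr rfl fun k hk => by
      rw [h k (Finset.mem_range.1 hk), h j (Finset.mem_range.1 hj)]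

theorem offDiagonal_add_le (hf : Integrable f) (hf2 : Integrable fun x => f x ^ 2) (hN : 0 < N)
    (b c : ℕ → ℝ) (M : ℕ) : offDiagonal f N (fun k => b k + c k) M
      ≤ 2 * offDiagonal f N b M + 2 * offDiagonal f N c M := by
  obtain ⟨i, e⟩ := integral_offDiagonal hf hf2 hN (fun k => b k + c k) M
  obtain ⟨i1, e1⟩ := integral_offDiagonal hf hf2 hN b M
  obtain ⟨i2, e2⟩ := integral_offDiagonal hf hf2 hN c M
  have h := integral_mono i ((i1.const_mul 2).add (i2.const_mul 2)) fun z => by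
    have : partialKernel N (fun k => b k + c k) M z.1 z.2
        = partialKernel N b M z.1 z.2 + partialKernel N c M z.1 z.2 := by
      simp only [partialKernel, ← Finset.sum_add_distrib, add_mul]
    simp only [Pi.add_apply, this]
    nlinarith [mul_nonneg (sq_nonneg (f z.1 - f z.2))
      (sq_nonneg (partialKernel N b M z.1 z.2 - partialKernel N c M z.1 z.2))]
  rw [e] at h
  have h2 := integral_add (i1.const_mul 2) (i2.const_mul 2)
  rw [integral_const_mul, integral_const_mul, e1, e2] at h2
  have h3 := h.trans h2.le
  linarith

/-- The Gagliardo seminorm. -/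
def gagliardo (f : ℝ → ℝ) : ℝ≥0∞ :=
  ∫⁻ x : ℝ, ∫⁻ y : ℝ, ENNReal.ofReal (((f x - f y) / (x - y)) ^ 2)

/-- If both points lie in [-1/5, 1/5], the bound |(x - y) K| ≤ 4 gives the Gagliardo integrand times
16. Otherwise one value of f vanishes, and the other point matters only if it is at distance at
least 1/10, where K² ≤ 100 ((x - y) K)². -/
theorem IsCutoff.dirichlet_le {C : ℝ} {b : ℕ → ℝ} {M : ℕ} (h : IsCutoff N C b M) (hN : 0 < N)
    (hs : ∀ x, x ∉ Set.Icc (-(1 / 10)) (1 / 10) → f x = 0) (x y : ℝ) :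
    (f x - f y) ^ 2 * partialKernel N b M x y ^ 2 ≤ 16 * ((f x - f y) / (x - y)) ^ 2
      + 100 * (f x ^ 2 * ((x - y) * partialKernel N b M x y) ^ 2)
      + 100 * (f y ^ 2 * ((y - x) * partialKernel N b M y x) ^ 2) := by
  have hfar : ∀ x y : ℝ, 1 / 5 < |y| → f x ^ 2 * partialKernel N b M x y ^ 2
      ≤ 100 * (f x ^ 2 * ((x - y) * partialKernel N b M x y) ^ 2) := by
    intro x y hy
    by_cases hx : x ∈ Set.Icc (-(1 / 10) : ℝ) (1 / 10)
    · have h1 : (1 / 10 : ℝ) ≤ |x - y| := by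
        have := abs_le.2 hx
        have := abs_sub_abs_le_abs_sub y x
        rw [abs_sub_comm y x] at this
        linarith
      have h2 : 1 ≤ 100 * (x - y) ^ 2 := by
        rw [← sq_abs]
        nlinarith [abs_nonneg (x - y)]
      rw [mul_pow]
      have := mul_le_mul_of_nonneg_right h2
        (by positivity : 0 ≤ f x ^ 2 * partialKernel N b M x y ^ 2)
      linarith
    · rw [hs x hx]; simp
  have hz : ∀ y : ℝ, 1 / 5 < |y| → f y = 0 := fun y hy => hs y fun hy' => by
    have := abs_le.2 hy'
    linarith
  have p1 : 0 ≤ 16 * ((f x - f y) / (x - y)) ^ 2 := by positivity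
  have p2 : 0 ≤ 100 * (f x ^ 2 * ((x - y) * partialKernel N b M x y) ^ 2) := by positivity
  have p3 : 0 ≤ 100 * (f y ^ 2 * ((y - x) * partialKernel N b M y x) ^ 2) := by positivity
  by_cases hx : |x| ≤ 1 / 5
  · by_cases hy : |y| ≤ 1 / 5
    · rcases eq_or_ne x y with rfl | hxy
      · simp
      have h1 := h.abs_mul_partialKernel_le hN hx hy
      have h2 : ((x - y) * partialKernel N b M x y) ^ 2 ≤ 4 ^ 2 := sq_le_sq.2 (by
        rw [abs_of_pos (four_pos : (0 : ℝ) < 4)]; exact h1)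
      have h3 : x - y ≠ 0 := sub_ne_zero.2 hxy
      have h4 : (f x - f y) ^ 2 * partialKernel N b M x y ^ 2
          = ((f x - f y) / (x - y)) ^ 2 * ((x - y) * partialKernel N b M x y) ^ 2 := by
        field_simp
      have h5 := mul_le_mul_of_nonneg_left h2 (sq_nonneg ((f x - f y) / (x - y)))
      linarith
    · have := hfar x y (not_le.1 hy)
      rw [hz y (not_le.1 hy)] at p1 p3 ⊢
      rw [sub_zero] at p1 ⊢
      linarith
  · have := hfar y x (not_le.1 hx)
    rw [hz x (not_le.1 hx)] at p1 p2 ⊢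
    rw [zero_sub, neg_sq, partialKernel_comm N b M x y] at *
    linarith

theorem lintegral_mul_far_le {C : ℝ} {b : ℕ → ℝ} {M : ℕ} (h : IsCutoff N C b M) (hN : 0 < N)
    (hf2 : Integrable fun x => f x ^ 2)
    (hs : ∀ x, x ∉ Set.Icc (-(1 / 10)) (1 / 10) → f x = 0) :
    ∫⁻ x, ∫⁻ y, ENNReal.ofReal (100 * (f x ^ 2 * ((x - y) * partialKernel N b M x y) ^ 2))
      ≤ ENNReal.ofReal (1200 * C * ∫ x, f x ^ 2) := by
  have hC : 0 ≤ C := by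
    have := h.mul_le 0
    simp only [CharP.cast_eq_zero, zero_mul] at this
    exact nonneg_of_mul_nonneg_left this hN
  have key : ∀ x, ∫⁻ y, ENNReal.ofReal (100 * (f x ^ 2 * ((x - y) * partialKernel N b M x y) ^ 2))
      ≤ ENNReal.ofReal (1200 * C * f x ^ 2) := by
    intro x
    by_cases hx : x ∈ Set.Icc (-(1 / 10) : ℝ) (1 / 10)
    · have h1 : |x| ≤ 1 / 5 := (abs_le.2 hx).trans (by norm_num)
      have e : ∀ y, ENNReal.ofReal (100 * (f x ^ 2 * ((x - y) * partialKernel N b M x y) ^ 2))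
          = ENNReal.ofReal (100 * f x ^ 2) *
            ENNReal.ofReal (((x - y) * partialKernel N b M x y) ^ 2) := fun y => by
        rw [← ENNReal.ofReal_mul (by positivity), mul_assoc]
      simp only [e]
      rw [lintegral_const_mul' _ _ ENNReal.ofReal_ne_top]
      refine (mul_le_mul_right (h.lintegral_mul_partialKernel_le hN h1) _).trans (le_of_eq ?_)
      rw [← ENNReal.ofReal_mul (by positivity)]
      congr 1
      ring
    · simp [hs x hx]
  refine (lintegral_mono key).trans (le_of_eq ?_)
  rw [← integral_const_mul, ofReal_integral_eq_lintegral_ofReal (hf2.const_mul _)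
    (ae_of_all _ fun x => by positivity)]

theorem IsCutoff.offDiagonal_le {C : ℝ} {b : ℕ → ℝ} {M : ℕ} (h : IsCutoff N C b M) (hN : 0 < N)
    (hfm : Measurable f) (hf : Integrable f) (hf2 : Integrable fun x => f x ^ 2)
    (hs : ∀ x, x ∉ Set.Icc (-(1 / 10)) (1 / 10) → f x = 0) (hg : gagliardo f ≠ ∞) :
    offDiagonal f N b M ≤ 8 * (gagliardo f).toReal + 1200 * C * ∫ x, f x ^ 2 := by
  have hC : 0 ≤ C := by
    have := h.mul_le 0
    simp only [CharP.cast_eq_zero, zero_mul] at this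
    exact nonneg_of_mul_nonneg_left this hN
  have hI : 0 ≤ 1200 * C * ∫ x, f x ^ 2 :=
    mul_nonneg (by positivity) (integral_nonneg fun _ => sq_nonneg _)
  obtain ⟨i, e⟩ := integral_offDiagonal hf hf2 hN b M
  have hK : Measurable fun z : ℝ × ℝ => partialKernel N b M z.1 z.2 :=
    (continuous_partialKernel N b M).measurable
  have m1 : Measurable fun z : ℝ × ℝ => ENNReal.ofReal (16 * ((f z.1 - f z.2) / (z.1 - z.2)) ^ 2) := by
    fun_prop
  have m2 : Measurable fun z : ℝ × ℝ =>
      ENNReal.ofReal (100 * (f z.1 ^ 2 * ((z.1 - z.2) * partialKernel N b M z.1 z.2) ^ 2)) := by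
    fun_prop
  have m3 : Measurable fun z : ℝ × ℝ =>
      ENNReal.ofReal (100 * (f z.2 ^ 2 * ((z.2 - z.1) * partialKernel N b M z.2 z.1) ^ 2)) :=
    m2.comp measurable_swap
  have b1 : ENNReal.ofReal (2 * offDiagonal f N b M)
      ≤ 16 * gagliardo f + 2 * ENNReal.ofReal (1200 * C * ∫ x, f x ^ 2) := by
    rw [← e, ofReal_integral_eq_lintegral_ofReal i (ae_of_all _ fun z => by positivity)]
    calc _ ≤ ∫⁻ z : ℝ × ℝ, (ENNReal.ofReal (16 * ((f z.1 - f z.2) / (z.1 - z.2)) ^ 2)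
          + ENNReal.ofReal (100 * (f z.1 ^ 2 * ((z.1 - z.2) * partialKernel N b M z.1 z.2) ^ 2))
          + ENNReal.ofReal (100 * (f z.2 ^ 2 * ((z.2 - z.1) * partialKernel N b M z.2 z.1) ^ 2))) := by
          refine lintegral_mono fun z => ?_
          rw [← ENNReal.ofReal_add (by positivity) (by positivity),
            ← ENNReal.ofReal_add (by positivity) (by positivity)]
          exact ENNReal.ofReal_le_ofReal (h.dirichlet_le hN hs z.1 z.2)
      _ = (∫⁻ z : ℝ × ℝ, ENNReal.ofReal (16 * ((f z.1 - f z.2) / (z.1 - z.2)) ^ 2))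
          + (∫⁻ z : ℝ × ℝ, ENNReal.ofReal
            (100 * (f z.1 ^ 2 * ((z.1 - z.2) * partialKernel N b M z.1 z.2) ^ 2)))
          + ∫⁻ z : ℝ × ℝ, ENNReal.ofReal
            (100 * (f z.2 ^ 2 * ((z.2 - z.1) * partialKernel N b M z.2 z.1) ^ 2)) := by
          have m12 : Measurable fun z : ℝ × ℝ =>
              ENNReal.ofReal (16 * ((f z.1 - f z.2) / (z.1 - z.2)) ^ 2)
              + ENNReal.ofReal (100 * (f z.1 ^ 2 *
                ((z.1 - z.2) * partialKernel N b M z.1 z.2) ^ 2)) := m1.add m2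
          rw [lintegral_add_left m12, lintegral_add_left m1]
      _ ≤ 16 * gagliardo f + ENNReal.ofReal (1200 * C * ∫ x, f x ^ 2)
          + ENNReal.ofReal (1200 * C * ∫ x, f x ^ 2) := by
          refine add_le_add (add_le_add (le_of_eq ?_) ?_) ?_
          · rw [Measure.volume_eq_prod, lintegral_prod _ m1.aemeasurable, gagliardo,
              ← lintegral_const_mul' _ _ (by norm_num)]
            refine lintegral_congr fun x => ?_
            rw [← lintegral_const_mul' _ _ (by norm_num)]
            refine lintegral_congr fun y => ?_
            rw [ENNReal.ofReal_mul (by norm_num)]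
            norm_num
          · rw [Measure.volume_eq_prod, lintegral_prod _ m2.aemeasurable]
            exact lintegral_mul_far_le h hN hf2 hs
          · rw [Measure.volume_eq_prod, lintegral_prod_symm _ m3.aemeasurable]
            exact lintegral_mul_far_le h hN hf2 hs
      _ = _ := by rw [add_assoc, ← two_mul]
  generalize (1200 * C * ∫ x, f x ^ 2) = J at b1 hI ⊢
  have b2 : 16 * gagliardo f + 2 * ENNReal.ofReal J
      = ENNReal.ofReal (16 * (gagliardo f).toReal + 2 * J) := by
    rw [ENNReal.ofReal_add (by positivity) (by positivity), ENNReal.ofReal_mul (by norm_num : (0 : ℝ) ≤ 16),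
      ENNReal.ofReal_toReal hg, ENNReal.ofReal_mul (by norm_num : (0 : ℝ) ≤ 2)]
    norm_num
  rw [b2, ENNReal.ofReal_le_ofReal_iff (by positivity)] at b1
  linarith

end Dirichlet

/-! ### Decomposition and error bound for the variance. -/

section Variance

theorem lintegral_comp_mul_right (g : ℝ → ℝ≥0∞) {a : ℝ} (ha : 0 < a) :
    ∫⁻ x, g (x * a) = ENNReal.ofReal a⁻¹ * ∫⁻ x, g x := by
  have e : MeasurableEmbedding fun x : ℝ => x * a :=
    (Homeomorph.mulRight₀ a ha.ne').measurableEmbedding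
  rw [← e.lintegral_map, Real.map_volume_mul_right ha.ne', lintegral_smul_measure,
    abs_of_pos (inv_pos.2 ha), smul_eq_mul]

/-- In dimension one the two Jacobians cancel the factor a² from the squared difference quotient.
This invariance keeps the H^{1/2} contribution of the off-diagonal part bounded in N. -/
theorem gagliardo_comp_mul (f : ℝ → ℝ) {a : ℝ} (ha : 0 < a) :
    gagliardo (fun x => f (x * a)) = gagliardo f := by
  have h1 : ∀ x, ∫⁻ y, ENNReal.ofReal (((f (x * a) - f (y * a)) / (x - y)) ^ 2)
      = ENNReal.ofReal a * ∫⁻ y, ENNReal.ofReal (((f (x * a) - f y) / (x * a - y)) ^ 2) := by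
    intro x
    have e : ∀ y, ENNReal.ofReal (((f (x * a) - f (y * a)) / (x - y)) ^ 2)
        = ENNReal.ofReal (a ^ 2) *
          ENNReal.ofReal (((f (x * a) - f (y * a)) / (x * a - y * a)) ^ 2) := fun y => by
      rw [← ENNReal.ofReal_mul (sq_nonneg a), ← mul_pow, ← sub_mul, mul_div, mul_comm a,
        mul_div_mul_right _ _ ha.ne']
    simp only [e]
    rw [lintegral_const_mul' _ _ ENNReal.ofReal_ne_top, lintegral_comp_mul_right
      (fun y => ENNReal.ofReal (((f (x * a) - f y) / (x * a - y)) ^ 2)) ha, ← mul_assoc,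
      ← ENNReal.ofReal_mul (sq_nonneg a)]
    congr 2
    field_simp
  unfold gagliardo
  simp only [h1]
  rw [lintegral_const_mul' _ _ ENNReal.ofReal_ne_top, lintegral_comp_mul_right
    (fun x => ∫⁻ y, ENNReal.ofReal (((f x - f y) / (x - y)) ^ 2)) ha, ← mul_assoc,
    ← ENNReal.ofReal_mul ha.le, mul_inv_cancel₀ ha.ne', ENNReal.ofReal_one, one_mul]

variable {Ψ : ℝ → ℝ} (hΨ : IsShape Ψ) {τ α : ℝ} (hτ : 0 < τ)
include hΨ hτ

/-- For k ≤ 2N this is p_k ≤ 1; beyond, k ≤ 2(k - N), and t Ψ(t) is bounded for t ≥ 0. -/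
theorem exists_mul_eig_le (hα1 : α < 1) :
    ∃ C, 0 ≤ C ∧ ∀ N : ℝ, 1 ≤ N → ∀ k : ℕ, k * eig Ψ τ α N k ≤ C * N := by
  obtain ⟨C, hC0, hC⟩ := exists_mul_le_of_antitone hΨ.antitone hΨ.nonneg hΨ.integrable_right
  refine ⟨2 + 2 * C * τ, by positivity, fun N hN k => ?_⟩
  have hN0 : 0 < N := by linarith
  have hp := Real.rpow_pos_of_pos hN0 α
  have hT : 0 < τ * N ^ α := mul_pos hτ hp
  have h0 : 0 ≤ eig Ψ τ α N k := hΨ.nonneg _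
  have h1 : eig Ψ τ α N k ≤ 1 := hΨ.le_one _
  have h2 : 0 ≤ 2 * C * τ * N := by positivity
  rcases le_or_gt (k : ℝ) (2 * N) with hk | hk
  · have := mul_le_mul hk h1 h0 (by positivity)
    linarith
  · have h3 := hC ((k - N) / (τ * N ^ α)) (div_nonneg (by linarith) hT.le)
    rw [div_mul_eq_mul_div, div_le_iff₀ hT] at h3
    have h4 : N ^ α ≤ N := by
      simpa using Real.rpow_le_rpow_of_exponent_le hN hα1.le
    have h5 : C * (τ * N ^ α) ≤ C * (τ * N) := by gcongr
    have h6 : k * eig Ψ τ α N k ≤ 2 * ((k - N) * eig Ψ τ α N k) := by nlinarith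
    have h7 : (k - N) * eig Ψ τ α N k ≤ C * (τ * N) := h3.trans h5
    nlinarith

variable {N : ℝ}

/-- Replacing the index by its maximum with the cut flattens the eigenvalues below the cut; the
truncation at M supplies the zero tail. -/
theorem isCutoff_eig (hN : 0 < N) {C : ℝ} (hC0 : 0 ≤ C)
    (hC : ∀ k : ℕ, k * eig Ψ τ α N k ≤ C * N) {M : ℕ} (hM : cut N < M) :
    IsCutoff N C (fun k => if k < M then eig Ψ τ α N (max k (cut N)) else 0) M where
  antitone j k hjk := by
    beta_reduce
    split_ifs with h1 h2 h2
    · exact hΨ.eig_antitone hτ hN (max_le_max_right _ hjk)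
    · omega
    · exact hΨ.nonneg _
    · exact le_rfl
  le_one k := by
    split_ifs
    · exact hΨ.le_one _
    · exact zero_le_one
  zero k hk := by simp [not_lt.2 hk]
  const k hk := by
    rw [if_pos (by omega), if_pos (by omega), max_eq_right hk.le, max_eq_right hk]
  mul_le k := by
    split_ifs
    · refine le_trans ?_ (hC (max k (cut N)))
      refine mul_le_mul_of_nonneg_right ?_ (hΨ.nonneg _)
      exact_mod_cast le_max_left _ _
    · rw [mul_zero]; positivity

omit hτ in
-- Adding and subtracting p_k² in tr(K g²) - tr(K g K g) separates the Bernoulli variances p_k(1 -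
-- p_k) from the Dirichlet integral.
theorem trace_gram_eq (g : ℝ → ℝ) (M : ℕ) :
    (gram (weighted (eig Ψ τ α N) (hermiteScaled N) M) fun x => g x ^ 2).trace
      - (gram (weighted (eig Ψ τ α N) (hermiteScaled N) M) g *
        gram (weighted (eig Ψ τ α N) (hermiteScaled N) M) g).trace
    = (∑ k ∈ Finset.range M, eig Ψ τ α N k * (1 - eig Ψ τ α N k) *
        ∫ x, g x ^ 2 * hermiteScaled N k x ^ 2) + offDiagonal g N (eig Ψ τ α N) M := by
  set p := eig Ψ τ α N with hp
  have hp0 : ∀ k, 0 ≤ p k := fun k => hΨ.nonneg _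
  have e1 : ∀ (h : ℝ → ℝ) (j k : Fin M), gram (weighted p (hermiteScaled N) M) h j k
      = √(p j) * √(p k) * ∫ x, h x * (hermiteScaled N j x * hermiteScaled N k x) := by
    intro h j k
    rw [gram, Matrix.of_apply, ← integral_const_mul]
    congr 1
    ext x
    simp only [weighted]
    ring
  have e2 : (gram (weighted p (hermiteScaled N) M) fun x => g x ^ 2).trace
      = ∑ k ∈ Finset.range M, p k * ∫ x, g x ^ 2 * hermiteScaled N k x ^ 2 := by
    rw [Matrix.trace, ← Fin.sum_univ_eq_sum_range
      (fun k => p k * ∫ x, g x ^ 2 * hermiteScaled N k x ^ 2)]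
    refine Finset.sum_congr rfl fun k _ => ?_
    rw [Matrix.diag_apply, e1, Real.mul_self_sqrt (hp0 k)]
    simp only [sq]
  have e3 : (gram (weighted p (hermiteScaled N) M) g *
      gram (weighted p (hermiteScaled N) M) g).trace
      = ∑ j ∈ Finset.range M, ∑ k ∈ Finset.range M,
        p j * p k * (∫ x, g x * (hermiteScaled N j x * hermiteScaled N k x)) ^ 2 := by
    rw [Matrix.trace, ← Fin.sum_univ_eq_sum_range (fun j => ∑ k ∈ Finset.range M,
        p j * p k * (∫ x, g x * (hermiteScaled N j x * hermiteScaled N k x)) ^ 2)]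
    refine Finset.sum_congr rfl fun j _ => ?_
    rw [Matrix.diag_apply, Matrix.mul_apply, ← Fin.sum_univ_eq_sum_range (fun k =>
        p j * p k * (∫ x, g x * (hermiteScaled N j x * hermiteScaled N k x)) ^ 2)]
    refine Finset.sum_congr rfl fun k _ => ?_
    have hc : ∫ x, g x * (hermiteScaled N k x * hermiteScaled N j x)
        = ∫ x, g x * (hermiteScaled N j x * hermiteScaled N k x) := by
      congr 1; ext x; ring
    rw [e1, e1, hc]
    linear_combination (∫ x, g x * (hermiteScaled N j x * hermiteScaled N k x)) ^ 2 *
      (√(p k) * √(p k) * Real.mul_self_sqrt (hp0 j) + p j * Real.mul_self_sqrt (hp0 k))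
  rw [e2, e3, offDiagonal, ← add_sub_assoc, ← Finset.sum_add_distrib]
  congr 1
  exact Finset.sum_congr rfl fun k _ => by ring

/-- The eigenvalues split as b + c, with b flattened below the cut and c supported there with 0 ≤ c
≤ 1 - p_cut. The first is handled by Christoffel–Darboux, the second by its diagonal alone; (u + v)²
≤ 2u² + 2v² doubles the constants. -/
theorem offDiagonal_eig_le {g : ℝ → ℝ} (hgm : Measurable g) (hg : Integrable g)
    (hg2 : Integrable fun x => g x ^ 2)
    (hs : ∀ x, x ∉ Set.Icc (-(1 / 10)) (1 / 10) → g x = 0) (hS : gagliardo g ≠ ∞) (hN : 4 ≤ N)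
    {C : ℝ} (hC0 : 0 ≤ C) (hC : ∀ k : ℕ, k * eig Ψ τ α N k ≤ C * N) {M : ℕ} (hM : cut N < M) :
    offDiagonal g N (eig Ψ τ α N) M ≤ 16 * (gagliardo g).toReal
      + (2400 * C + 6 * N * (1 - eig Ψ τ α N (cut N))) * ∫ x, g x ^ 2 := by
  have hN0 : 0 < N := by linarith
  set p := eig Ψ τ α N with hp
  set m := cut N with hm
  have hanti : Antitone p := hΨ.eig_antitone hτ hN0
  have hp1 : ∀ k, p k ≤ 1 := fun k => hΨ.le_one _
  have hI : 0 ≤ ∫ x, g x ^ 2 := integral_nonneg fun _ => sq_nonneg _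
  set b : ℕ → ℝ := fun k => if k < M then p (max k m) else 0 with hb
  set c : ℕ → ℝ := fun k => if k < m then p k - p m else 0 with hc
  have hc0 : ∀ k, 0 ≤ c k := fun k => by
    simp only [hc]
    split_ifs with h
    · exact sub_nonneg.2 (hanti h.le)
    · exact le_rfl
  have e : offDiagonal g N p M = offDiagonal g N (fun k => b k + c k) M := by
    refine offDiagonal_congr fun k hk => ?_
    simp only [hb, hc, if_pos hk]
    split_ifs with h
    · rw [max_eq_right h.le]; ring
    · rw [max_eq_left (not_lt.1 h), add_zero]
  have h1 := (isCutoff_eig hΨ hτ hN0 hC0 hC hM).offDiagonal_le hN0 hgm hg hg2 hs hS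
  have h2 : offDiagonal g N c M ≤ 3 * N * (1 - p m) * ∫ x, g x ^ 2 := by
    have hA0 : ∀ k, 0 ≤ ∫ x, g x ^ 2 * hermiteScaled N k x ^ 2 := fun k =>
      integral_nonneg fun x => by positivity
    have hA : ∑ k ∈ Finset.range m, (∫ x, g x ^ 2 * hermiteScaled N k x ^ 2)
        ≤ 3 * N * ∫ x, g x ^ 2 := by
      have := sum_average_le hg2 (fun x => sq_nonneg (g x)) 0 N m
      simp only [average, neg_zero, Real.rpow_zero, mul_one] at this
      exact this.trans (mul_le_mul_of_nonneg_right (scale_mul_jac_le hN) hI)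
    calc offDiagonal g N c M
        ≤ ∑ k ∈ Finset.range M, c k ^ 2 * (∫ x, g x ^ 2 * hermiteScaled N k x ^ 2) :=
          offDiagonal_le_diagonal hc0 M
      _ = ∑ k ∈ Finset.range m, c k ^ 2 * (∫ x, g x ^ 2 * hermiteScaled N k x ^ 2) := by
          refine (Finset.sum_subset (Finset.range_subset_range.2 hM.le) fun k _ hk => ?_).symm
          simp only [hc, if_neg (Finset.mem_range.not.1 hk)]
          ring
      _ ≤ ∑ k ∈ Finset.range m, (1 - p m) * (∫ x, g x ^ 2 * hermiteScaled N k x ^ 2) := by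
          refine Finset.sum_le_sum fun k hk => mul_le_mul_of_nonneg_right ?_ (hA0 k)
          have h3 : c k ≤ 1 - p m := by
            simp only [hc, if_pos (Finset.mem_range.1 hk)]
            linarith [hp1 k]
          have h4 : 1 - p m ≤ 1 := sub_le_self 1 (hΨ.nonneg _)
          nlinarith [hc0 k]
      _ ≤ _ := by
          rw [← Finset.mul_sum]
          have := mul_le_mul_of_nonneg_left hA (sub_nonneg.2 (hp1 m))
          linarith
  have h3 := offDiagonal_add_le hg hg2 hN0 b c M
  rw [e]
  linarith

theorem variance_bounds {g : ℝ → ℝ} (hgm : Measurable g) (hg : Integrable g)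
    (hg2 : Integrable fun x => g x ^ 2)
    (hs : ∀ x, x ∉ Set.Icc (-(1 / 10)) (1 / 10) → g x = 0) (hS : gagliardo g ≠ ∞) (hN : 4 ≤ N)
    {C : ℝ} (hC0 : 0 ≤ C) (hC : ∀ k : ℕ, k * eig Ψ τ α N k ≤ C * N) {v : ℝ}
    (hv : Tendsto (fun M => (gram (weighted (eig Ψ τ α N) (hermiteScaled N) M) fun x => g x ^ 2).trace
      - (gram (weighted (eig Ψ τ α N) (hermiteScaled N) M) g *
        gram (weighted (eig Ψ τ α N) (hermiteScaled N) M) g).trace) atTop (𝓝 v)) :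
    |v - ∑' k, eig Ψ τ α N k * (1 - eig Ψ τ α N k) * ∫ x, g x ^ 2 * hermiteScaled N k x ^ 2|
      ≤ 16 * (gagliardo g).toReal
        + (2400 * C + 6 * N * (1 - eig Ψ τ α N (cut N))) * ∫ x, g x ^ 2 := by
  have hN0 : 0 < N := by linarith
  have hsum := summable_diagonal hg2 (fun x => sq_nonneg (g x)) hΨ (α := α) (δ := 0)
    (Y := 1 / 10) hτ hN0 (fun y hy => by rw [hs y hy]; ring)
  simp only [average, neg_zero, Real.rpow_zero, mul_one] at hsum
  have h := (hv.congr (trace_gram_eq hΨ g)).sub hsum.hasSum.tendsto_sum_nat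
  simp only [add_sub_cancel_left] at h
  refine le_of_tendsto h.abs ?_
  filter_upwards [eventually_gt_atTop (cut N)] with M hM
  rw [abs_of_nonneg (offDiagonal_nonneg hg hg2 hN0 _ M)]
  exact offDiagonal_eig_le hΨ hτ hgm hg hg2 hs hS hN hC0 hC hM

end Variance

/-! ### Test functions: dilation, Lipschitz maps, null sets. -/

section TestFunction

/-- Measurable functions in `H^{1/2}` that vanish outside `[-Y, Y]`. -/
structure IsTest (Y : ℝ) (g : ℝ → ℝ) : Prop where
  measurable : Measurable g
  memLp : MemLp g 2
  zero : ∀ y, y ∉ Set.Icc (-Y) Y → g y = 0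
  gagliardo_ne_top : gagliardo g ≠ ∞

namespace IsTest

variable {Y : ℝ} {g : ℝ → ℝ} (hg : IsTest Y g)
include hg

theorem integrable : Integrable g := integrable_of_sq hg.memLp hg.zero

theorem integrable_sq : Integrable fun x => g x ^ 2 := hg.memLp.integrable_sq

theorem mono {Z : ℝ} (hZ : Y ≤ Z) : IsTest Z g where
  measurable := hg.measurable
  memLp := hg.memLp
  zero y hy := hg.zero y fun h => hy ⟨by linarith [h.1], h.2.trans hZ⟩
  gagliardo_ne_top := hg.gagliardo_ne_top

theorem rescale {N : ℝ} (hN : 0 < N) (δ : ℝ) : IsTest (Y * N ^ (-δ)) (rescale g N δ) where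
  measurable := hg.measurable.comp (by fun_prop)
  memLp := by
    have hp := Real.rpow_pos_of_pos hN δ
    rw [memLp_two_iff_integrable_sq]
    · exact hg.integrable_sq.comp_mul_right' hp.ne'
    · exact (hg.measurable.comp (by fun_prop : Measurable fun x : ℝ => x * N ^ δ)).aestronglyMeasurable
  zero y hy := by
    have hp := Real.rpow_pos_of_pos hN δ
    refine hg.zero _ fun h => hy ?_
    rw [Set.mem_Icc, ← abs_le] at h ⊢
    rw [abs_mul, abs_of_pos hp] at h
    rwa [Real.rpow_neg hN.le, ← div_eq_mul_inv, le_div_iff₀ hp]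
  gagliardo_ne_top := by
    have := gagliardo_comp_mul g (Real.rpow_pos_of_pos hN δ)
    unfold ModifiedGUE.rescale
    rw [this]
    exact hg.gagliardo_ne_top

/-- A 1-Lipschitz map fixing 0 decreases all difference quotients; this keeps truncations in
H^{1/2}. -/
theorem comp {F : ℝ → ℝ} (hF : ∀ a b, |F a - F b| ≤ |a - b|) (hF0 : F 0 = 0) :
    IsTest Y fun x => F (g x) where
  measurable := by
    have : LipschitzWith 1 F := LipschitzWith.of_dist_le_mul fun a b => by
      simpa [Real.dist_eq] using hF a b
    exact this.continuous.measurable.comp hg.measurable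
  memLp := by
    have : LipschitzWith 1 F := LipschitzWith.of_dist_le_mul fun a b => by
      simpa [Real.dist_eq] using hF a b
    exact this.comp_memLp hF0 hg.memLp
  zero y hy := by rw [hg.zero y hy, hF0]
  gagliardo_ne_top := by
    refine ne_top_of_le_ne_top hg.gagliardo_ne_top (lintegral_mono fun x => lintegral_mono fun y =>
      ENNReal.ofReal_le_ofReal (sq_le_sq.2 ?_))
    rw [abs_div, abs_div]
    exact div_le_div_of_nonneg_right (hF _ _) (abs_nonneg _)

end IsTest

theorem integral_rescale_sq_mul {N : ℝ} (hN : 0 < N) (δ : ℝ) (g : ℝ → ℝ) (k : ℕ) :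
    ∫ x, rescale g N δ x ^ 2 * hermiteScaled N k x ^ 2
      = N ^ (-δ) * average (fun y => g y ^ 2) δ N k := by
  have hp := Real.rpow_pos_of_pos hN δ
  have h := Measure.integral_comp_mul_right
    (fun y => g y ^ 2 * hermiteScaled N k (y * N ^ (-δ)) ^ 2) (N ^ δ)
  rw [abs_of_pos (inv_pos.2 hp), smul_eq_mul, ← Real.rpow_neg hN.le] at h
  rw [average, ← h]
  congr 1
  ext x
  rw [mul_assoc x, ← Real.rpow_add hN, add_neg_cancel, Real.rpow_zero, mul_one]
  rfl

theorem integral_rescale_sq {N : ℝ} (hN : 0 < N) (δ : ℝ) (g : ℝ → ℝ) :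
    ∫ x, rescale g N δ x ^ 2 = N ^ (-δ) * ∫ y, g y ^ 2 := by
  have hp := Real.rpow_pos_of_pos hN δ
  have h := Measure.integral_comp_mul_right (fun y => g y ^ 2) (N ^ δ)
  rwa [abs_of_pos (inv_pos.2 hp), smul_eq_mul, ← Real.rpow_neg hN.le] at h

/-- The expected number of points in a null set is the integral of the one-point correlation
function over it, which is 0. -/
theorem PointProcess.ae_notMem_of_null {Ω : Type*} [MeasurableSpace Ω] (Ξ : PointProcess Ω)
    {P : Measure Ω} {ρ : (Fin 1 → ℝ) → ℝ} (hρ : Ξ.IsCorrelationFunction P 1 ρ) {B : Set ℝ}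
    (hB : volume B = 0) : ∀ᵐ ω ∂P, ∀ x ∈ Ξ.points ω, x ∉ B := by
  wlog hBm : MeasurableSet B generalizing B
  · have := this (B := toMeasurable volume B) (by rwa [measure_toMeasurable])
      (measurableSet_toMeasurable _ _)
    filter_upwards [this] with ω h x hx hxB using h x hx (subset_toMeasurable _ _ hxB)
  set E : Set Ω := {ω | (Ξ.points ω ∩ B).encard ≠ 0} with hE
  have hEm : MeasurableSet E :=
    (Ξ.measurable_count B hBm) (measurableSet_singleton (0 : ℕ∞)).compl
  set F : (Fin 1 → ℝ) → ℝ≥0∞ := fun x => B.indicator 1 (x 0) with hF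
  have hFm : Measurable F := (measurable_one.indicator hBm).comp (measurable_pi_apply 0)
  have h0 : ∫⁻ x, F x * ENNReal.ofReal (ρ x) = 0 := by
    have hnull : volume ((fun x : Fin 1 → ℝ => x 0) ⁻¹' B) = 0 :=
      (Measure.quasiMeasurePreserving_eval (fun _ : Fin 1 => (volume : Measure ℝ)) 0).preimage_null hB
    refine (lintegral_congr_ae ?_).trans lintegral_zero
    filter_upwards [compl_mem_ae_iff.2 hnull] with x hx
    have hx' : x 0 ∉ B := hx
    have : F x = 0 := Set.indicator_of_notMem hx' _
    rw [this, zero_mul]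
  have h1 : P E = 0 := by
    rw [← lintegral_indicator_one hEm, ← nonpos_iff_eq_zero, ← h0, ← hρ.2 F hFm]
    refine lintegral_mono fun ω => ?_
    by_cases hω : ω ∈ E
    · obtain ⟨x, hx, hxB⟩ := Set.encard_ne_zero.1 hω
      rw [Set.indicator_of_mem hω]
      refine le_trans ?_ (ENNReal.le_tsum ⟨fun _ => x, Function.injective_of_subsingleton _,
        fun _ => hx⟩)
      rw [hF]
      simp [hxB]
    · rw [Set.indicator_of_notMem hω]; exact zero_le
  filter_upwards [compl_mem_ae_iff.2 h1] with ω hω x hx hxB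
  exact hω (Set.encard_ne_zero.2 ⟨x, hx, hxB⟩)

end TestFunction

/-! ### Asymptotics of the variance. -/

section Asymptotics

variable {Ψ : ℝ → ℝ} (hΨ : IsShape Ψ) {τ α δ : ℝ} (hτ : 0 < τ) (hδ : 0 < δ) (hδα : δ < α)
  (hα : α < 1)
  {Ω : Set.Ioi (0 : ℝ) → Type*} [∀ N, MeasurableSpace (Ω N)]
  {P : ∀ N, Measure (Ω N)} [∀ N, IsProbabilityMeasure (P N)]
  {Ξ : ∀ N, PointProcess (Ω N)}
  (hΞ : ∀ N, (Ξ N).IsDeterminantal (P N) (kernel Ψ τ α N))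

/-- The linear statistic of a rescaled test function that vanishes outside `[-Y, Y]`. -/
def stat (Ξ : ∀ N, PointProcess (Ω N)) (Y δ : ℝ) (g : ℝ → ℝ) (N : Set.Ioi (0 : ℝ)) (ω : Ω N) : ℝ :=
  ∑ x ∈ (Ξ N).pointsIn (Y * (N : ℝ) ^ (-δ)) ω, rescale g N δ x

variable {Y : ℝ} {g : ℝ → ℝ} (hg : IsTest Y g)

include hΨ hτ hΞ hg

theorem memLp_stat (δ : ℝ) (N : Set.Ioi (0 : ℝ)) : MemLp (stat Ξ Y δ g N) 2 (P N) :=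
  have hr := hg.rescale N.2 δ
  ((hΨ.isSpectral hτ N.2).moments (hΞ N) hr.measurable hr.zero hr.memLp).1

include hδ hδα hα

/-- The variance of the linear statistics. -/
theorem tendsto_variance_stat :
    Tendsto (fun N : Set.Ioi (0 : ℝ) => (N : ℝ) ^ (-(α - δ)) * variance (stat Ξ Y δ g N) (P N))
      atTop (𝓝 (τ / 2 * shapeConst Ψ * ∫ x, g x ^ 2)) := by
  obtain ⟨C, hC0, hC⟩ := exists_mul_eig_le hΨ hτ hα
  have hα0 : 0 < α := hδ.trans hδα
  have hD := tendsto_diagonal hg.integrable_sq (fun y => sq_nonneg (g y)) hΨ hτ hα0 hα hδ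
    (hδα.trans hα) (Y := Y) fun y hy => by rw [hg.zero y hy]; ring
  -- This is the error of `variance_bounds` divided by N^(α-δ): the seminorm does not change under
  -- dilation and ∫ g_δ² = N^(-δ) ∫ g².
  have hE : Tendsto (fun N : ℝ => 16 * (gagliardo g).toReal * N ^ (-(α - δ))
      + (2400 * C * N ^ (-α) + 6 * (N ^ (1 - α) * (1 - eig Ψ τ α N (cut N)))) * ∫ x, g x ^ 2)
      atTop (𝓝 0) := by
    have := ((tendsto_rpow_neg_atTop (sub_pos.2 hδα)).const_mul (16 * (gagliardo g).toReal)).add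
      ((((tendsto_rpow_neg_atTop hα0).const_mul (2400 * C)).add
        ((tendsto_one_sub_eig_cut hΨ hτ hα).const_mul 6)).mul_const (∫ x, g x ^ 2))
    simpa using this
  rw [← tendsto_comp_val_Ioi_atTop (a := (0 : ℝ))] at hD hE
  refine tendsto_of_tendsto_of_dist hD (squeeze_zero' (Eventually.of_forall fun _ => dist_nonneg)
    ?_ hE)
  have hev : ∀ᶠ N : ℝ in atTop, 4 ≤ N ∧ Y * N ^ (-δ) ≤ 1 / 10 :=
    (eventually_ge_atTop 4).and (eventually_mul_rpow_neg_le hδ Y (by norm_num))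
  have hev' : ∀ᶠ N : Set.Ioi (0 : ℝ) in atTop, 4 ≤ (N : ℝ) ∧ Y * (N : ℝ) ^ (-δ) ≤ 1 / 10 :=
    (tendsto_comp_val_Ioi_atTop.2 tendsto_id).eventually hev
  filter_upwards [hev'] with N hN
  have hN0 : 0 < (N : ℝ) := N.2
  have hr := hg.rescale hN0 δ
  have hv := ((hΨ.isSpectral hτ hN0).moments (hΞ N) hr.measurable hr.zero hr.memLp).2.2
  have hb := variance_bounds hΨ hτ hr.measurable hr.integrable hr.integrable_sq
    (hr.mono hN.2).zero hr.gagliardo_ne_top hN.1 hC0 (hC N (by linarith [hN.1])) hv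
  simp only [integral_rescale_sq_mul hN0, integral_rescale_sq hN0] at hb
  have e1 : ∀ k, eig Ψ τ α N k * (1 - eig Ψ τ α N k) *
      ((N : ℝ) ^ (-δ) * average (fun y => g y ^ 2) δ N k)
      = (N : ℝ) ^ (-δ) * (eig Ψ τ α N k * (1 - eig Ψ τ α N k) *
        average (fun y => g y ^ 2) δ N k) := fun k => by ring
  have e2 : gagliardo (rescale g N δ) = gagliardo g :=
    gagliardo_comp_mul g (Real.rpow_pos_of_pos hN0 δ)
  have e3 : (N : ℝ) ^ (-α) = (N : ℝ) ^ (-(α - δ)) * (N : ℝ) ^ (-δ) := by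
    rw [← Real.rpow_add hN0]; congr 1; ring
  have e4 : (N : ℝ) ^ (1 - α) = N * (N : ℝ) ^ (-α) := by
    rw [sub_eq_add_neg, Real.rpow_add hN0, Real.rpow_one]
  simp only [e1] at hb
  rw [tsum_mul_left, e2] at hb
  have hp := Real.rpow_pos_of_pos hN0 (-(α - δ))
  rw [dist_comm, Real.dist_eq, e4, e3, mul_assoc, ← mul_sub, abs_mul, abs_of_pos hp]
  refine (mul_le_mul_of_nonneg_left hb hp.le).trans (le_of_eq ?_)
  ring

end Asymptotics

/-! ### Central limit theorem: bounded functions, then truncation. -/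

section CentralLimit

theorem norm_exp_sub_exp_le (a b : ℝ) :
    ‖Complex.exp (a * Complex.I) - Complex.exp (b * Complex.I)‖ ≤ |a - b| := by
  have h : Complex.exp (a * Complex.I) - Complex.exp (b * Complex.I)
      = Complex.exp (Complex.I * b) * (Complex.exp (Complex.I * ((a - b : ℝ) : ℂ)) - 1) := by
    rw [mul_sub, ← Complex.exp_add, mul_one]
    congr 2
    · push_cast; ring
    · ring
  rw [h, norm_mul, Complex.norm_exp_I_mul_ofReal, one_mul]
  exact Real.norm_exp_I_mul_ofReal_sub_one_le

/-- The map x ↦ e^{ix} is 1-Lipschitz, and the L¹ norm is at most the L² norm because the variance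
of |U - V| is nonnegative. -/
theorem norm_charFun_sub_le {Ω : Type*} [MeasurableSpace Ω] {P : Measure Ω}
    [IsProbabilityMeasure P] {U V : Ω → ℝ} (hU : MemLp U 2 P) (hV : MemLp V 2 P) (t : ℝ) :
    ‖(∫ ω, Complex.exp (t * U ω * Complex.I) ∂P) - ∫ ω, Complex.exp (t * V ω * Complex.I) ∂P‖
      ≤ |t| * √(∫ ω, (U ω - V ω) ^ 2 ∂P) := by
  have hi : ∀ W : Ω → ℝ, MemLp W 2 P →
      Integrable (fun ω => Complex.exp (t * W ω * Complex.I)) P := fun W hW => by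
    have hm : AEStronglyMeasurable (fun ω => Complex.exp (t * W ω * Complex.I)) P := by
      have h1 := hW.aestronglyMeasurable.aemeasurable
      exact AEMeasurable.aestronglyMeasurable (by fun_prop)
    refine Integrable.of_bound hm 1 (ae_of_all _ fun ω => ?_)
    rw [← Complex.ofReal_mul, Complex.norm_exp_ofReal_mul_I]
  have hd : MemLp (fun ω => |U ω - V ω|) 2 P := (hU.sub hV).norm
  have h1 : (∫ ω, |U ω - V ω| ∂P) ≤ √(∫ ω, (U ω - V ω) ^ 2 ∂P) := by
    refine Real.le_sqrt_of_sq_le ?_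
    have h2 := variance_nonneg (fun ω => |U ω - V ω|) P
    rw [variance_eq_sub hd] at h2
    simp only [Pi.pow_apply, sq_abs] at h2
    linarith
  rw [← integral_sub (hi U hU) (hi V hV)]
  calc _ ≤ ∫ ω, |t| * |U ω - V ω| ∂P := by
        refine norm_integral_le_of_norm_le ((hd.integrable one_le_two).const_mul _)
          (ae_of_all _ fun ω => ?_)
        rw [← Complex.ofReal_mul, ← Complex.ofReal_mul, ← abs_mul, mul_sub]
        exact norm_exp_sub_exp_le _ _
    _ ≤ _ := by
        rw [integral_const_mul]
        exact mul_le_mul_of_nonneg_left h1 (abs_nonneg t)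

/-- Truncation at height `R`. -/
def clamp (R x : ℝ) : ℝ := max (-R) (min R x)

theorem clamp_lipschitz (R a b : ℝ) : |clamp R a - clamp R b| ≤ |a - b| := by
  unfold clamp
  have h1 := abs_max_sub_max_le_max (-R) (min R a) (-R) (min R b)
  have h2 := abs_min_sub_min_le_max R a R b
  rw [sub_self, abs_zero, max_eq_right (abs_nonneg (min R a - min R b))] at h1
  rw [sub_self, abs_zero, max_eq_right (abs_nonneg (a - b))] at h2
  exact h1.trans h2

/-- Because `clamp` is nondecreasing and 1-Lipschitz, increments of the identity exceed its
increments by an amount between 0 and the full increment. -/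
theorem sub_clamp_lipschitz (R a b : ℝ) : |(a - clamp R a) - (b - clamp R b)| ≤ |a - b| := by
  wlog h : b ≤ a generalizing a b
  · rw [abs_sub_comm, abs_sub_comm a]
    exact this b a (not_le.1 h).le
  have h1 := (abs_le.1 (clamp_lipschitz R a b)).2
  have h2 : clamp R b ≤ clamp R a := max_le_max_left _ (min_le_min_left _ h)
  rw [abs_of_nonneg (sub_nonneg.2 h)] at h1 ⊢
  rw [abs_le]
  constructor <;> linarith

theorem clamp_zero {R : ℝ} (hR : 0 ≤ R) : clamp R 0 = 0 := by
  rw [clamp, min_eq_right hR, max_eq_right (by linarith)]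

theorem abs_clamp_le {R : ℝ} (hR : 0 ≤ R) (x : ℝ) : |clamp R x| ≤ R :=
  abs_le.2 ⟨le_max_left _ _, max_le (by linarith) (min_le_left _ _)⟩

theorem abs_clamp_le_abs {R : ℝ} (hR : 0 ≤ R) (x : ℝ) : |clamp R x| ≤ |x| := by
  simpa [clamp_zero hR] using clamp_lipschitz R x 0

theorem clamp_of_abs_le {R x : ℝ} (h : |x| ≤ R) : clamp R x = x := by
  rw [abs_le] at h
  rw [clamp, min_eq_right h.2, max_eq_right h.1]

theorem tendsto_integral_clamp_sq {g : ℝ → ℝ} (hg : Measurable g)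
    (hg2 : Integrable fun x => g x ^ 2) :
    Tendsto (fun n : ℕ => ∫ x, clamp n (g x) ^ 2) atTop (𝓝 (∫ x, g x ^ 2)) ∧
    Tendsto (fun n : ℕ => ∫ x, (g x - clamp n (g x)) ^ 2) atTop (𝓝 0) := by
  have hm : ∀ n : ℕ, Measurable fun x => clamp n (g x) := fun n => by
    unfold clamp; fun_prop
  have hev : ∀ x, ∀ᶠ n : ℕ in atTop, clamp n (g x) = g x := fun x => by
    filter_upwards [eventually_ge_atTop ⌈|g x|⌉₊] with n hn
    exact clamp_of_abs_le (Nat.ceil_le.1 hn)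
  constructor
  · refine tendsto_integral_of_dominated_convergence (fun x => g x ^ 2)
      (fun n => ((hm n).pow_const 2).aestronglyMeasurable) hg2 (fun n => ae_of_all _ fun x => ?_)
      (ae_of_all _ fun x => ?_)
    · rw [Real.norm_eq_abs, abs_of_nonneg (sq_nonneg _)]
      exact sq_le_sq.2 (abs_clamp_le_abs n.cast_nonneg _)
    · refine tendsto_const_nhds.congr' ?_
      filter_upwards [hev x] with n hn
      rw [hn]
  · have h0 : ∫ _x : ℝ, (0 : ℝ) = 0 := integral_zero _ _
    rw [← h0]
    refine tendsto_integral_of_dominated_convergence (fun x => g x ^ 2)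
      (fun n => ((hg.sub (hm n)).pow_const 2).aestronglyMeasurable) hg2
      (fun n => ae_of_all _ fun x => ?_) (ae_of_all _ fun x => ?_)
    · rw [Real.norm_eq_abs, abs_of_nonneg (sq_nonneg _)]
      refine sq_le_sq.2 ?_
      simpa [clamp_zero n.cast_nonneg] using sub_clamp_lipschitz n (g x) 0
    · refine tendsto_const_nhds.congr' ?_
      filter_upwards [hev x] with n hn
      rw [hn, sub_self, sq, mul_zero]

variable {Ψ : ℝ → ℝ} (hΨ : IsShape Ψ) {τ α δ : ℝ} (hτ : 0 < τ) (hδ : 0 < δ) (hδα : δ < α)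
  (hα : α < 1)
  {Ω : Set.Ioi (0 : ℝ) → Type*} [∀ N, MeasurableSpace (Ω N)]
  {P : ∀ N, Measure (Ω N)} [∀ N, IsProbabilityMeasure (P N)]
  {Ξ : ∀ N, PointProcess (Ω N)}
  (hΞ : ∀ N, (Ξ N).IsDeterminantal (P N) (kernel Ψ τ α N))

/-- The centered linear statistic, normalized. -/
def normalized (Ξ : ∀ N, PointProcess (Ω N)) (P : ∀ N, Measure (Ω N)) (α δ Y : ℝ) (g : ℝ → ℝ)
    (N : Set.Ioi (0 : ℝ)) (ω : Ω N) : ℝ :=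
  (N : ℝ) ^ (-((α - δ) / 2)) * (stat Ξ Y δ g N ω - ∫ ω', stat Ξ Y δ g N ω' ∂(P N))

variable {Y : ℝ} {g : ℝ → ℝ} (hg : IsTest Y g)

include hΨ hτ hΞ hg

theorem memLp_normalized (N : Set.Ioi (0 : ℝ)) : MemLp (normalized Ξ P α δ Y g N) 2 (P N) :=
  ((memLp_stat hΨ hτ hΞ hg δ N).sub (memLp_const _)).const_mul _

theorem integral_normalized_sq (N : Set.Ioi (0 : ℝ)) :
    ∫ ω, normalized Ξ P α δ Y g N ω ^ 2 ∂(P N)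
      = (N : ℝ) ^ (-(α - δ)) * variance (stat Ξ Y δ g N) (P N) := by
  have hN : 0 < (N : ℝ) := N.2
  rw [variance_eq_integral (memLp_stat hΨ hτ hΞ hg δ N).aestronglyMeasurable.aemeasurable,
    ← integral_const_mul]
  congr 1
  ext ω
  rw [normalized, mul_pow, ← Real.rpow_natCast, ← Real.rpow_mul hN.le]
  congr 2
  push_cast
  ring

include hδ hδα hα

/-- In `log_mgf_bound` at s·N^(-(α-δ)/2) the exponential factors tend to 1, so both bounds tend to
s²/2 times the limiting variance. -/
theorem tendsto_mgf_normalized {R : ℝ} (hR : ∀ x, |g x| ≤ R) (s : ℝ) :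
    Tendsto (fun N => ∫ ω, Real.exp (s * normalized Ξ P α δ Y g N ω) ∂(P N)) atTop
      (𝓝 (Real.exp (τ / 2 * shapeConst Ψ * (∫ x, g x ^ 2) * s ^ 2 / 2))) := by
  have hV := tendsto_variance_stat hΨ hτ hδ hδα hα hΞ hg
  set v := τ / 2 * shapeConst Ψ * ∫ x, g x ^ 2
  set a : Set.Ioi (0 : ℝ) → ℝ := fun N => (N : ℝ) ^ (-((α - δ) / 2)) with ha
  have ha0 : Tendsto a atTop (𝓝 0) := (tendsto_comp_val_Ioi_atTop (a := (0 : ℝ))).2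
    (tendsto_rpow_neg_atTop (by linarith : 0 < (α - δ) / 2))
  have ha2 : ∀ N : Set.Ioi (0 : ℝ), a N ^ 2 = (N : ℝ) ^ (-(α - δ)) := fun N => by
    have hN : 0 < (N : ℝ) := N.2
    rw [ha, ← Real.rpow_natCast, ← Real.rpow_mul hN.le]
    congr 1
    push_cast
    ring
  set X := stat Ξ Y δ g
  have key : ∀ N, Integrable (fun ω => Real.exp (s * a N * X N ω)) (P N) ∧
      (s * a N) ^ 2 / 2 * (variance (X N) (P N) * Real.exp (-(2 * R * |s * a N|)))
      ≤ Real.log (∫ ω, Real.exp (s * a N * X N ω) ∂(P N)) - s * a N * ∫ ω, X N ω ∂(P N) ∧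
      Real.log (∫ ω, Real.exp (s * a N * X N ω) ∂(P N)) - s * a N * ∫ ω, X N ω ∂(P N)
      ≤ (s * a N) ^ 2 / 2 * (variance (X N) (P N) * Real.exp (2 * R * |s * a N|)) := fun N =>
    have hr := hg.rescale N.2 δ
    (hΨ.isSpectral hτ N.2).log_mgf_bound (hΞ N) hr.measurable hr.zero
      (fun x => hR (x * (N : ℝ) ^ δ)) (s * a N)
  have e1 : ∀ N, ∫ ω, Real.exp (s * normalized Ξ P α δ Y g N ω) ∂(P N)
      = Real.exp (Real.log (∫ ω, Real.exp (s * a N * X N ω) ∂(P N))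
        - s * a N * ∫ ω, X N ω ∂(P N)) := fun N => by
    rw [Real.exp_sub, Real.exp_log (integral_exp_pos (key N).1), div_eq_mul_inv, ← Real.exp_neg,
      ← integral_mul_const]
    congr 1
    ext ω
    rw [← Real.exp_add, normalized]
    congr 1
    simp only [ha, X]
    ring
  simp only [e1]
  refine (Real.continuous_exp.tendsto _).comp ?_
  have hexp : ∀ c : ℝ, Tendsto (fun N => Real.exp (c * |s * a N|)) atTop (𝓝 1) := fun c => by
    have h1 : Tendsto (fun N => c * |s * a N|) atTop (𝓝 0) := by
      simpa using ((ha0.const_mul s).abs).const_mul c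
    have h2 := (Real.continuous_exp.tendsto 0).comp h1
    rwa [Real.exp_zero] at h2
  have hb : ∀ c : ℝ, Tendsto (fun N => (s * a N) ^ 2 / 2 *
      (variance (X N) (P N) * Real.exp (c * |s * a N|))) atTop (𝓝 (v * s ^ 2 / 2)) := fun c => by
    have h1 := (hV.mul (hexp c)).const_mul (s ^ 2 / 2)
    rw [mul_one, mul_comm, ← mul_div_assoc] at h1
    refine h1.congr fun N => ?_
    rw [mul_pow, ha2]
    ring
  refine tendsto_of_tendsto_of_tendsto_of_le_of_le (hb (-(2 * R))) (hb (2 * R)) (fun N => ?_)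
    fun N => (key N).2.2
  have := (key N).2.1
  rwa [← neg_mul] at this

theorem tendsto_charFun_normalized_of_bounded {R : ℝ} (hR : ∀ x, |g x| ≤ R) (t : ℝ) :
    Tendsto (fun N => ∫ ω, Complex.exp (t * normalized Ξ P α δ Y g N ω * Complex.I) ∂(P N)) atTop
      (𝓝 (Complex.exp (-((τ / 2 * shapeConst Ψ * ∫ x, g x ^ 2 : ℝ) * t ^ 2 / 2)))) := by
  have hI : ∀ N, ∀ s : ℝ,
      Integrable (fun ω => Real.exp (s * normalized Ξ P α δ Y g N ω)) (P N) := fun N s => by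
    have hr := hg.rescale N.2 δ
    have h := ((hΨ.isSpectral hτ N.2).log_mgf_bound (hΞ N) hr.measurable hr.zero
      (fun x => hR (x * (N : ℝ) ^ δ)) (s * (N : ℝ) ^ (-((α - δ) / 2)))).1
    refine (h.mul_const (Real.exp (-(s * (N : ℝ) ^ (-((α - δ) / 2)) *
      ∫ ω, stat Ξ Y δ g N ω ∂(P N))))).congr (ae_of_all _ fun ω => ?_)
    beta_reduce
    rw [← Real.exp_add, normalized]
    congr 1
    rw [stat]
    ring
  have h := tendsto_charFun_of_tendsto_mgf (P := P) (Y := normalized Ξ P α δ Y g)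
    (fun N => (memLp_normalized hΨ hτ hΞ hg N).aestronglyMeasurable.aemeasurable) hI
    (tendsto_mgf_normalized hΨ hτ hδ hδα hα hΞ hg hR) t
  simpa only [mul_right_comm] using h

/-- Approximate g by its truncation at height n. The remainder is again a test function, so its
normalized variance tends to c ∫ (g - clamp n g)², small for large n; the truncated statistic is
covered by the bounded case. The height n is fixed before N tends to infinity. -/
theorem tendsto_charFun_normalized (t : ℝ) :
    Tendsto (fun N => ∫ ω, Complex.exp (t * normalized Ξ P α δ Y g N ω * Complex.I) ∂(P N)) atTop
      (𝓝 (Complex.exp (-((τ / 2 * shapeConst Ψ * ∫ x, g x ^ 2 : ℝ) * t ^ 2 / 2)))) := by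
  set c := τ / 2 * shapeConst Ψ
  obtain ⟨l1, l2⟩ := tendsto_integral_clamp_sq hg.measurable hg.integrable_sq
  have hF : ∀ n : ℕ, IsTest Y fun x => clamp n (g x) := fun n =>
    hg.comp (clamp_lipschitz n) (clamp_zero n.cast_nonneg)
  have hG : ∀ n : ℕ, IsTest Y fun x => g x - clamp n (g x) := fun n =>
    hg.comp (F := fun x => x - clamp n x) (sub_clamp_lipschitz n)
      (by rw [clamp_zero n.cast_nonneg, sub_zero])
  have hsub : ∀ (n : ℕ) N ω, normalized Ξ P α δ Y g N ω
      - normalized Ξ P α δ Y (fun x => clamp n (g x)) N ω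
      = normalized Ξ P α δ Y (fun x => g x - clamp n (g x)) N ω := fun n N ω => by
    have e : ∀ ω, stat Ξ Y δ (fun x => g x - clamp n (g x)) N ω
        = stat Ξ Y δ g N ω - stat Ξ Y δ (fun x => clamp n (g x)) N ω := fun ω => by
      simp only [stat, rescale, Finset.sum_sub_distrib]
    simp only [normalized, e]
    rw [integral_sub ((memLp_stat hΨ hτ hΞ hg δ N).integrable one_le_two)
      ((memLp_stat hΨ hτ hΞ (hF n) δ N).integrable one_le_two)]
    ring
  have m1 : Tendsto (fun n : ℕ => |t| * √(c * ∫ x, (g x - clamp n (g x)) ^ 2)) atTop (𝓝 0) := by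
    simpa using ((l2.const_mul c).sqrt).const_mul |t|
  have m2 : Tendsto (fun n : ℕ => Complex.exp (-((c * ∫ x, clamp n (g x) ^ 2 : ℝ) * t ^ 2 / 2)))
      atTop (𝓝 (Complex.exp (-((c * ∫ x, g x ^ 2 : ℝ) * t ^ 2 / 2)))) := by
    refine (Complex.continuous_exp.tendsto _).comp ?_
    exact ((((Complex.continuous_ofReal.tendsto _).comp (l1.const_mul c)).mul_const _).div_const
      _).neg
  rw [Metric.tendsto_nhds]
  intro ε hε
  have hε3 : 0 < ε / 3 := by positivity
  obtain ⟨n, hn1, hn2⟩ := ((m1.eventually (eventually_lt_nhds hε3)).and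
    ((Metric.tendsto_nhds.1 m2) _ hε3)).exists
  have hV := ((tendsto_variance_stat hΨ hτ hδ hδα hα hΞ (hG n)).sqrt).const_mul |t|
  have hC := tendsto_charFun_normalized_of_bounded hΨ hτ hδ hδα hα hΞ (hF n)
    (fun x => abs_clamp_le n.cast_nonneg (g x)) t
  filter_upwards [hV.eventually (eventually_lt_nhds hn1), (Metric.tendsto_nhds.1 hC) _ hε3]
    with N h1 h2
  have h3 := norm_charFun_sub_le (memLp_normalized (α := α) (δ := δ) hΨ hτ hΞ hg N)
    (memLp_normalized (α := α) (δ := δ) hΨ hτ hΞ (hF n) N) t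
  simp only [hsub] at h3
  rw [integral_normalized_sq hΨ hτ hΞ (hG n) N] at h3
  rw [← dist_eq_norm] at h3
  have h4 := dist_triangle4 (∫ ω, Complex.exp (t * normalized Ξ P α δ Y g N ω * Complex.I) ∂(P N))
    (∫ ω, Complex.exp (t * normalized Ξ P α δ Y (fun x => clamp n (g x)) N ω * Complex.I) ∂(P N))
    (Complex.exp (-((c * ∫ x, clamp n (g x) ^ 2 : ℝ) * t ^ 2 / 2)))
    (Complex.exp (-((c * ∫ x, g x ^ 2 : ℝ) * t ^ 2 / 2)))
  linarith

end CentralLimit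

/-! ### Reduction to measurable representatives and convergence in distribution. -/

section Reduction

theorem MemHHalf.exists_isTest {f : ℝ → ℝ} (hf : MemHHalf f) (hfc : HasCompactSupport f) :
    ∃ Y g, IsTest Y g ∧ f =ᵐ[volume] g ∧ ∀ y, y ∉ Set.Icc (-Y) Y → f y = 0 := by
  obtain ⟨Y, hY⟩ := hfc.isBounded.subset_closedBall 0
  rw [Real.closedBall_eq_Icc, zero_sub, zero_add] at hY
  have hz : ∀ y, y ∉ Set.Icc (-Y) Y → f y = 0 := fun y hy => by
    by_contra h
    exact hy (hY (subset_tsupport f h))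
  have hm := hf.memLp.aestronglyMeasurable.aemeasurable
  have he : f =ᵐ[volume] (Set.Icc (-Y) Y).indicator (hm.mk f) := by
    filter_upwards [hm.ae_eq_mk] with x hx
    by_cases h : x ∈ Set.Icc (-Y) Y
    · rw [Set.indicator_of_mem h, hx]
    · rw [Set.indicator_of_notMem h, hz x h]
  refine ⟨Y, _, ⟨hm.measurable_mk.indicator measurableSet_Icc, hf.memLp.ae_eq he,
    fun y hy => Set.indicator_of_notMem hy _, ?_⟩, he, hz⟩
  have h : gagliardo ((Set.Icc (-Y) Y).indicator (hm.mk f)) = gagliardo f := by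
    refine lintegral_congr_ae ?_
    filter_upwards [he] with x hx
    refine lintegral_congr_ae ?_
    filter_upwards [he] with y hy
    rw [hx, hy]
  rw [h]
  exact hf.seminorm_lt_top.ne

variable {Ω : Set.Ioi (0 : ℝ) → Type*} [∀ N, MeasurableSpace (Ω N)]
  {P : ∀ N, Measure (Ω N)} {Ξ : ∀ N, PointProcess (Ω N)}

/-- Almost surely no point of the process falls in the null set where f and its measurable
representative differ after dilation. -/
theorem linearStatistic_ae_eq_stat {K : Set.Ioi (0 : ℝ) → ℝ → ℝ → ℝ}
    (hΞ : ∀ N, (Ξ N).IsDeterminantal (P N) (K N)) {f g : ℝ → ℝ} {Y : ℝ}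
    (hfg : f =ᵐ[volume] g) (hz : ∀ y, y ∉ Set.Icc (-Y) Y → f y = 0) (δ : ℝ)
    (N : Set.Ioi (0 : ℝ)) :
    (Ξ N).linearStatistic (rescale f N δ) =ᵐ[P N] stat Ξ Y δ g N := by
  have hN : 0 < (N : ℝ) := N.2
  have hp := Real.rpow_pos_of_pos hN δ
  have hB : volume ((fun x => x * (N : ℝ) ^ δ) ⁻¹' {y | f y ≠ g y}) = 0 := by
    rw [Real.volume_preimage_mul_right hp.ne', ae_iff.1 hfg, mul_zero]
  filter_upwards [(Ξ N).ae_notMem_of_null (hΞ N 1) hB] with ω hω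
  rw [(Ξ N).linearStatistic_eq_sum (L := Y * (N : ℝ) ^ (-δ)), stat]
  · refine Finset.sum_congr rfl fun x hx => ?_
    by_contra h
    exact hω x ((Ξ N).mem_pointsIn.1 hx).1 h
  · intro y hy
    refine hz _ fun h => hy ?_
    rw [Set.mem_Icc, ← abs_le] at h ⊢
    rw [abs_mul, abs_of_pos hp] at h
    rwa [Real.rpow_neg hN.le, ← div_eq_mul_inv, le_div_iff₀ hp]

theorem tendstoInDistribution_gaussian {ι : Type*} {l : Filter ι} [l.IsCountablyGenerated]
    {Ω : ι → Type*} [∀ i, MeasurableSpace (Ω i)] {P : ∀ i, Measure (Ω i)}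
    [∀ i, IsProbabilityMeasure (P i)] {X : ∀ i, Ω i → ℝ} (hX : ∀ i, AEMeasurable (X i) (P i))
    {v : ℝ} (hv : 0 ≤ v)
    (h : ∀ t : ℝ, Tendsto (fun i => ∫ ω, Complex.exp (t * X i ω * Complex.I) ∂(P i)) l
      (𝓝 (Complex.exp (-(v * t ^ 2 / 2))))) :
    TendstoInDistribution X l (id : ℝ → ℝ) P (gaussianReal 0 v.toNNReal) where
  forall_aemeasurable := hX
  aemeasurable_limit := aemeasurable_id
  tendsto := by
    -- Lévy's continuity theorem is applied along sequences, which suffice since the filter is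
    -- countably generated.
    refine tendsto_of_seq_tendsto fun u hu => ?_
    refine ProbabilityMeasure.tendsto_iff_tendsto_charFun.2 fun t => ?_
    have e1 : ∀ n, charFun ((P (u n)).map (X (u n))) t
        = ∫ ω, Complex.exp (t * X (u n) ω * Complex.I) ∂(P (u n)) := fun n => by
      rw [charFun_apply_real, integral_map (hX _) (by fun_prop)]
    have e2 : charFun ((gaussianReal 0 v.toNNReal).map (id : ℝ → ℝ)) t
        = Complex.exp (-(v * t ^ 2 / 2)) := by
      rw [Measure.map_id, charFun_gaussianReal]
      congr 1
      rw [Complex.ofReal_zero, mul_zero, zero_mul, zero_sub]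
      have : ((v.toNNReal : ℝ) : ℂ) = (v : ℂ) := by rw [Real.coe_toNNReal v hv]
      exact congrArg (fun z : ℂ => -(z * t ^ 2 / 2)) this
    have h1 := (h t).comp hu
    rw [ProbabilityMeasure.coe_mk, e2]
    exact h1.congr fun n => (e1 n).symm

end Reduction

end ModifiedGUE

end

theorem mainTheorem3
    (Ψ : ℝ → ℝ) (hΨ : ModifiedGUE.IsShape Ψ)
    (τ α δ : ℝ) (hτ : 0 < τ) (hδ : 0 < δ) (hδα : δ < α) (hα : α < 1)
    (f : ℝ → ℝ) (hf : ModifiedGUE.MemHHalf f) (hfc : HasCompactSupport f)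
    -- for every `N > 0`, a modified GUE with parameter `N`, on some probability space
    (Ω : Set.Ioi (0 : ℝ) → Type*) [∀ N, MeasurableSpace (Ω N)]
    (P : ∀ N, Measure (Ω N)) [∀ N, IsProbabilityMeasure (P N)]
    (Ξ : ∀ N, ModifiedGUE.PointProcess (Ω N))
    (hΞ : ∀ N, (Ξ N).IsDeterminantal (P N) (ModifiedGUE.kernel Ψ τ α N)) :
    -- `B²_Ψ` is finite and positive
    (Integrable (fun t => Ψ t * (1 - Ψ t)) ∧ 0 < ModifiedGUE.shapeConst Ψ) ∧
    -- the linear statistics have a finite variance, with the stated asymptotics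
    (∀ N, MemLp ((Ξ N).linearStatistic (ModifiedGUE.rescale f N δ)) 2 (P N)) ∧
    ((fun N : Set.Ioi (0 : ℝ) =>
        variance ((Ξ N).linearStatistic (ModifiedGUE.rescale f N δ)) (P N)
          - τ / 2 * (N : ℝ) ^ (α - δ) * ModifiedGUE.shapeConst Ψ * ∫ x, f x ^ 2)
      =o[atTop] fun N : Set.Ioi (0 : ℝ) => (N : ℝ) ^ (α - δ)) ∧
    -- the central limit theorem
    TendstoInDistribution
      (fun (N : Set.Ioi (0 : ℝ)) (ω : Ω N) =>
        (N : ℝ) ^ (-((α - δ) / 2)) *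
          ((Ξ N).linearStatistic (ModifiedGUE.rescale f N δ) ω
            - ∫ ω', (Ξ N).linearStatistic (ModifiedGUE.rescale f N δ) ω' ∂(P N)))
      atTop (id : ℝ → ℝ) P
      (gaussianReal 0 (τ / 2 * ModifiedGUE.shapeConst Ψ * ∫ x, f x ^ 2).toNNReal) := by
  obtain ⟨Y, g, hg, hfg, hz⟩ := hf.exists_isTest hfc
  have hst := ModifiedGUE.linearStatistic_ae_eq_stat hΞ hfg hz δ
  have hI : ∫ x, f x ^ 2 = ∫ x, g x ^ 2 := by
    refine integral_congr_ae ?_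
    filter_upwards [hfg] with x hx
    rw [hx]
  have hL := ModifiedGUE.memLp_stat hΨ hτ hΞ hg δ
  refine ⟨⟨hΨ.integrable, hΨ.shapeConst_pos⟩, fun N => (hL N).ae_eq (hst N).symm, ?_, ?_⟩
  · have hV := ModifiedGUE.tendsto_variance_stat hΨ hτ hδ hδα hα hΞ hg
    have hpos : ∀ N : Set.Ioi (0 : ℝ), 0 < (N : ℝ) ^ (α - δ) := fun N =>
      Real.rpow_pos_of_pos N.2 _
    refine isLittleO_of_tendsto' (Eventually.of_forall fun N h => absurd h (hpos N).ne') ?_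
    have h0 := hV.sub_const (τ / 2 * ModifiedGUE.shapeConst Ψ * ∫ x, g x ^ 2)
    rw [sub_self] at h0
    refine h0.congr fun N => ?_
    have hN : 0 < (N : ℝ) := N.2
    have := (hpos N).ne'
    rw [variance_congr (hst N), hI, Real.rpow_neg hN.le]
    field_simp
  · have hae : ∀ N : Set.Ioi (0 : ℝ), (fun ω => (N : ℝ) ^ (-((α - δ) / 2)) *
          ((Ξ N).linearStatistic (ModifiedGUE.rescale f N δ) ω
            - ∫ ω', (Ξ N).linearStatistic (ModifiedGUE.rescale f N δ) ω' ∂(P N)))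
        =ᵐ[P N] ModifiedGUE.normalized Ξ P α δ Y g N := fun N => by
      filter_upwards [hst N] with ω hω
      rw [ModifiedGUE.normalized, hω, integral_congr_ae (hst N)]
    have hv : 0 ≤ τ / 2 * ModifiedGUE.shapeConst Ψ * ∫ x, f x ^ 2 :=
      mul_nonneg (mul_nonneg (by linarith) hΨ.shapeConst_pos.le)
        (integral_nonneg fun _ => sq_nonneg _)
    refine ModifiedGUE.tendstoInDistribution_gaussian (fun N =>
      ((ModifiedGUE.memLp_normalized hΨ hτ hΞ hg N).ae_eq
        (hae N).symm).aestronglyMeasurable.aemeasurable) hv fun t => ?_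
    rw [hI]
    refine (ModifiedGUE.tendsto_charFun_normalized hΨ hτ hδ hδα hα hΞ hg t).congr fun N => ?_
    refine integral_congr_ae ?_
    filter_upwards [hae N] with ω hω
    rw [hω]
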